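/- An *unpointed Waldhausen category* is a small category $\mathcal C$ with two subcategories, the cofibrations $co\mathcal C$ (written $\rightarrowtail$) and the weak equivalences $w\mathcal C$, such that: both contain all isomorphisms; for any morphism $C\to X$ and any cofibration $C\rightarrowtail D$ the pushout $X\cup_C D$ exists and $X\to X\cup_C D$ is a cofibration; and the gluing lemma holds, i.e. a map of diagrams from $X\leftarrow C\rightarrowtail D$ to $X'\leftarrow C'\rightarrowtail D'$ whose three components are weak equivalences induces a weak equivalence $X\cup_C D\to X'\cup_{C'}D'$. It is an unpointed Waldhausen category *with initial object* if $\mathcal C$ has an initial object $\varnothing$ and $\varnothing\to X$ is a cofibration for every $X$; then $\mathcal C$ has finite coproducts. It *has functorial factorizations* if there are a functor $T$ from the arrow category $\mathcal C^{[1]}$ to $\mathcal C$ and factorizations $X\rightarrowtail T(f)\xrightarrow{\sim}Y$ of every morphism $f\colon X\to Y$ into a cofibration followed by a weak equivalence, natural in $f\in\mathcal C^{[1]}$, where $T$ takes objectwise weak equivalences of arrows to weak equivalences (this last condition is automatic if the weak equivalences satisfy the two-out-of-three property). Let $\mathrm{tw}[n]$ be the poset of pairs $(i\le j)$, $0\le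 i\le j\le n$, with a morphism $(i\le j)\to(i'\le j')$ iff $i'\le i$ and $j\le j'$. Let $w\mathrm{Cob}(\mathcal C)_n$ be the category whose objects are the functors $F\colon\mathrm{tw}[n]\to\mathcal C$, $(i\le j)\mapsto F_{ij}$, such that (i) $F_{ij}\to F_{ik}$ is a cofibration for all $i\le j\le k$, and (ii) for all $i\le j\le k\le l$ the square with vertices $F_{jk},F_{ik},F_{jl},F_{il}$ is a pushout; its morphisms are the natural transformations that are objectwise weak equivalences. If $\mathcal C$ has an initial object as above, let $w\mathrm{Cob}^{\mathrm{sym}}(\mathcal C)_n\subset w\mathrm{Cob}(\mathcal C)_n$ be the full subcategory of those $F$ for which, in addition, (iii) $F_{ii}\sqcup F_{i+1,i+1}\to F_{i,i+1}$ is a cofibration for each $0\le i<n$. The categories $w\mathrm{Cob}(\mathcal C)_n$ form a simplicial category, and the $w\mathrm{Cob}^{\mathrm{sym}}(\mathcal C)_n$ form a semi-simplicial subcategory. Let $\mathsf B\mathrm{Cob}(\mathcal C,w\mathcal C)$ be the geometric realization of the simplicial space $[n]\mapsto|N_\bullet w\mathrm{Cob}(\mathcal C)_n|$, and let $\mathsf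 B\mathrm{Cob}^{\mathrm{sym}}(\mathcal C,w\mathcal C)$ be the geometric realization of the semi-simplicial space $[n]\mapsto|N_\bullet w\mathrm{Cob}^{\mathrm{sym}}(\mathcal C)_n|$. The inclusion map $\mathsf B\mathrm{Cob}^{\mathrm{sym}}(\mathcal C,w\mathcal C)\to\mathsf B\mathrm{Cob}(\mathcal C,w\mathcal C)$ is the composite of the map of realizations of semi-simplicial spaces induced by the levelwise inclusions with the canonical map from the realization of the underlying semi-simplicial space of $[n]\mapsto|N_\bullet w\mathrm{Cob}(\mathcal C)_n|$ to the realization of this simplicial space. **Proposition.** Let $\mathcal C$ be an unpointed Waldhausen category with initial object, and suppose that $\mathcal C$ has functorial factorizations. Then the inclusion map $$\mathsf B\mathrm{Cob}^{\mathrm{sym}}(\mathcal C,w\mathcal C)\longrightarrow\mathsf B\mathrm{Cob}(\mathcal C,w\mathcal C)$$ is a weak homotopy equivalence. -/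

import Mathlib

open CategoryTheory CategoryTheory.Limits Opposite
open scoped Topology Topology.Homotopy

universe v u w

namespace CobordismCategory

/-! ### Unpointed Waldhausen categories -/

/-- An unpointed Waldhausen category: a category with subcategories of cofibrations and of weak
equivalences, both containing the isomorphisms (hence all objects), such that pushouts along
cofibrations exist, cofibrations are stable under these pushouts, and the weak equivalences
satisfy the gluing lemma. -/
class UnpointedWaldhausenCategory (C : Type u) [Category.{v} C] where
  /-- the cofibrations -/
  cof : MorphismProperty C
  /-- the weak equivalences -/
  weq : MorphismProperty C
  cof_of_isIso : ∀ {X Y : C} (f : X ⟶ Y), IsIso f → cof f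
  cof_comp : ∀ {X Y Z : C} (f : X ⟶ Y) (g : Y ⟶ Z), cof f → cof g → cof (f ≫ g)
  weq_of_isIso : ∀ {X Y : C} (f : X ⟶ Y), IsIso f → weq f
  weq_comp : ∀ {X Y Z : C} (f : X ⟶ Y) (g : Y ⟶ Z), weq f → weq g → weq (f ≫ g)
  hasPushout_of_cof : ∀ {A B X : C} (f : A ⟶ X) (i : A ⟶ B), cof i → HasPushout f i
  cof_of_isPushout : ∀ {A B X P : C} {f : A ⟶ X} {i : A ⟶ B} {j : X ⟶ P} {g : B ⟶ P},
    IsPushout f i j g → cof i → cof j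
  /-- The gluing lemma: a map between two diagrams `X ⟵ A ↣ B` and `X' ⟵ A' ↣ B'` whose three
  components are weak equivalences induces a weak equivalence `p` on pushouts. -/
  gluing : ∀ {A B X P A' B' X' P' : C}
    {f : A ⟶ X} {i : A ⟶ B} {j : X ⟶ P} {g : B ⟶ P}
    {f' : A' ⟶ X'} {i' : A' ⟶ B'} {j' : X' ⟶ P'} {g' : B' ⟶ P'}
    (a : A ⟶ A') (b : B ⟶ B') (x : X ⟶ X') (p : P ⟶ P'),
    IsPushout f i j g → IsPushout f' i' j' g' → cof i → cof i' →
    f ≫ x = a ≫ f' → i ≫ b = a ≫ i' → j ≫ p = x ≫ j' → g ≫ p = b ≫ g' →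
    weq a → weq b → weq x → weq p

open UnpointedWaldhausenCategory

/-- An unpointed Waldhausen category with initial object: it has an initial object `∅`, and
`∅ ⟶ X` is a cofibration for every object `X`. -/
class HasCofibrantInitial (C : Type u) [Category.{v} C] [UnpointedWaldhausenCategory C] :
    Prop where
  hasInitial : HasInitial C
  cof_initial_to : ∀ X : C, cof (initial.to X)

attribute [instance] HasCofibrantInitial.hasInitial

/-- Functorial factorizations: a functor `T` on the category of arrows and factorizations
`X ↣ T f ⟶ Y` of all maps `f : X ⟶ Y` into a cofibration followed by a weak equivalence, natural
in the arrow `f`. As for a cylinder functor, `T` is compatible with the weak equivalences: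
it takes a natural weak equivalence of arrows to a weak equivalence (this is automatic if the
weak equivalences have the two-out-of-three property). -/
def HasFunctorialFactorizations (C : Type u) [Category.{v} C] [UnpointedWaldhausenCategory C] :
    Prop :=
  ∃ T : MorphismProperty.FunctorialFactorizationData (cof (C := C)) (weq (C := C)),
    ∀ {f g : Arrow C} (φ : f ⟶ g), weq φ.left → weq φ.right → weq (T.Z.map φ)

/-- Finite coproducts are pushouts along cofibrations out of the initial object. -/
instance hasBinaryCoproducts (C : Type u) [Category.{v} C] [UnpointedWaldhausenCategory C]
    [HasCofibrantInitial C] : HasBinaryCoproducts C := by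
  have h : ∀ X Y : C, HasColimit (pair X Y) := fun X Y => by
    have := hasPushout_of_cof (initial.to X) (initial.to Y) (HasCofibrantInitial.cof_initial_to Y)
    exact ⟨⟨⟨_, isCoproductOfIsInitialIsPushout _ _ (initial.to X) (initial.to Y)
      initialIsInitial (pushoutIsPushout (initial.to X) (initial.to Y))⟩⟩⟩
  exact hasBinaryCoproducts_of_hasColimit_pair C

/-! ### Twisted arrow categories of ordered sets -/

/-- The twisted arrow category of an ordered set `P`: its objects are the pairs `i ≤ j`, and there
is a (unique) morphism `(i ≤ j) ⟶ (i' ≤ j')` if and only if `i' ≤ i` and `j ≤ j'`. -/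
@[ext]
structure Tw (P : Type) [Preorder P] where
  src : P
  tgt : P
  le : src ≤ tgt

namespace Tw

variable {P Q R : Type} [Preorder P] [Preorder Q] [Preorder R]

instance : Preorder (Tw P) where
  le x y := y.src ≤ x.src ∧ x.tgt ≤ y.tgt
  le_refl _ := ⟨le_rfl, le_rfl⟩
  le_trans _ _ _ h h' := ⟨h'.1.trans h.1, h.2.trans h'.2⟩

/-- The functor `tw P ⥤ tw Q` induced by an order-preserving map. -/
def map (f : P →o Q) : Tw P ⥤ Tw Q where
  obj x := ⟨f x.src, f x.tgt, f.monotone x.le⟩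
  map h := homOfLE ⟨f.monotone (leOfHom h).1, f.monotone (leOfHom h).2⟩

/-- The morphism `(i ≤ j) ⟶ (i ≤ k)` for `i ≤ j ≤ k`. -/
def right {i j k : P} (hij : i ≤ j) (hjk : j ≤ k) :
    (⟨i, j, hij⟩ : Tw P) ⟶ ⟨i, k, hij.trans hjk⟩ :=
  homOfLE ⟨le_rfl, hjk⟩

/-- The morphism `(j ≤ k) ⟶ (i ≤ k)` for `i ≤ j ≤ k`. -/
def left {i j k : P} (hij : i ≤ j) (hjk : j ≤ k) :
    (⟨j, k, hjk⟩ : Tw P) ⟶ ⟨i, k, hij.trans hjk⟩ :=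
  homOfLE ⟨hij, le_rfl⟩

end Tw

/-! ### The simplicial category `w Cob(C)` and the semi-simplicial category `w Cob^sym(C)` -/

section

variable (C : Type u) [Category.{v} C] [UnpointedWaldhausenCategory C]

/-- The objects of `Cob(C)_n`, for `P = [n]`. -/
structure IsCob {P : Type} [Preorder P] (F : Tw P ⥤ C) : Prop where
  cof_right : ∀ {i j k : P} (hij : i ≤ j) (hjk : j ≤ k), cof (F.map (Tw.right hij hjk))
  isPushout : ∀ {i j k l : P} (hij : i ≤ j) (hjk : j ≤ k) (hkl : k ≤ l),
    IsPushout (F.map (Tw.left hij hjk)) (F.map (Tw.right hjk hkl))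
      (F.map (Tw.right (hij.trans hjk) hkl)) (F.map (Tw.left hij (hjk.trans hkl)))

/-- The objects of `Cob^sym(C)_n`: those of `Cob(C)_n` such that the canonical map
`F_{i,i} ⊔ F_{i+1,i+1} ⟶ F_{i,i+1}` is a cofibration for all `0 ≤ i < n`. -/
structure IsSymCob [HasCofibrantInitial C] {n : ℕ} (F : Tw (Fin (n + 1)) ⥤ C) : Prop
    extends IsCob C F where
  cof_desc : ∀ i : Fin n, cof (coprod.desc
    (F.map (Tw.right (le_refl i.castSucc) i.castSucc_lt_succ.le))
    (F.map (Tw.left i.castSucc_lt_succ.le (le_refl i.succ))))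

variable {C}

/-- The category whose objects are the functors `tw P ⥤ C` with a property `S`, and whose
morphisms are the objectwise weak equivalences: the subcategory of weak equivalences in the full
subcategory of functors with the property `S`. -/
structure WFun {P : Type} [Preorder P] (S : (Tw P ⥤ C) → Prop) where
  functor : Tw P ⥤ C
  prop : S functor

namespace WFun

variable {P Q : Type} [Preorder P] [Preorder Q]

/-- Natural transformations that are objectwise weak equivalences. -/
@[ext]
structure Hom {S : (Tw P ⥤ C) → Prop} (F G : WFun S) where
  trans : F.functor ⟶ G.functor
  weq_app : ∀ x, weq (trans.app x)

@[simps]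
instance category (S : (Tw P ⥤ C) → Prop) : Category.{v} (WFun S) where
  Hom F G := Hom F G
  id F := ⟨𝟙 _, fun _ => weq_of_isIso _ (inferInstanceAs (IsIso (𝟙 _)))⟩
  comp α β := ⟨α.trans ≫ β.trans, fun x => weq_comp _ _ (α.weq_app x) (β.weq_app x)⟩

/-- Restriction along `tw P ⥤ tw Q` for an order-preserving map `P → Q`. -/
@[simps]
def restrict {S : (Tw Q ⥤ C) → Prop} {S' : (Tw P ⥤ C) → Prop} (f : P →o Q)
    (h : ∀ F, S F → S' (Tw.map f ⋙ F)) : WFun S ⥤ WFun S' where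
  obj F := ⟨Tw.map f ⋙ F.functor, h _ F.prop⟩
  map α := ⟨Functor.whiskerLeft (Tw.map f) α.trans, fun _ => α.weq_app _⟩

/-- The inclusion of full subcategories. -/
@[simps]
def incl {S S' : (Tw P ⥤ C) → Prop} (h : ∀ F, S F → S' F) : WFun S ⥤ WFun S' where
  obj F := ⟨F.functor, h _ F.prop⟩
  map α := ⟨α.trans, α.weq_app⟩

end WFun

theorem IsCob.restrict {P Q : Type} [Preorder P] [Preorder Q] (f : P →o Q) {F : Tw Q ⥤ C}
    (h : IsCob C F) : IsCob C (Tw.map f ⋙ F) where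
  cof_right hij hjk := h.cof_right (f.monotone hij) (f.monotone hjk)
  isPushout hij hjk hkl := h.isPushout (f.monotone hij) (f.monotone hjk) (f.monotone hkl)

set_option linter.unusedSimpArgs false in
theorem cof_coprod_map_id [HasCofibrantInitial C] {A B : C} (Z : C) (f : A ⟶ B) (hf : cof f) :
    cof (coprod.map f (𝟙 Z)) := by
  have h : IsPushout (coprod.inl : A ⟶ A ⨿ Z) f (coprod.map f (𝟙 Z)) coprod.inl := by
    refine ⟨⟨by simp⟩, ⟨PushoutCocone.IsColimit.mk _
      (fun s => coprod.desc s.inr (coprod.inr ≫ s.inl)) (fun s => ?_) (fun s => ?_)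
      (fun s m h1 h2 => ?_)⟩⟩
    · ext
      · simpa [coprod.inl_desc, coprod.inr_desc, coprod.inl_desc_assoc,
        coprod.inr_desc_assoc] using s.condition.symm
      · simp [coprod.inl_desc, coprod.inr_desc, coprod.inl_desc_assoc,
        coprod.inr_desc_assoc]
    · simp [coprod.inl_desc, coprod.inr_desc, coprod.inl_desc_assoc,
        coprod.inr_desc_assoc]
    · ext
      · simpa [coprod.inl_desc, coprod.inr_desc, coprod.inl_desc_assoc,
        coprod.inr_desc_assoc] using h2
      · simp [← h1, coprod.inl_desc, coprod.inr_desc, coprod.inl_desc_assoc,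
        coprod.inr_desc_assoc]
  exact cof_of_isPushout h hf

set_option linter.unusedSimpArgs false in
theorem cof_coprod_desc_trans [HasCofibrantInitial C] {A B D X Y P : C}
    {a : A ⟶ X} {b : B ⟶ X} {b' : B ⟶ Y} {d : D ⟶ Y} {p : X ⟶ P} {q : Y ⟶ P}
    (sq : IsPushout b b' p q) (ha : cof a) (h : cof (coprod.desc b' d)) :
    cof (coprod.desc (a ≫ p) (d ≫ q)) := by
  have sq' : IsPushout (coprod.map b (𝟙 D)) (coprod.desc b' d) (coprod.desc p (d ≫ q)) q := by
    refine ⟨⟨by ext <;> simp [sq.w, coprod.inl_desc, coprod.inr_desc, coprod.inl_desc_assoc,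
        coprod.inr_desc_assoc]⟩, ⟨PushoutCocone.IsColimit.mk _
      (fun s => sq.desc (coprod.inl ≫ s.inl) s.inr ?_) (fun s => ?_) (fun s => ?_)
      (fun s m h1 h2 => ?_)⟩⟩
    · have := coprod.inl ≫= s.condition
      simpa [coprod.inl_desc, coprod.inr_desc, coprod.inl_desc_assoc,
        coprod.inr_desc_assoc] using this
    · have := coprod.inr ≫= s.condition
      ext
      · simp [coprod.inl_desc, coprod.inr_desc, coprod.inl_desc_assoc,
        coprod.inr_desc_assoc]
      · simpa [coprod.inl_desc, coprod.inr_desc, coprod.inl_desc_assoc,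
        coprod.inr_desc_assoc] using this.symm
    · simp [coprod.inl_desc, coprod.inr_desc, coprod.inl_desc_assoc,
        coprod.inr_desc_assoc]
    · apply sq.hom_ext
      · simp [← h1, coprod.inl_desc, coprod.inr_desc, coprod.inl_desc_assoc,
        coprod.inr_desc_assoc]
      · simpa [coprod.inl_desc, coprod.inr_desc, coprod.inl_desc_assoc,
        coprod.inr_desc_assoc] using h2
  have e : coprod.desc (a ≫ p) (d ≫ q) = coprod.map a (𝟙 D) ≫ coprod.desc p (d ≫ q) := by
    ext <;> simp [coprod.inl_desc, coprod.inr_desc, coprod.inl_desc_assoc,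
        coprod.inr_desc_assoc]
  rw [e]
  exact cof_comp _ _ (cof_coprod_map_id D a ha) (cof_of_isPushout sq' h)

theorem IsSymCob.cof_desc_of_lt [HasCofibrantInitial C] {n : ℕ} {F : Tw (Fin (n + 1)) ⥤ C}
    (h : IsSymCob C F) {i j : Fin (n + 1)} (hij : i < j) :
    cof (coprod.desc (F.map (Tw.right (le_refl i) hij.le))
      (F.map (Tw.left hij.le (le_refl j)))) := by
  induction j using Fin.induction with
  | zero => exact absurd hij (by simp)
  | succ k ih =>
    rcases (Fin.le_castSucc_iff.mpr hij).eq_or_lt with rfl | hik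
    · exact h.cof_desc k
    · have hk : k.castSucc ≤ k.succ := k.castSucc_lt_succ.le
      have := cof_coprod_desc_trans (h.isPushout hik.le (le_refl k.castSucc) hk)
        (h.cof_right (le_refl i) hik.le) (h.cof_desc k)
      rw [← F.map_comp, ← F.map_comp] at this
      exact this

theorem IsSymCob.restrict [HasCofibrantInitial C] {m n : ℕ}
    (f : Fin (m + 1) ↪o Fin (n + 1)) {F : Tw (Fin (n + 1)) ⥤ C} (h : IsSymCob C F) :
    IsSymCob C (Tw.map f.toOrderHom ⋙ F) where
  toIsCob := h.toIsCob.restrict _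
  cof_desc i := h.cof_desc_of_lt (f.strictMono i.castSucc_lt_succ)

variable (C)

/-- The simplicial category `[n] ↦ w Cob(C)_n`. -/
def wCob : SimplexCategoryᵒᵖ ⥤ Cat.{v, max u v} where
  obj n := Cat.of (WFun (IsCob C (P := Fin (n.unop.len + 1))))
  map f := (WFun.restrict f.unop.toOrderHom (fun _ h => h.restrict _)).toCatHom

/-- The semi-simplicial category `[n] ↦ w Cob^sym(C)_n`. -/
def wSymCob [HasCofibrantInitial C] : SemiSimplexCategoryᵒᵖ ⥤ Cat.{v, max u v} where
  obj n := Cat.of (WFun (IsSymCob C (n := n.unop.len)))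
  map f := (WFun.restrict (SemiSimplexCategory.homEquiv f.unop).toOrderHom
    (fun _ h => h.restrict _)).toCatHom

/-- The inclusion of semi-simplicial categories `w Cob^sym(C) ⊂ w Cob(C)`. -/
def wSymCobIncl [HasCofibrantInitial C] :
    wSymCob C ⟶ SemiSimplexCategory.toSimplexCategory.op ⋙ wCob C where
  app n := (WFun.incl (P := Fin (n.unop.len + 1)) (S := IsSymCob C) (S' := IsCob C)
    (fun _ h => h.toIsCob)).toCatHom

end

/-! ### Geometric realization of (semi-)simplicial spaces -/

/-- The relation `(f^* x, t) ∼ (x, f_* t)` for `f : [m] ⟶ [n]`, `x ∈ X_n` and `t ∈ Δ^m`. -/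
inductive RealizationRel {J : Type} [SmallCategory J] (ι : J ⥤ SimplexCategory)
    (X : Jᵒᵖ ⥤ TopCat.{w}) :
    (Σ j : J, X.obj (op j) × SimplexCategory.toTop₀.obj (ι.obj j)) →
    (Σ j : J, X.obj (op j) × SimplexCategory.toTop₀.obj (ι.obj j)) → Prop
  | glue {m n : J} (f : m ⟶ n) (x : X.obj (op n)) (t : SimplexCategory.toTop₀.obj (ι.obj m)) :
      RealizationRel ι X ⟨m, X.map f.op x, t⟩ ⟨n, x, SimplexCategory.toTop₀.map (ι.map f) t⟩

/-- The quotient space `∐ X_n × Δ^n / ∼`. For `ι` the identity of `Δ` this is the geometric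
realization of a simplicial space, and for `ι` the inclusion of the subcategory of injective maps
into `Δ`, it is the geometric realization of a semi-simplicial space. -/
def Realization {J : Type} [SmallCategory J] (ι : J ⥤ SimplexCategory) (X : Jᵒᵖ ⥤ TopCat.{w}) :
    Type w :=
  Quot (RealizationRel ι X)

namespace Realization

variable {J : Type} [SmallCategory J]

instance (ι : J ⥤ SimplexCategory) (X : Jᵒᵖ ⥤ TopCat.{w}) : TopologicalSpace (Realization ι X) :=
  inferInstanceAs (TopologicalSpace (Quot _))

/-- The map of realizations induced by a map of (semi-)simplicial spaces. -/
def map (ι : J ⥤ SimplexCategory) {X Y : Jᵒᵖ ⥤ TopCat.{w}} (η : X ⟶ Y) :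
    C(Realization ι X, Realization ι Y) where
  toFun := Quot.map (fun p => ⟨p.1, η.app (op p.1) p.2.1, p.2.2⟩) (by
    rintro _ _ ⟨f, x, t⟩
    have h : η.app _ (X.map f.op x) = Y.map f.op (η.app _ x) :=
      ConcreteCategory.congr_hom (η.naturality f.op) x
    dsimp only
    rw [h]
    exact RealizationRel.glue f _ t)
  continuous_toFun := by
    refine continuous_quot_lift _ (continuous_quot_mk.comp (continuous_sigma fun j => ?_))
    exact continuous_sigmaMk.comp ((η.app (op j)).hom.continuous.prodMap continuous_id)

/-- The canonical map from the realization of the semi-simplicial space underlying a simplicial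
space `X` to the realization of `X`, given by the identity of `X_n × Δ^n`. -/
def ofRestrict (ι : J ⥤ SimplexCategory) (X : SimplexCategoryᵒᵖ ⥤ TopCat.{w}) :
    C(Realization ι (ι.op ⋙ X), Realization (𝟭 SimplexCategory) X) where
  toFun := Quot.map (fun p => ⟨ι.obj p.1, p.2.1, p.2.2⟩) (by
    rintro _ _ ⟨f, x, t⟩
    exact RealizationRel.glue (ι := 𝟭 SimplexCategory) (ι.map f) x t)
  continuous_toFun := continuous_quot_lift _ (continuous_quot_mk.comp
    (continuous_sigma fun j => continuous_sigmaMk (i := ι.obj j)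
      (σ := fun n : SimplexCategory => X.obj (op n) × SimplexCategory.toTop₀.obj n)))

end Realization

/-! ### Classifying spaces -/

section

variable (C : Type u) [Category.{v} C] [UnpointedWaldhausenCategory C]

/-- The levelwise classifying space `X ↦ |N X|` of a diagram of categories. -/
noncomputable def levelwiseClassifyingSpace {K : Type} [SmallCategory K] (X : K ⥤ Cat.{v, u}) :
    K ⥤ TopCat.{max u v} :=
  X ⋙ nerveFunctor ⋙ SSet.toTop

/-- The cobordism category `Cob(C, wC)`, as the simplicial space `[n] ↦ |N w Cob(C)_n|`. -/
noncomputable def cob : SimplexCategoryᵒᵖ ⥤ TopCat.{max u v} :=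
  levelwiseClassifyingSpace (wCob C)

/-- The symmetric cobordism category `Cob^sym(C, wC)`, as the semi-simplicial space
`[n] ↦ |N w Cob^sym(C)_n|`. -/
noncomputable def symCob [HasCofibrantInitial C] :
    SemiSimplexCategoryᵒᵖ ⥤ TopCat.{max u v} :=
  levelwiseClassifyingSpace (wSymCob C)

/-- The classifying space `B Cob(C, wC)`. -/
abbrev BCob : Type (max u v) := Realization (𝟭 SimplexCategory) (cob C)

/-- The classifying space `B Cob^sym(C, wC)`. -/
abbrev BSymCob [HasCofibrantInitial C] : Type (max u v) :=
  Realization SemiSimplexCategory.toSimplexCategory (symCob C)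

/-- The map of semi-simplicial spaces induced by `w Cob^sym(C) ⊂ w Cob(C)`. -/
noncomputable def symCobIncl [HasCofibrantInitial C] :
    symCob C ⟶ SemiSimplexCategory.toSimplexCategory.op ⋙ cob C :=
  Functor.whiskerRight (wSymCobIncl C) (nerveFunctor ⋙ SSet.toTop)

/-- The canonical map `B Cob^sym(C, wC) ⟶ B Cob(C, wC)`: the map of realizations of
semi-simplicial spaces induced by the inclusion, followed by the canonical map to the realization
of the simplicial space `Cob(C, wC)`. -/
noncomputable def inclusion [HasCofibrantInitial C] : C(BSymCob C, BCob C) :=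
  (Realization.ofRestrict SemiSimplexCategory.toSimplexCategory (cob C)).comp
    (Realization.map SemiSimplexCategory.toSimplexCategory (symCobIncl C))

end

/-! ### Weak homotopy equivalences -/

section

variable {X Y : Type w} [TopologicalSpace X] [TopologicalSpace Y]

/-- The map on path components induced by a continuous map. -/
def mapZerothHomotopy (f : C(X, Y)) : ZerothHomotopy X → ZerothHomotopy Y :=
  Quotient.map' f (fun _ _ h => h.map f.continuous)

/-- The map `π_n(X, x) → π_n(Y, f(x))` induced by a continuous map. -/
def mapHomotopyGroup (f : C(X, Y)) (n : ℕ) (x : X) : π_ n X x → π_ n Y (f x) :=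
  Quotient.map (fun γ => ⟨f.comp γ.1, fun y hy => congrArg f (γ.2 y hy)⟩)
    (fun _ _ h => h.map fun H => H.compContinuousMap f)

/-- A map is a weak homotopy equivalence if it induces bijections on path components and on all
homotopy groups at all base points. -/
structure IsWeakHomotopyEquivalence (f : C(X, Y)) : Prop where
  bijective_zerothHomotopy : Function.Bijective (mapZerothHomotopy f)
  bijective_homotopyGroup : ∀ (n : ℕ) (x : X), 1 ≤ n →
    Function.Bijective (mapHomotopyGroup f n x)

end

end CobordismCategory

/-! The map is a composite of two weak equivalences: the realization of the levelwise inclusions,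
and the comparison of the semi-simplicial with the simplicial realization of `cob C`.

On each level the inclusion has an explicit homotopy inverse. An object F of `w Cob(C)_n` is
determined up to isomorphism by its zigzag F_00 → F_01 ← F_11 → ⋯, all other values being iterated
pushouts. Factoring the maps F_ii ⊔ F_{i+1,i+1} → F_{i,i+1} functorially and regluing gives a
symmetric object (`symmetrize`), and the gluing lemma makes the projection back to F a natural weak
equivalence. Since the inclusion is full, one transformation serves on both sides, so the two
homotopies on nerves are strictly compatible with the inclusion
(`nonempty_compatibleInverse_nerve`).

These inverses are not required to commute with face maps, so the passage to realizations studies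
maps out of them. `HasDualLifting` says that a map from P × D to any space Z, already factored
through Q over the boundary of D, factors through Q up to a homotopy relative to that boundary. Maps
out of a semi-simplicial realization are built one X_n × Δ^n at a time, relative to X_n × ∂Δ^n; each
step is `exists_dual_lift`, and no cofibrancy of the spaces X_n is needed (`hasDualLifting_map`).

For the comparison of realizations, the levels are themselves realizations of simplicial sets, so
maps out are compatible families indexed by bisimplices. The preimage of a simplex Δ^p is modelled
by `Fat p`, the realization of the semi-simplicial set underlying Δ[p], which deforms over Δ^p onto
its top simplex. A map given on the sets Fat p × Δ^q is deformed, naturally in the bisimplex, to one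
that factors through Δ^p × Δ^q (`exists_isFlattening`, `exists_natural_family`); the result is
natural for degeneracies too.

Finally, dual lifting with D a point and D = [0, 1] yields a homotopy inverse with enough coherence
to solve all relative lifting problems (`HasBdryLifting.of_dual`), whence the bijections on homotopy
groups. -/

namespace CobordismCategory

open unitInterval

/-! ### Radial structures and the homotopy extension property -/

/-- A radial structure on a space `K`: a function `gauge : K → [0, 1]`, thought of as a distance
from a centre, and a rescaling operation: `push k m` is the multiple of `k` by the factor
`1 / max m (gauge k)`. The boundary of `K` is the subset where the gauge is `1`. -/
structure Radial (K : Type*) [TopologicalSpace K] where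
  gauge : K → ℝ
  push : K → ℝ → K
  continuous_gauge : Continuous gauge
  continuous_push : Continuous fun p : K × ℝ => push p.1 p.2
  gauge_nonneg : ∀ k, 0 ≤ gauge k
  gauge_le : ∀ k, gauge k ≤ 1
  -- Only 1/2 ≤ m ≤ 1 matters: `retr` uses m = 1 - t/2 with t in [0, 1]. This keeps the denominators
  -- away from 0.
  gauge_push : ∀ k m, 1 / 2 ≤ m → m ≤ 1 → gauge (push k m) = gauge k / max m (gauge k)
  push_eq : ∀ k m, 1 / 2 ≤ m → m ≤ 1 → max m (gauge k) = 1 → push k m = k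

namespace Radial

variable {K K' : Type*} [TopologicalSpace K] [TopologicalSpace K']

/-- The boundary of a space with a radial structure. -/
def bdry (R : Radial K) : Set K := {k | R.gauge k = 1}

theorem isClosed_bdry (R : Radial K) : IsClosed R.bdry :=
  isClosed_eq R.continuous_gauge continuous_const

/-- The radial structure with empty boundary. -/
def noBdry (K : Type*) [TopologicalSpace K] : Radial K where
  gauge _ := 0
  push k _ := k
  continuous_gauge := continuous_const
  continuous_push := continuous_fst
  gauge_nonneg _ := le_rfl
  gauge_le _ := zero_le_one
  gauge_push _ _ _ _ := by simp
  push_eq _ _ _ _ _ := rfl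

@[simp]
theorem bdry_noBdry : (noBdry K).bdry = ∅ := by
  ext; simp [bdry, noBdry]

/-- The product of two radial structures. -/
def prod (R : Radial K) (R' : Radial K') : Radial (K × K') where
  gauge k := max (R.gauge k.1) (R'.gauge k.2)
  -- Enlarging m by the gauge of the other factor makes both coordinates scale by the same number,
  -- the inverse of the maximum of m and both gauges.
  push k m := (R.push k.1 (max m (R'.gauge k.2)), R'.push k.2 (max m (R.gauge k.1)))
  continuous_gauge := (R.continuous_gauge.comp continuous_fst).max
    (R'.continuous_gauge.comp continuous_snd)
  continuous_push := by
    have h := R.continuous_gauge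
    have h' := R'.continuous_gauge
    refine Continuous.prodMk ?_ ?_
    · exact R.continuous_push.comp (f := fun p : (K × K') × ℝ =>
        (p.1.1, max p.2 (R'.gauge p.1.2))) (by fun_prop)
    · exact R'.continuous_push.comp (f := fun p : (K × K') × ℝ =>
        (p.1.2, max p.2 (R.gauge p.1.1))) (by fun_prop)
  gauge_nonneg k := le_max_of_le_left (R.gauge_nonneg _)
  gauge_le k := max_le (R.gauge_le _) (R'.gauge_le _)
  gauge_push k m h1 h2 := by
    rw [R.gauge_push _ _ (h1.trans (le_max_left _ _)) (max_le h2 (R'.gauge_le _)),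
      R'.gauge_push _ _ (h1.trans (le_max_left _ _)) (max_le h2 (R.gauge_le _))]
    rw [max_assoc, max_assoc, max_comm (R'.gauge k.2) (R.gauge k.1),
      max_div_div_right (le_max_of_le_left (by linarith))]
  push_eq k m h1 h2 h := by
    refine Prod.ext ?_ ?_
    · refine R.push_eq _ _ (h1.trans (le_max_left _ _)) (max_le h2 (R'.gauge_le _)) ?_
      rw [max_assoc, max_comm (R'.gauge k.2), h]
    · refine R'.push_eq _ _ (h1.trans (le_max_left _ _)) (max_le h2 (R.gauge_le _)) ?_
      rw [max_assoc, h]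

theorem mem_bdry_prod {R : Radial K} {R' : Radial K'} {k : K × K'} :
    k ∈ (R.prod R').bdry ↔ k.1 ∈ R.bdry ∨ k.2 ∈ R'.bdry := by
  have h := R.gauge_le k.1
  have h' := R'.gauge_le k.2
  simp only [bdry, prod, Set.mem_ofPred_eq]
  constructor
  · intro e
    rcases max_choice (R.gauge k.1) (R'.gauge k.2) with h | h <;> rw [h] at e <;> simp [e]
  · rintro (e | e) <;> rw [e] <;> simp [h, h']

/-- Rescaling of `[0, 1]` around the midpoint. -/
noncomputable def rescale (x : I) (M : ℝ) : I :=
  Set.projIcc 0 1 zero_le_one (1 / 2 + ((x : ℝ) - 1 / 2) / M)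

theorem rescale_one (x : I) : rescale x 1 = x := by
  have : (1 / 2 + ((x : ℝ) - 1 / 2) / 1) = x := by ring
  rw [rescale, this]
  simp

theorem two_mul_rescale_sub (x : I) {M : ℝ} (hM : 0 < M) (hx : |2 * (x : ℝ) - 1| ≤ M) :
    2 * (rescale x M : ℝ) - 1 = M⁻¹ * (2 * (x : ℝ) - 1) := by
  have e : 2 * (1 / 2 + ((x : ℝ) - 1 / 2) / M) - 1 = M⁻¹ * (2 * (x : ℝ) - 1) := by
    field_simp; ring
  have hb : |2 * (1 / 2 + ((x : ℝ) - 1 / 2) / M) - 1| ≤ 1 := by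
    rw [e, abs_mul, abs_of_pos (inv_pos.2 hM), ← div_eq_inv_mul]
    exact div_le_one_of_le₀ hx hM.le
  rw [abs_le] at hb
  rw [← e, rescale, Set.projIcc_of_mem _ ⟨by linarith, by linarith⟩]

theorem abs_two_mul_sub_le (x : I) : |2 * (x : ℝ) - 1| ≤ 1 := by
  rw [abs_le]
  constructor <;> linarith [x.2.1, x.2.2]

theorem abs_two_mul_sub_eq_one (x : I) : |2 * (x : ℝ) - 1| = 1 ↔ x = 0 ∨ x = 1 := by
  rw [abs_eq zero_le_one, or_comm, ← Set.Icc.coe_eq_zero, ← Set.Icc.coe_eq_one]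
  refine or_congr ?_ ?_ <;> constructor <;> intro h <;> linarith

/-- The radial structure of a cube. -/
noncomputable def cube (N : Type*) [Fintype N] : Radial (N → I) where
  gauge x := ‖(fun i => 2 * (x i : ℝ) - 1 : N → ℝ)‖
  -- The extra 1/2 is invisible for m ≥ 1/2; it keeps the divisor positive, so that `push` is
  -- continuous for all real m.
  push x m := fun i => rescale (x i)
    (max (1 / 2) (max m ‖(fun i => 2 * (x i : ℝ) - 1 : N → ℝ)‖))
  continuous_gauge := by fun_prop
  continuous_push := by
    refine continuous_pi fun i => continuous_projIcc.comp ?_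
    refine continuous_const.add (Continuous.div (by fun_prop) (by fun_prop) fun x => ?_)
    have := le_max_left (1 / 2 : ℝ) (max x.2 ‖(fun i => 2 * (x.1 i : ℝ) - 1 : N → ℝ)‖)
    positivity
  gauge_nonneg _ := norm_nonneg _
  gauge_le x := (pi_norm_le_iff_of_nonneg zero_le_one).2 fun i => abs_two_mul_sub_le _
  gauge_push x m h1 h2 := by
    set g := ‖(fun i => 2 * (x i : ℝ) - 1 : N → ℝ)‖ with hg
    have hM : max (1 / 2) (max m g) = max m g := by rw [← max_assoc, max_eq_right h1]
    have hpos : 0 < max m g := lt_max_of_lt_left (by linarith)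
    have e : (fun i => 2 * (rescale (x i) (max (1 / 2) (max m g)) : ℝ) - 1 : N → ℝ) =
        (max m g)⁻¹ • fun i => 2 * (x i : ℝ) - 1 := by
      funext i
      rw [hM]
      exact two_mul_rescale_sub _ hpos (le_max_of_le_right
        (norm_le_pi_norm (fun i => 2 * (x i : ℝ) - 1 : N → ℝ) i))
    rw [e, norm_smul, Real.norm_of_nonneg (inv_nonneg.2 hpos.le), div_eq_inv_mul]
  push_eq x m h1 h2 h := by
    funext i
    rw [h, max_eq_right (by norm_num), rescale_one]

theorem bdry_cube (N : Type*) [Fintype N] : (cube N).bdry = Cube.boundary N := by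
  ext x
  change ‖(fun i => 2 * (x i : ℝ) - 1 : N → ℝ)‖ = 1 ↔ ∃ i, x i = 0 ∨ x i = 1
  simp_rw [← abs_two_mul_sub_eq_one]
  constructor
  · intro h
    by_contra! hn
    refine lt_irrefl (1 : ℝ) (h.symm.trans_lt ((pi_norm_lt_iff zero_lt_one).2 fun i => ?_))
    exact lt_of_le_of_ne (abs_two_mul_sub_le _) (hn i)
  · rintro ⟨i, hi⟩
    refine le_antisymm ((cube N).gauge_le x) (hi.symm.trans_le ?_)
    exact norm_le_pi_norm (fun i => 2 * (x i : ℝ) - 1 : N → ℝ) i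

/-- The radial structure of the unit interval. -/
noncomputable def interval : Radial I where
  gauge x := |2 * (x : ℝ) - 1|
  push x m := rescale x (max (1 / 2) (max m |2 * (x : ℝ) - 1|))
  continuous_gauge := by fun_prop
  continuous_push := by
    refine continuous_projIcc.comp ?_
    refine continuous_const.add (Continuous.div (by fun_prop) (by fun_prop) fun x => ?_)
    have := le_max_left (1 / 2 : ℝ) (max x.2 |2 * (x.1 : ℝ) - 1|)
    positivity
  gauge_nonneg _ := abs_nonneg _
  gauge_le x := abs_two_mul_sub_le x
  gauge_push x m h1 h2 := by
    have hM : max (1 / 2) (max m |2 * (x : ℝ) - 1|) = max m |2 * (x : ℝ) - 1| := by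
      rw [← max_assoc, max_eq_right h1]
    have hpos : (0 : ℝ) < max m |2 * (x : ℝ) - 1| := lt_max_of_lt_left (by linarith)
    rw [hM, two_mul_rescale_sub _ hpos (le_max_right _ _), abs_mul,
      abs_of_pos (inv_pos.2 hpos), div_eq_inv_mul]
  push_eq x m h1 h2 h := by
    rw [h, max_eq_right (by norm_num), rescale_one]

theorem mem_bdry_interval {s : I} : s ∈ interval.bdry ↔ s = 0 ∨ s = 1 :=
  abs_two_mul_sub_eq_one s

/-- A retraction of `K × I` onto `K × 0 ∪ ∂K × I`. -/
noncomputable def retr (R : Radial K) (p : K × I) : K × I :=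
  -- Radial projection from the point at height 2 above the centre. The ray through (k, t) is (λk, 2
  -- - λ(2 - t)); it meets the bottom at λ = 1/(1 - t/2) and the wall at λ = 1/gauge k, and the
  -- smaller λ is taken.
  (R.push p.1 (1 - p.2 / 2), Set.projIcc 0 1 zero_le_one
    (2 - (2 - p.2) / max (1 - (p.2 : ℝ) / 2) (R.gauge p.1)))

theorem retr_mem_aux (p : I) : (1 : ℝ) / 2 ≤ 1 - p / 2 ∧ (1 : ℝ) - p / 2 ≤ 1 := by
  constructor <;> linarith [p.2.1, p.2.2]

theorem continuous_retr (R : Radial K) : Continuous R.retr := by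
  have hg := R.continuous_gauge
  refine Continuous.prodMk ?_ ?_
  · exact R.continuous_push.comp (f := fun p : K × I => (p.1, 1 - (p.2 : ℝ) / 2)) (by fun_prop)
  · refine continuous_projIcc.comp (continuous_const.sub (Continuous.div (by fun_prop)
      (by fun_prop) fun p => ?_))
    have := (retr_mem_aux p.2).1
    have : (0 : ℝ) < max (1 - (p.2 : ℝ) / 2) (R.gauge p.1) := lt_max_of_lt_left (by linarith)
    exact this.ne'

theorem retr_mem (R : Radial K) (p : K × I) : (R.retr p).2 = 0 ∨ (R.retr p).1 ∈ R.bdry := by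
  obtain ⟨h1, h2⟩ := retr_mem_aux p.2
  rcases le_total (R.gauge p.1) (1 - (p.2 : ℝ) / 2) with h | h
  · left
    have : (2 - (2 - (p.2 : ℝ)) / max (1 - (p.2 : ℝ) / 2) (R.gauge p.1)) = 0 := by
      rw [max_eq_left h]
      have : (1 - (p.2 : ℝ) / 2) ≠ 0 := by linarith
      have : (2 - (p.2 : ℝ)) ≠ 0 := by intro h; apply this; linarith
      field_simp
      ring
    rw [retr, this]
    simp
  · right
    rw [bdry, Set.mem_ofPred_eq, retr, R.gauge_push _ _ h1 h2, max_eq_right h, div_self]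
    linarith

theorem retr_eq_self (R : Radial K) {p : K × I} (hp : p.2 = 0 ∨ p.1 ∈ R.bdry) :
    R.retr p = p := by
  obtain ⟨h1, h2⟩ := retr_mem_aux p.2
  have h : max (1 - (p.2 : ℝ) / 2) (R.gauge p.1) = 1 := by
    rcases hp with h | h
    · rw [h]
      simpa using R.gauge_le p.1
    · rw [bdry, Set.mem_ofPred_eq] at h
      rw [h]
      exact max_eq_right h2
  refine Prod.ext (R.push_eq _ _ h1 h2 h) ?_
  rw [retr, h]
  simp

/-- The homotopy extension property for the boundary of a radial structure. -/
theorem exists_extension (R : Radial K) {Z : Type*} [TopologicalSpace Z]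
    (a : K → Z) (ha : Continuous a) (b : K × I → Z) (hb : ContinuousOn b (R.bdry ×ˢ Set.univ))
    (hab : ∀ k ∈ R.bdry, b (k, 0) = a k) :
    ∃ c : C(K × I, Z), (∀ k, c (k, 0) = a k) ∧ ∀ k ∈ R.bdry, ∀ t, c (k, t) = b (k, t) := by
  classical
  let F : K × I → Z := fun p => if p.1 ∈ R.bdry then b p else a p.1
  have hF0 : ∀ k, F (k, 0) = a k := fun k => by
    by_cases h : k ∈ R.bdry <;> simp [F, h, hab]
  have hFb : ∀ k ∈ R.bdry, ∀ t, F (k, t) = b (k, t) := fun k h t => by simp [F, h]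
  have hF : ContinuousOn F ({p | p.2 = 0} ∪ R.bdry ×ˢ Set.univ) := by
    refine ContinuousOn.union_of_isClosed ?_ ?_ (isClosed_eq continuous_snd continuous_const)
      (R.isClosed_bdry.prod isClosed_univ)
    · refine (ha.comp continuous_fst).continuousOn.congr ?_
      rintro ⟨k, t⟩ (rfl : t = 0)
      exact hF0 k
    · refine hb.congr ?_
      rintro ⟨k, t⟩ ⟨hk, -⟩
      exact hFb k hk t
  refine ⟨⟨F ∘ R.retr, hF.comp_continuous R.continuous_retr fun p => ?_⟩, fun k => ?_,
    fun k hk t => ?_⟩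
  · rcases R.retr_mem p with h | h
    · exact Or.inl h
    · exact Or.inr ⟨h, Set.mem_univ _⟩
  · change F (R.retr (k, 0)) = _
    rw [R.retr_eq_self (Or.inl rfl), hF0]
  · change F (R.retr (k, t)) = _
    rw [R.retr_eq_self (Or.inr hk), hFb k hk]

/-- A box `K × I × I` can be filled if a map is given on three of the faces of the square `I × I`
and on the boundary of `K`. -/
theorem exists_filling (R : Radial K) {Z : Type*} [TopologicalSpace Z]
    (bot left right : K × I → Z) (q : K × I × I → Z)
    (hbot : Continuous bot) (hleft : Continuous left) (hright : Continuous right)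
    (hq : ContinuousOn q (R.bdry ×ˢ Set.univ))
    (h0 : ∀ k, bot (k, 0) = left (k, 0)) (h1 : ∀ k, bot (k, 1) = right (k, 0))
    (hqb : ∀ k ∈ R.bdry, ∀ s, q (k, s, 0) = bot (k, s))
    (hql : ∀ k ∈ R.bdry, ∀ t, q (k, 0, t) = left (k, t))
    (hqr : ∀ k ∈ R.bdry, ∀ t, q (k, 1, t) = right (k, t)) :
    ∃ top : C(K × I, Z), (∀ k, top (k, 0) = left (k, 1)) ∧ (∀ k, top (k, 1) = right (k, 1)) ∧
      ∀ k ∈ R.bdry, ∀ s, top (k, s) = q (k, s, 1) := by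
  classical
  let b : (K × I) × I → Z := fun p => if p.1.1 ∈ R.bdry then q (p.1.1, p.1.2, p.2) else
    if p.1.2 = 0 then left (p.1.1, p.2) else right (p.1.1, p.2)
  have b1 : ∀ k ∈ R.bdry, ∀ s t, b ((k, s), t) = q (k, s, t) := fun k hk s t => by simp [b, hk]
  have b2 : ∀ k t, b ((k, 0), t) = left (k, t) := fun k t => by
    by_cases hk : k ∈ R.bdry
    · rw [b1 k hk, hql k hk]
    · simp [b, hk]
  have b3 : ∀ k t, b ((k, 1), t) = right (k, t) := fun k t => by
    by_cases hk : k ∈ R.bdry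
    · rw [b1 k hk, hqr k hk]
    · simp [b, hk]
  have hb : ContinuousOn b ((R.prod interval).bdry ×ˢ Set.univ) := by
    have e : ((R.prod interval).bdry ×ˢ (Set.univ : Set I)) =
        ({p | p.1.1 ∈ R.bdry} ∪ {p | p.1.2 = 0}) ∪ {p | p.1.2 = 1} := by
      ext ⟨⟨k, s⟩, t⟩
      simp [mem_bdry_prod, mem_bdry_interval, or_assoc]
    have c1 : IsClosed {p : (K × I) × I | p.1.1 ∈ R.bdry} :=
      R.isClosed_bdry.preimage (by fun_prop)
    have c2 : IsClosed {p : (K × I) × I | p.1.2 = 0} := isClosed_eq (by fun_prop) (by fun_prop)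
    have c3 : IsClosed {p : (K × I) × I | p.1.2 = 1} := isClosed_eq (by fun_prop) (by fun_prop)
    rw [e]
    refine ContinuousOn.union_of_isClosed (ContinuousOn.union_of_isClosed ?_ ?_ c1 c2) ?_
      (c1.union c2) c3
    · refine (hq.comp (f := fun p : (K × I) × I => (p.1.1, p.1.2, p.2)) (by fun_prop)
        (fun p hp => ⟨hp, Set.mem_univ _⟩)).congr ?_
      rintro ⟨⟨k, s⟩, t⟩ hk
      exact b1 k hk s t
    · refine (hleft.comp (f := fun p : (K × I) × I => (p.1.1, p.2))
        (by fun_prop)).continuousOn.congr ?_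
      rintro ⟨⟨k, s⟩, t⟩ (rfl : s = 0)
      exact b2 k t
    · refine (hright.comp (f := fun p : (K × I) × I => (p.1.1, p.2))
        (by fun_prop)).continuousOn.congr ?_
      rintro ⟨⟨k, s⟩, t⟩ (rfl : s = 1)
      exact b3 k t
  -- The boundary of K × I consists of ∂K × I and the two ends, so `bot` extends over the last
  -- coordinate with `q`, `left` and `right` prescribed there. The lid of the box is the time-1 map.
  obtain ⟨c, hc0, hcb⟩ := (R.prod interval).exists_extension bot hbot b hb (by
    rintro ⟨k, s⟩ hks
    rw [mem_bdry_prod, mem_bdry_interval] at hks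
    rcases hks with hk | (rfl : s = 0) | (rfl : s = 1)
    · rw [b1 k hk, hqb k hk]
    · rw [b2, h0]
    · rw [b3, h1])
  refine ⟨⟨fun p => c (p, 1), by fun_prop⟩, fun k => ?_, fun k => ?_, fun k hk s => ?_⟩
  · exact (hcb (k, 0) (by simp [mem_bdry_prod, mem_bdry_interval]) 1).trans (b2 k 1)
  · exact (hcb (k, 1) (by simp [mem_bdry_prod, mem_bdry_interval]) 1).trans (b3 k 1)
  · exact (hcb (k, s) (by simp [mem_bdry_prod, hk]) 1).trans (b1 k hk s 1)

end Radial

/-! ### Compatible homotopy equivalences -/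

/-- A homotopy inverse of `f` together with homotopies `inv ∘ f ∼ id` and `f ∘ inv ∼ id` that are
strictly compatible with `f`. -/
structure CompatibleInverse {X Y : Type*} [TopologicalSpace X] [TopologicalSpace Y]
    (f : C(X, Y)) where
  inv : C(Y, X)
  left : C(X × I, X)
  right : C(Y × I, Y)
  left_zero : ∀ x, left (x, 0) = inv (f x)
  left_one : ∀ x, left (x, 1) = x
  right_zero : ∀ y, right (y, 0) = f (inv y)
  right_one : ∀ y, right (y, 1) = y
  compat : ∀ x t, f (left (x, t)) = right (f x, t)

namespace CompatibleInverse

variable {X Y : Type*} [TopologicalSpace X] [TopologicalSpace Y] {f : C(X, Y)}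

/-- The product with a fixed space. -/
def prod (c : CompatibleInverse f) (W : Type*) [TopologicalSpace W] :
    CompatibleInverse (f.prodMap (ContinuousMap.id W)) where
  inv := c.inv.prodMap (ContinuousMap.id W)
  left := ⟨fun p => (c.left (p.1.1, p.2), p.1.2), by fun_prop⟩
  right := ⟨fun p => (c.right (p.1.1, p.2), p.1.2), by fun_prop⟩
  left_zero x := Prod.ext (c.left_zero _) rfl
  left_one x := Prod.ext (c.left_one _) rfl
  right_zero x := Prod.ext (c.right_zero _) rfl
  right_one x := Prod.ext (c.right_one _) rfl
  compat x t := Prod.ext (c.compat _ _) rfl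

/-- A relative extension property dual to the homotopy lifting extension property of a homotopy
equivalence of pairs: given a map `x` on `X`, a map `y` on the boundary of `Y`, and a homotopy
between `x` and `y ∘ f` on the boundary of `X`, the map `y` extends to `Y`, and the homotopy
extends to `X`. -/
theorem exists_dual_lift (c : CompatibleInverse f) (R : Radial X) (S : Radial Y)
    (hf : ∀ x ∈ R.bdry, f x ∈ S.bdry) (hg : ∀ y ∈ S.bdry, c.inv y ∈ R.bdry)
    (hu : ∀ x ∈ R.bdry, ∀ t, c.left (x, t) ∈ R.bdry)
    (hv : ∀ y ∈ S.bdry, ∀ t, c.right (y, t) ∈ S.bdry)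
    {Z : Type*} [TopologicalSpace Z] (x : C(X, Z)) (y : Y → Z) (hy : ContinuousOn y S.bdry)
    (h : X × I → Z) (hh : ContinuousOn h (R.bdry ×ˢ Set.univ))
    (h0 : ∀ k ∈ R.bdry, h (k, 0) = x k) (h1 : ∀ k ∈ R.bdry, h (k, 1) = y (f k)) :
    ∃ (y' : C(Y, Z)) (h' : C(X × I, Z)), (∀ k ∈ S.bdry, y' k = y k) ∧
      (∀ k ∈ R.bdry, ∀ t, h' (k, t) = h (k, t)) ∧ (∀ k, h' (k, 0) = x k) ∧
      ∀ k, h' (k, 1) = y' (f k) := by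
  classical
  -- Now H(·, 1) is a map on X homotopic to x that equals y ∘ f on the boundary.
  obtain ⟨H, H0, Hb⟩ := R.exists_extension x x.continuous h hh h0
  have hyv : ContinuousOn (fun p : Y × I => y (c.right p)) (S.bdry ×ˢ Set.univ) :=
    hy.comp c.right.continuous.continuousOn fun p hp => hv p.1 hp.1 p.2
  -- The candidate H(inv ·, 1) on Y is y(f(inv ·)) on the boundary, not y. The homotopy y ∘ `right`
  -- corrects this, so V(·, 1) extends y.
  obtain ⟨V, V0, Vb⟩ := S.exists_extension (fun k => H (c.inv k, 1)) (by fun_prop)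
    (fun p : Y × I => y (c.right p)) hyv (fun k hk => by
      rw [c.right_zero, Hb _ (hg k hk), h1 _ (hg k hk)])
  -- The homotopy from x to V(f ·, 1) is H, then H(`left`, 1) backwards, then V ∘ f. On the boundary
  -- this is h followed by a path y ∘ `right` and its reverse. The square q, constant along the
  -- lines where s - t is constant, cancels the detour and leaves h on the top edge.
  let q : X × I × I → Z := fun p =>
    if p.2.1 ≤ p.2.2 then h (p.1, Set.projIcc 0 1 zero_le_one (1 + (p.2.1 : ℝ) - p.2.2))
    else y (c.right (f p.1, Set.projIcc 0 1 zero_le_one (1 - ((p.2.1 : ℝ) - p.2.2))))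
  have q1 : ∀ k (s t : I), s ≤ t →
      q (k, s, t) = h (k, Set.projIcc 0 1 zero_le_one (1 + (s : ℝ) - t)) :=
    fun k s t hst => by simp [q, hst]
  have q2 : ∀ k ∈ R.bdry, ∀ s t : I, t ≤ s →
      q (k, s, t) = y (c.right (f k, Set.projIcc 0 1 zero_le_one (1 - ((s : ℝ) - t)))) := by
    intro k hk s t hst
    rcases hst.eq_or_lt with rfl | hst
    · rw [q1 _ _ _ le_rfl]
      have e1 : (1 + (t : ℝ) - t) = 1 := by ring
      have e2 : (1 - ((t : ℝ) - t)) = 1 := by ring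
      rw [e1, e2, Set.projIcc_right]
      exact (h1 k hk).trans (congrArg y (c.right_one _).symm)
    · simp [q, not_le.2 hst]
  have hq : ContinuousOn q (R.bdry ×ˢ Set.univ) := by
    have e : R.bdry ×ˢ (Set.univ : Set (I × I)) =
        (R.bdry ×ˢ {p : I × I | p.1 ≤ p.2}) ∪ (R.bdry ×ˢ {p : I × I | p.2 ≤ p.1}) := by
      ext ⟨k, s, t⟩
      have := le_total s t
      simp only [Set.mem_prod, Set.mem_univ, and_true, Set.mem_union, Set.mem_ofPred_eq]
      tauto
    rw [e]
    refine ContinuousOn.union_of_isClosed ?_ ?_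
      (R.isClosed_bdry.prod (isClosed_le continuous_fst continuous_snd))
      (R.isClosed_bdry.prod (isClosed_le continuous_snd continuous_fst))
    · refine (hh.comp (f := fun p : X × I × I =>
        (p.1, (Set.projIcc 0 1 zero_le_one (1 + (p.2.1 : ℝ) - p.2.2) : I))) ?_
        fun p hp => ⟨hp.1, trivial⟩).congr ?_
      · exact (Continuous.prodMk continuous_fst
          (continuous_projIcc.comp (by fun_prop))).continuousOn
      · rintro ⟨k, s, t⟩ ⟨hk, hst⟩
        exact q1 k s t hst
    · refine (hyv.comp (f := fun p : X × I × I =>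
        (f p.1, (Set.projIcc 0 1 zero_le_one (1 - ((p.2.1 : ℝ) - p.2.2)) : I))) ?_
        fun p hp => ⟨hf _ hp.1, trivial⟩).congr ?_
      · exact (Continuous.prodMk (by fun_prop)
          (continuous_projIcc.comp (by fun_prop))).continuousOn
      · rintro ⟨k, s, t⟩ ⟨hk, hst⟩
        exact q2 k hk s t hst
  have proj : ∀ (r : ℝ) (s : I), r = s → Set.projIcc 0 1 zero_le_one r = s := by
    rintro _ s rfl
    simp
  -- Bottom edge: the middle homotopy. Left edge: H run backwards from time 1. Right edge: V. The
  -- lid therefore runs from x to V(f ·, 1) and restricts to h on the boundary.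
  obtain ⟨T, T0, T1, Tb⟩ := R.exists_filling (fun p => H (c.left (p.1, σ p.2), 1))
    (fun p => H (p.1, σ p.2)) (fun p => V (f p.1, p.2)) q (by fun_prop) (by fun_prop)
    (by fun_prop) hq (fun k => by simp [c.left_one]) (fun k => by simp [c.left_zero, V0])
    (fun k hk s => by
      rw [q2 k hk s 0 zero_le, proj _ (σ s) (by simp), ← c.compat, Hb _ (hu k hk _),
        h1 _ (hu k hk _)])
    (fun k hk t => by
      rw [q1 k 0 t zero_le, proj _ (σ t) (by simp), Hb k hk])
    (fun k hk t => by
      rw [q2 k hk 1 t le_one', proj _ t (by simp), Vb _ (hf k hk)])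
  refine ⟨⟨fun k => V (k, 1), by fun_prop⟩, T, fun k hk => ?_, fun k hk s => ?_, fun k => ?_,
    fun k => T1 k⟩
  · exact (Vb k hk 1).trans (congrArg y (c.right_one k))
  · rw [Tb k hk, q1 k s 1 le_one', proj _ s (by simp)]
  · rw [T0]
    simpa using H0 k

end CompatibleInverse

open unitInterval

/-! ### A criterion for weak homotopy equivalences -/

/-- The extension property of a homotopy equivalence `f : P → Q` with respect to maps into
arbitrary spaces, with parameters in a space `D`, relative to the boundary of `D`. -/
def HasDualLifting {P Q : Type w} [TopologicalSpace P] [TopologicalSpace Q] (f : C(P, Q))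
    {D : Type} [TopologicalSpace D] (R : Radial D) : Prop :=
  ∀ (Z : Type w) [TopologicalSpace Z] (x : C(P × D, Z)) (y : Q × D → Z),
    ContinuousOn y (Set.univ ×ˢ R.bdry) → (∀ p, ∀ d ∈ R.bdry, x (p, d) = y (f p, d)) →
    ∃ (y' : C(Q × D, Z)) (h : C((P × D) × I, Z)), (∀ q, ∀ d ∈ R.bdry, y' (q, d) = y (q, d)) ∧
      (∀ p d, h ((p, d), 0) = x (p, d)) ∧ (∀ p d, h ((p, d), 1) = y' (f p, d)) ∧
      ∀ p, ∀ d ∈ R.bdry, ∀ t, h ((p, d), t) = x (p, d)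

/-- A map has the homotopy lifting extension property with respect to the boundary of `K`. -/
def HasBdryLifting {P Q : Type w} [TopologicalSpace P] [TopologicalSpace Q] (f : C(P, Q))
    {K : Type*} [TopologicalSpace K] (R : Radial K) : Prop :=
  ∀ (b : C(K, Q)) (a : K → P), ContinuousOn a R.bdry → (∀ k ∈ R.bdry, b k = f (a k)) →
    ∃ (a' : C(K, P)) (H : C(K × I, Q)), (∀ k ∈ R.bdry, a' k = a k) ∧ (∀ k, H (k, 0) = b k) ∧
      (∀ k, H (k, 1) = f (a' k)) ∧ ∀ k ∈ R.bdry, ∀ t, H (k, t) = b k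

section

variable {P Q : Type w} [TopologicalSpace P] [TopologicalSpace Q] {f : C(P, Q)}

/-- Testing against Z = P and then Z = Q produces a homotopy inverse g, homotopies u : id ∼ g f and
V : id ∼ f g, and a second-order homotopy θ from f u to V f relative to the ends. This coherence is
what allows a homotopy equivalence to solve lifting problems strictly relative to a boundary. -/
theorem HasBdryLifting.of_dual [Nonempty P] (h₀ : HasDualLifting f (Radial.noBdry PUnit.{1}))
    (h₁ : HasDualLifting f Radial.interval) {K : Type*} [TopologicalSpace K] (R : Radial K) :
    HasBdryLifting f R := by
  classical
  intro b a ha hba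
  -- The identity of P is factored through f up to homotopy. The boundary is empty, so the
  -- prescribed values on it are a dummy.
  obtain ⟨g', u', -, hu0, hu1, -⟩ := h₀ P ⟨Prod.fst, continuous_fst⟩
    (fun _ => Classical.arbitrary P) continuousOn_const (by simp)
  obtain ⟨g, rfl⟩ : ∃ g : C(Q, P), g' = g.comp ⟨Prod.fst, continuous_fst⟩ :=
    ⟨⟨fun q => g' (q, PUnit.unit), by fun_prop⟩, rfl⟩
  -- The homotopy f u is factored through f × id, with the identity of Q and f g prescribed at the
  -- two ends.
  obtain ⟨V, θ, hV, hθ0, hθ1, hθ⟩ := h₁ Q ⟨fun p => f (u' ((p.1, PUnit.unit), p.2)), by fun_prop⟩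
    (fun p => if p.2 = 0 then p.1 else f (g p.1)) (by
      have e : (Set.univ ×ˢ Radial.interval.bdry : Set (Q × I)) =
          {p | p.2 = 0} ∪ {p | p.2 = 1} := by
        ext ⟨q, s⟩
        simp [Radial.mem_bdry_interval]
      rw [e]
      refine ContinuousOn.union_of_isClosed ?_ ?_ (isClosed_eq continuous_snd continuous_const)
        (isClosed_eq continuous_snd continuous_const)
      · refine continuous_fst.continuousOn.congr ?_
        rintro ⟨q, s⟩ (rfl : s = 0)
        simp
      · refine ((f.comp g).continuous.comp continuous_fst).continuousOn.congr ?_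
        rintro ⟨q, s⟩ (rfl : s = 1)
        simp) (by
      rintro p d hd
      rcases Radial.mem_bdry_interval.1 hd with rfl | rfl
      · simp [hu0]
      · simp [hu1])
  have m0 : (0 : I) ∈ Radial.interval.bdry := Radial.mem_bdry_interval.2 (Or.inl rfl)
  have m1 : (1 : I) ∈ Radial.interval.bdry := Radial.mem_bdry_interval.2 (Or.inr rfl)
  have hV0 : ∀ q, V (q, 0) = q := fun q => by simp [hV q 0 m0]
  have hV1 : ∀ q, V (q, 1) = f (g q) := fun q => by simp [hV q 1 m1]
  simp only [ContinuousMap.coe_mk] at hθ0 hθ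
  set u : C(P × I, P) := ⟨fun p => u' ((p.1, PUnit.unit), p.2), by fun_prop⟩ with hu
  have hu0 : ∀ p, u (p, 0) = p := fun p => hu0 p PUnit.unit
  have hu1 : ∀ p, u (p, 1) = g (f p) := fun p => hu1 p PUnit.unit
  have hθ0 : ∀ p d, θ ((p, d), 0) = f (u (p, d)) := hθ0
  have hθ : ∀ p, ∀ d ∈ Radial.interval.bdry, ∀ t, θ ((p, d), t) = f (u (p, d)) := hθ
  have hau : ∀ r : K × I → I, Continuous r →
      ContinuousOn (fun p : K × I => u (a p.1, r p)) (R.bdry ×ˢ Set.univ) := fun r hr =>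
    u.continuous.comp_continuousOn (ContinuousOn.prodMk
      (ha.comp continuous_fst.continuousOn fun p hp => hp.1) hr.continuousOn)
  -- The map g b equals g f a on the boundary; running u backwards moves it to a there. The lift is
  -- U(·, 1).
  obtain ⟨U, U0, Ub⟩ := R.exists_extension (fun k => g (b k)) (by fun_prop)
    (fun p : K × I => u (a p.1, σ p.2)) (hau _ (by fun_prop)) (fun k hk => by
      rw [hba k hk]
      simp [hu1])
  -- The homotopy V(b, ·) from f g b to b is deformed, rel its two ends, by θ over the boundary,
  -- where it becomes f u(a, ·) exactly.
  obtain ⟨W, W0, Wb⟩ := (R.prod Radial.interval).exists_extension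
    (fun p : K × I => V (b p.1, σ p.2)) (by fun_prop)
    (fun p : (K × I) × I => if p.1.2 = 0 ∨ p.1.2 = 1 then V (b p.1.1, σ p.1.2) else
      θ ((a p.1.1, σ p.1.2), σ p.2)) (by
      have e : ((R.prod Radial.interval).bdry ×ˢ (Set.univ : Set I)) =
          {p | p.1.1 ∈ R.bdry} ∪ {p | p.1.2 = 0 ∨ p.1.2 = 1} := by
        ext ⟨⟨k, s⟩, t⟩
        simp [Radial.mem_bdry_prod, Radial.mem_bdry_interval]
      have c1 : IsClosed {p : (K × I) × I | p.1.1 ∈ R.bdry} :=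
        R.isClosed_bdry.preimage (by fun_prop)
      have c2 : IsClosed {p : (K × I) × I | p.1.2 = 0 ∨ p.1.2 = 1} :=
        (isClosed_eq (by fun_prop) (by fun_prop)).union (isClosed_eq (by fun_prop) (by fun_prop))
      rw [e]
      refine ContinuousOn.union_of_isClosed ?_ ?_ c1 c2
      · refine (θ.continuous.comp_continuousOn (f := fun p : (K × I) × I =>
          ((a p.1.1, σ p.1.2), σ p.2)) ?_).congr ?_
        · refine ContinuousOn.prodMk (ContinuousOn.prodMk
            (ha.comp (f := fun p : (K × I) × I => p.1.1) (by fun_prop) fun p hp => hp)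
            (by fun_prop)) (by fun_prop)
        · rintro ⟨⟨k, s⟩, t⟩ (hk : k ∈ R.bdry)
          dsimp only
          split_ifs with h
          · rcases h with rfl | rfl
            · simp [hθ _ _ m1, hu1, hV1, hba k hk]
            · simp [hθ _ _ m0, hu0, hV0, hba k hk]
          · rfl
      · refine (V.continuous.comp (f := fun p : (K × I) × I =>
          (b p.1.1, σ p.1.2)) (by fun_prop)).continuousOn.congr ?_
        rintro ⟨⟨k, s⟩, t⟩ h
        exact if_pos h) (by
      rintro ⟨k, s⟩ hks
      rw [Radial.mem_bdry_prod, Radial.mem_bdry_interval] at hks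
      dsimp only at hks ⊢
      split_ifs with h
      · rfl
      · rw [unitInterval.symm_zero, hθ1, hba k (hks.resolve_right h)])
  have hW1 : ∀ k ∈ R.bdry, ∀ s, W ((k, s), 1) = f (u (a k, σ s)) := fun k hk s => by
    rw [Wb _ (by simp [Radial.mem_bdry_prod, hk])]
    dsimp only
    split_ifs with h
    · rcases h with rfl | rfl
      · simp [hu1, hV1, hba k hk]
      · simp [hu0, hV0, hba k hk]
    · rw [unitInterval.symm_one, hθ0]
  have hW10 : ∀ k, W ((k, 0), 1) = f (g (b k)) := fun k => by
    rw [Wb _ (by simp [Radial.mem_bdry_prod, m0])]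
    simp [hV1]
  have hW11 : ∀ k, W ((k, 1), 1) = b k := fun k => by
    rw [Wb _ (by simp [Radial.mem_bdry_prod, m1])]
    simp [hV0]
  -- The lid goes from b to f U(·, 1). On the boundary, two copies of the path f u(a, ·) cancel
  -- through max(s, t), so the lid is constant there.
  obtain ⟨T, T0, T1, Tb⟩ := R.exists_filling (fun p => f (U p)) (fun p => W (p, 1))
    (fun p => f (U (p.1, 1))) (fun p => f (u (a p.1, σ (max p.2.1 p.2.2)))) (by fun_prop)
    (by fun_prop) (by fun_prop) (f.continuous.comp_continuousOn (u.continuous.comp_continuousOn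
      (ContinuousOn.prodMk (ha.comp (f := fun p : K × I × I => p.1) (by fun_prop)
        fun p hp => hp.1) (by fun_prop))))
    (fun k => by rw [U0, hW10]) (fun k => rfl)
    (fun k hk s => by simp [Ub k hk])
    (fun k hk t => by simp [hW1 k hk])
    (fun k hk t => by simp [Ub k hk, max_eq_left (le_one' : t ≤ 1)])
  refine ⟨⟨fun k => U (k, 1), by fun_prop⟩, T, fun k hk => ?_, fun k => ?_, fun k => T1 k,
    fun k hk t => ?_⟩
  · exact (Ub k hk 1).trans (by simp [hu0])
  · rw [T0, hW11]
  · rw [Tb k hk]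
    simp [hu0, hba k hk, max_eq_right (le_one' : t ≤ 1)]

theorem homotopicRel_of_bdry {K Z : Type*} [TopologicalSpace K] [TopologicalSpace Z]
    {S : Set K} {a b : C(K, Z)} (H : C(K × I, Z)) (h0 : ∀ k, H (k, 0) = a k)
    (h1 : ∀ k, H (k, 1) = b k) (hS : ∀ k ∈ S, ∀ t, H (k, t) = a k) : a.HomotopicRel b S :=
  ⟨{ toFun := fun p => H (p.2, p.1)
     continuous_toFun := by fun_prop
     map_zero_left := h0
     map_one_left := h1
     prop' := fun t k hk => hS k hk t }⟩

/-- Surjectivity comes from lifting over a point and over cubes; injectivity from lifting over the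
interval and over cube × interval, where the boundary carries the two representatives. -/
theorem isWeakHomotopyEquivalence_of_bdryLifting
    [Nonempty P]
    (h : ∀ {K : Type} [TopologicalSpace K] (R : Radial K), HasBdryLifting f R) :
    IsWeakHomotopyEquivalence f where
  bijective_zerothHomotopy := by
    constructor
    · intro x₀ x₁ e
      induction x₀ using Quotient.inductionOn with | _ x₀
      induction x₁ using Quotient.inductionOn with | _ x₁
      obtain ⟨γ⟩ : Joined (f x₀) (f x₁) := Quotient.exact e
      obtain ⟨a', -, ha, -⟩ := h Radial.interval γ.toContinuousMap
        (fun t => if t = 0 then x₀ else x₁) (by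
          have : Radial.interval.bdry.Finite :=
            (Set.toFinite {0, 1}).subset fun s hs => Radial.mem_bdry_interval.1 hs
          exact this.continuousOn _) (by
          intro k hk
          rcases Radial.mem_bdry_interval.1 hk with rfl | rfl <;> simp)
      refine Quotient.sound ⟨⟨a', ?_, ?_⟩⟩
      · simp [ha 0 (Radial.mem_bdry_interval.2 (Or.inl rfl))]
      · simp [ha 1 (Radial.mem_bdry_interval.2 (Or.inr rfl))]
    · intro y
      induction y using Quotient.inductionOn with | _ y
      obtain ⟨a', H, -, H0, H1, -⟩ := h (Radial.noBdry PUnit.{1}) (ContinuousMap.const _ y)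
        (fun _ => Classical.arbitrary P) (by simp) (by simp)
      refine ⟨Quotient.mk _ (a' PUnit.unit), Quotient.sound (Joined.symm ⟨⟨⟨fun t =>
        H (PUnit.unit, t), by fun_prop⟩, H0 _, H1 _⟩⟩)⟩
  bijective_homotopyGroup n x hn := by
    constructor
    · intro γ₀ γ₁ e
      induction γ₀ using Quotient.inductionOn with | _ γ₀
      induction γ₁ using Quotient.inductionOn with | _ γ₁
      obtain ⟨G⟩ := (Quotient.exact e : ContinuousMap.HomotopicRel _ _ _)
      obtain ⟨a', -, ha, -⟩ := h ((Radial.cube (Fin n)).prod Radial.interval)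
        ⟨fun p => G (p.2, p.1), by fun_prop⟩
        (fun p => if p.2 = 0 then γ₀ p.1 else if p.2 = 1 then γ₁ p.1 else x) (by
          have e : ((Radial.cube (Fin n)).prod Radial.interval).bdry =
              ({p | p.1 ∈ Cube.boundary (Fin n)} ∪ {p | p.2 = 0}) ∪ {p | p.2 = 1} := by
            ext ⟨k, s⟩
            simp [Radial.mem_bdry_prod, Radial.mem_bdry_interval, Radial.bdry_cube, or_assoc]
          have c1 : IsClosed {p : (Fin n → I) × I | p.1 ∈ Cube.boundary (Fin n)} := by
            rw [← Radial.bdry_cube]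
            exact (Radial.isClosed_bdry _).preimage (by fun_prop)
          have c2 : IsClosed {p : (Fin n → I) × I | p.2 = 0} :=
            isClosed_eq (by fun_prop) (by fun_prop)
          have c3 : IsClosed {p : (Fin n → I) × I | p.2 = 1} :=
            isClosed_eq (by fun_prop) (by fun_prop)
          rw [e]
          refine ContinuousOn.union_of_isClosed (ContinuousOn.union_of_isClosed ?_ ?_ c1 c2) ?_
            (c1.union c2) c3
          · refine (continuousOn_const (c := x)).congr ?_
            rintro ⟨k, s⟩ hk
            have e0 : γ₀ k = x := γ₀.2 k hk
            have e1 : γ₁ k = x := γ₁.2 k hk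
            simp [e0, e1]
          · refine (γ₀.1.continuous.comp continuous_fst).continuousOn.congr ?_
            rintro ⟨k, s⟩ (rfl : s = 0)
            simp
          · refine (γ₁.1.continuous.comp continuous_fst).continuousOn.congr ?_
            rintro ⟨k, s⟩ (rfl : s = 1)
            simp) (by
          rintro ⟨k, s⟩ hk
          rw [Radial.mem_bdry_prod, Radial.mem_bdry_interval, Radial.bdry_cube] at hk
          rcases hk with hk | (rfl : s = 0) | (rfl : s = 1)
          · have e0 : γ₀ k = x := γ₀.2 k hk
            have e1 : γ₁ k = x := γ₁.2 k hk
            have := G.eq_fst s hk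
            dsimp at this ⊢
            rw [this]
            simp [e0, e1]
          · simp
          · simp)
      refine Quotient.sound (homotopicRel_of_bdry a' (fun k => ?_) (fun k => ?_)
        fun k hk t => ?_)
      · rw [ha (k, 0) (by simp [Radial.mem_bdry_prod, Radial.mem_bdry_interval])]
        simp
      · rw [ha (k, 1) (by simp [Radial.mem_bdry_prod, Radial.mem_bdry_interval])]
        simp
      · rw [ha (k, t) (by simp [Radial.mem_bdry_prod, Radial.bdry_cube, hk])]
        have e0 : γ₀ k = x := γ₀.2 k hk
        have e1 : γ₁ k = x := γ₁.2 k hk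
        simp [e0, e1]
    · intro γ
      induction γ using Quotient.inductionOn with | _ γ
      obtain ⟨a', H, ha, H0, H1, Hb⟩ := h (Radial.cube (Fin n)) γ.1 (fun _ => x)
        continuousOn_const (fun k hk => γ.2 k (by rwa [Radial.bdry_cube] at hk))
      rw [Radial.bdry_cube] at ha Hb
      exact ⟨Quotient.mk _ ⟨a', ha⟩, Quotient.sound
        (ContinuousMap.HomotopicRel.symm (homotopicRel_of_bdry H H0 H1 Hb))⟩

theorem isWeakHomotopyEquivalence_of_dualLifting [Nonempty P]
    (h₀ : HasDualLifting f (Radial.noBdry PUnit.{1}))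
    (h₁ : HasDualLifting f Radial.interval) : IsWeakHomotopyEquivalence f :=
  isWeakHomotopyEquivalence_of_bdryLifting fun R => .of_dual h₀ h₁ R

end

/-! ### Composition of weak homotopy equivalences -/

section Comp

variable {X Y Z : Type w} [TopologicalSpace X] [TopologicalSpace Y] [TopologicalSpace Z]

theorem IsWeakHomotopyEquivalence.comp {g : C(Y, Z)} {f : C(X, Y)}
    (hg : IsWeakHomotopyEquivalence g) (hf : IsWeakHomotopyEquivalence f) :
    IsWeakHomotopyEquivalence (g.comp f) where
  bijective_zerothHomotopy := by
    have e : mapZerothHomotopy (g.comp f) = mapZerothHomotopy g ∘ mapZerothHomotopy f := by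
      funext x
      induction x using Quotient.inductionOn
      rfl
    rw [e]
    exact hg.1.comp hf.1
  bijective_homotopyGroup n x hn := by
    have e : mapHomotopyGroup (g.comp f) n x =
        mapHomotopyGroup g n (f x) ∘ mapHomotopyGroup f n x := by
      funext x
      induction x using Quotient.inductionOn
      rfl
    rw [e]
    exact (hg.2 n (f x) hn).comp (hf.2 n x hn)

end Comp

open unitInterval

/-! ### Topological simplices -/

section Simplex

theorem map_apply_of_injective {X Y : Type} [Fintype X] [Fintype Y] {f : X → Y}
    (hf : Function.Injective f) (t : stdSimplex ℝ X) (x : X) : stdSimplex.map f t (f x) = t x := by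
  classical
  rw [stdSimplex.map_coe, FunOnFinite.linearMap_apply_apply]
  have : (Finset.univ.filter fun y => f y = f x) = {x} := by
    ext y
    simp [hf.eq_iff]
  rw [this, Finset.sum_singleton]

theorem map_apply_of_notMem_range {X Y : Type} [Fintype X] [Fintype Y] {f : X → Y}
    (t : stdSimplex ℝ X) {y : Y} (hy : y ∉ Set.range f) : stdSimplex.map f t y = 0 := by
  classical
  rw [stdSimplex.map_coe, FunOnFinite.linearMap_apply_apply]
  refine Finset.sum_eq_zero fun x hx => (hy ⟨x, ?_⟩).elim
  simpa using hx

theorem map_stdSimplex_injective {X Y : Type} [Fintype X] [Fintype Y] {f : X → Y}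
    (hf : Function.Injective f) : Function.Injective (stdSimplex.map (S := ℝ) f) := by
  intro s t h
  refine stdSimplex.ext (funext fun x => ?_)
  rw [← map_apply_of_injective hf, h, map_apply_of_injective hf]

theorem isClosedEmbedding_map_stdSimplex {X Y : Type} [Fintype X] [Fintype Y] {f : X → Y}
    (hf : Function.Injective f) : Topology.IsClosedEmbedding (stdSimplex.map (S := ℝ) f) :=
  (stdSimplex.continuous_map f).isClosedEmbedding (map_stdSimplex_injective hf)

/-- A point of a simplex lies in the interior of a face. -/
theorem exists_support {L : Type} [LinearOrder L] [Fintype L] (t : stdSimplex ℝ L) :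
    ∃ (m : ℕ) (θ : Fin (m + 1) ↪o L) (s : stdSimplex ℝ (Fin (m + 1))),
      stdSimplex.map θ s = t ∧ ∀ i, 0 < s i := by
  classical
  set S : Finset L := Finset.univ.filter fun i => 0 < t i with hS
  have hne : S.Nonempty := by
    by_contra h
    rw [Finset.not_nonempty_iff_eq_empty, Finset.filter_eq_empty_iff] at h
    have h1 := stdSimplex.sum_eq_one t
    rw [Finset.sum_eq_zero fun i hi => le_antisymm (not_lt.1 (h hi)) (stdSimplex.zero_le t i)]
      at h1
    exact zero_ne_one h1
  obtain ⟨m, hm⟩ : ∃ m, S.card = m + 1 := ⟨S.card - 1, by have := hne.card_pos; omega⟩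
  set θ := S.orderEmbOfFin hm
  have hθ : ∀ i, 0 < t (θ i) := fun i => by
    have := S.orderEmbOfFin_mem hm i
    exact (Finset.mem_filter.1 this).2
  have hr : ∀ j, j ∉ Set.range θ → t j = 0 := fun j hj => by
    have : j ∉ S := by
      intro h
      apply hj
      rw [S.range_orderEmbOfFin hm]
      exact h
    rw [hS, Finset.mem_filter] at this
    exact le_antisymm (not_lt.1 fun h => this ⟨Finset.mem_univ _, h⟩) (stdSimplex.zero_le t j)
  refine ⟨m, θ, ⟨fun i => t (θ i), fun i => (hθ i).le, ?_⟩, ?_, hθ⟩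
  · rw [← stdSimplex.sum_eq_one t]
    refine (Finset.sum_map Finset.univ θ.toEmbedding t).symm.trans ?_
    refine Finset.sum_subset (Finset.subset_univ _) fun j _ hj => hr j ?_
    rintro ⟨i, rfl⟩
    exact hj (Finset.mem_map_of_mem _ (Finset.mem_univ i))
  · refine stdSimplex.ext (funext fun j => ?_)
    by_cases hj : j ∈ Set.range θ
    · obtain ⟨i, rfl⟩ := hj
      exact map_apply_of_injective θ.injective _ _
    · rw [map_apply_of_notMem_range _ hj, hr j hj]

/-- A point with positive coordinates whose image lies in a face comes from that face. -/
theorem exists_factor_of_pos {L M N : Type} [LinearOrder L] [LinearOrder M]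
    [Preorder N] [Fintype L] [Fintype M] [Fintype N] (α : L →o N) (θ : M ↪o N)
    {s : stdSimplex ℝ L} (hs : ∀ i, 0 < s i) {t : stdSimplex ℝ M}
    (h : stdSimplex.map α s = stdSimplex.map θ t) : ∃ κ : L →o M, ∀ x, θ (κ x) = α x := by
  classical
  have hr : ∀ x, α x ∈ Set.range θ := by
    intro x
    by_contra hx
    have h0 := map_apply_of_notMem_range t hx
    rw [← h, stdSimplex.map_coe, FunOnFinite.linearMap_apply_apply,
      Finset.sum_eq_zero_iff_of_nonneg fun i _ => stdSimplex.zero_le s i] at h0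
    exact (hs x).ne' (h0 x (by simp))
  choose κ hκ using hr
  refine ⟨⟨κ, fun a b hab => ?_⟩, hκ⟩
  rw [← θ.le_iff_le, hκ, hκ]
  exact α.monotone hab

/-- Two faces meet in a face. -/
theorem exists_common_face {L M N : Type} [LinearOrder L] [LinearOrder M] [LinearOrder N]
    [Fintype L] [Fintype M] [Fintype N] (θ : L ↪o N) (θ' : M ↪o N)
    {t : stdSimplex ℝ L} {t' : stdSimplex ℝ M} (h : stdSimplex.map θ t = stdSimplex.map θ' t') :
    ∃ (c : ℕ) (κ : Fin (c + 1) ↪o L) (κ' : Fin (c + 1) ↪o M) (s : stdSimplex ℝ (Fin (c + 1))),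
      (∀ x, θ (κ x) = θ' (κ' x)) ∧ t = stdSimplex.map κ s ∧ t' = stdSimplex.map κ' s := by
  obtain ⟨c, κ, s, rfl, hs⟩ := exists_support t
  let αs : Fin (c + 1) →o N := ⟨fun x => θ (κ x), θ.monotone.comp κ.monotone⟩
  have h2 : stdSimplex.map αs s = stdSimplex.map θ' t' := by
    rw [← h, stdSimplex.map_comp_apply]
    rfl
  obtain ⟨κ', hκ'⟩ := exists_factor_of_pos αs θ' hs h2
  have hinj : Function.Injective κ' := fun a b hab => by
    apply κ.injective
    apply θ.injective
    exact (hκ' a).symm.trans ((congrArg θ' hab).trans (hκ' b))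
  refine ⟨c, κ, OrderEmbedding.ofStrictMono κ' (κ'.monotone.strictMono_of_injective hinj), s,
    fun x => (hκ' x).symm, rfl, ?_⟩
  apply map_stdSimplex_injective θ'.injective
  rw [← h2, stdSimplex.map_comp_apply]
  congr 1
  funext x
  exact (hκ' x).symm

theorem map_mem_of_notSurjective {X Y : Type} [Fintype X] [Fintype Y] {f : X → Y}
    (hf : ¬ Function.Surjective f) (t : stdSimplex ℝ X) : ∃ y, stdSimplex.map f t y = 0 := by
  simp only [Function.Surjective, not_forall] at hf
  obtain ⟨y, hy⟩ := hf
  exact ⟨y, map_apply_of_notMem_range t hy⟩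

/-! ### The radial structure of a simplex -/

namespace Radial

variable (n : ℕ)

/-- The deviation of a point of the simplex from the barycentre. -/
noncomputable def simplexGauge (t : stdSimplex ℝ (Fin (n + 1))) : ℝ :=
  Finset.univ.sup' Finset.univ_nonempty fun i => 1 - (n + 1 : ℝ) * t i

variable {n}

theorem le_simplexGauge (t : stdSimplex ℝ (Fin (n + 1))) (i : Fin (n + 1)) :
    1 - (n + 1 : ℝ) * t i ≤ simplexGauge n t :=
  Finset.le_sup' (fun i => 1 - (n + 1 : ℝ) * t i) (Finset.mem_univ i)

theorem exists_simplexGauge (t : stdSimplex ℝ (Fin (n + 1))) :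
    ∃ i, simplexGauge n t = 1 - (n + 1 : ℝ) * t i := by
  obtain ⟨i, -, hi⟩ := Finset.exists_mem_eq_sup' Finset.univ_nonempty
    fun i => 1 - (n + 1 : ℝ) * t i
  exact ⟨i, hi⟩

theorem continuous_stdSimplex_apply {X : Type} [Fintype X] (i : X) :
    Continuous fun t : stdSimplex ℝ X => t i :=
  (continuous_apply i).comp continuous_subtype_val

theorem continuous_simplexGauge : Continuous (simplexGauge n) := by
  refine Continuous.finset_sup'_apply _ fun i _ => ?_
  exact continuous_const.sub (continuous_const.mul (continuous_stdSimplex_apply i))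

theorem simplexGauge_le_one (t : stdSimplex ℝ (Fin (n + 1))) : simplexGauge n t ≤ 1 := by
  refine Finset.sup'_le _ _ fun i _ => ?_
  have := stdSimplex.zero_le t i
  have : 0 ≤ (n + 1 : ℝ) * t i := by positivity
  linarith

theorem simplexGauge_eq_one_iff {t : stdSimplex ℝ (Fin (n + 1))} :
    simplexGauge n t = 1 ↔ ∃ i, t i = 0 := by
  constructor
  · intro h
    obtain ⟨i, hi⟩ := exists_simplexGauge t
    refine ⟨i, ?_⟩
    have : (n + 1 : ℝ) * t i = 0 := by linarith
    exact (mul_eq_zero.1 this).resolve_left (by positivity)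
  · rintro ⟨i, hi⟩
    refine le_antisymm (simplexGauge_le_one t) ?_
    have := le_simplexGauge t i
    rw [hi] at this
    simpa using this

/-- Rescaling of the simplex around the barycentre. -/
noncomputable def simplexPush (t : stdSimplex ℝ (Fin (n + 1))) (m : ℝ) :
    stdSimplex ℝ (Fin (n + 1)) :=
  ⟨fun i => 1 / (n + 1 : ℝ) + (t i - 1 / (n + 1 : ℝ)) / max (1 / 2) (max m (simplexGauge n t)), by
    have hM : 0 < max (1 / 2) (max m (simplexGauge n t)) := lt_max_of_lt_left (by norm_num)
    have hn : (0 : ℝ) < n + 1 := by positivity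
    constructor
    · intro i
      have h1 : 1 - (n + 1 : ℝ) * t i ≤ max (1 / 2) (max m (simplexGauge n t)) :=
        (le_simplexGauge t i).trans ((le_max_right _ _).trans (le_max_right _ _))
      have : 1 / (n + 1 : ℝ) + (t i - 1 / (n + 1 : ℝ)) / max (1 / 2) (max m (simplexGauge n t)) =
          (max (1 / 2) (max m (simplexGauge n t)) - (1 - (n + 1 : ℝ) * t i)) /
            ((n + 1) * max (1 / 2) (max m (simplexGauge n t))) := by
        field_simp
        ring
      refine le_of_le_of_eq ?_ this.symm
      exact div_nonneg (by linarith) (by positivity)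
    · have h1 := stdSimplex.sum_eq_one t
      rw [Finset.sum_add_distrib, ← Finset.sum_div Finset.univ (fun i => t i - 1 / (n + 1 : ℝ)),
        Finset.sum_sub_distrib, h1]
      simp [mul_inv_cancel₀ hn.ne']⟩

theorem simplexPush_apply (t : stdSimplex ℝ (Fin (n + 1))) (m : ℝ) (i : Fin (n + 1)) :
    simplexPush t m i =
      1 / (n + 1 : ℝ) + (t i - 1 / (n + 1 : ℝ)) / max (1 / 2) (max m (simplexGauge n t)) := rfl

theorem continuous_simplexPush :
    Continuous fun p : stdSimplex ℝ (Fin (n + 1)) × ℝ => simplexPush p.1 p.2 := by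
  refine Continuous.subtype_mk (continuous_pi fun i => ?_) _
  have h1 := continuous_simplexGauge (n := n)
  have h2 := continuous_stdSimplex_apply i
  refine continuous_const.add (Continuous.div
    ((h2.comp continuous_fst).sub continuous_const) (by fun_prop) fun p => ?_)
  have : 0 < max (1 / 2) (max p.2 (simplexGauge n p.1)) := lt_max_of_lt_left (by norm_num)
  exact this.ne'

theorem simplexGauge_push (t : stdSimplex ℝ (Fin (n + 1))) (m : ℝ) (hm : 1 / 2 ≤ m) :
    simplexGauge n (simplexPush t m) = simplexGauge n t / max m (simplexGauge n t) := by
  have hM : max (1 / 2) (max m (simplexGauge n t)) = max m (simplexGauge n t) := by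
    rw [← max_assoc, max_eq_right hm]
  have hpos : 0 < max m (simplexGauge n t) := lt_max_of_lt_left (by linarith)
  have hn : (0 : ℝ) < n + 1 := by positivity
  have key : ∀ i, 1 - (n + 1 : ℝ) * simplexPush t m i =
      (1 - (n + 1 : ℝ) * t i) / max m (simplexGauge n t) := fun i => by
    rw [simplexPush_apply, hM]
    field_simp
    ring
  refine le_antisymm (Finset.sup'_le _ _ fun i _ => ?_) ?_
  · rw [key]
    exact div_le_div_of_nonneg_right (le_simplexGauge t i) hpos.le
  · obtain ⟨i, hi⟩ := exists_simplexGauge t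
    refine le_trans (le_of_eq ?_) (le_simplexGauge _ i)
    rw [key, ← hi]

/-- The radial structure of a simplex. -/
noncomputable def simplex (n : ℕ) : Radial (stdSimplex ℝ (Fin (n + 1))) where
  gauge := simplexGauge n
  push := simplexPush
  continuous_gauge := continuous_simplexGauge
  continuous_push := continuous_simplexPush
  gauge_nonneg t := by
    by_contra! h
    have h1 := stdSimplex.sum_eq_one t
    -- The deviations 1 - (n + 1) t_i sum to 0, so they cannot all be negative.
    have h2 : ∑ i, (1 - (n + 1 : ℝ) * t i) < ∑ i : Fin (n + 1), 0 :=
      Finset.sum_lt_sum_of_nonempty Finset.univ_nonempty fun i _ =>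
        (le_simplexGauge t i).trans_lt h
    rw [Finset.sum_sub_distrib, ← Finset.mul_sum, h1] at h2
    simp at h2
  gauge_le := simplexGauge_le_one
  gauge_push t m hm _ := simplexGauge_push t m hm
  push_eq t m hm _ h := by
    refine stdSimplex.ext (funext fun i => ?_)
    rw [simplexPush_apply, h, max_eq_right (by norm_num)]
    ring

theorem mem_bdry_simplex {t : stdSimplex ℝ (Fin (n + 1))} :
    t ∈ (simplex n).bdry ↔ ∃ i, t i = 0 :=
  simplexGauge_eq_one_iff

end Radial

end Simplex

/-- A map defined on finitely many closed pieces. -/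
theorem exists_glue {Q W Z A : Type*} [TopologicalSpace Q] [TopologicalSpace W]
    [TopologicalSpace Z] [Finite A] [Nonempty Z] {F : A → Type*} [∀ a, TopologicalSpace (F a)]
    (e : ∀ a, F a → Q) (he : ∀ a, Topology.IsClosedEmbedding (e a)) (φ : ∀ a, C(F a × W, Z))
    (hφ : ∀ a b t t', e a t = e b t' → ∀ w, φ a (t, w) = φ b (t', w)) :
    ∃ Φ : Q × W → Z, ContinuousOn Φ ((⋃ a, Set.range (e a)) ×ˢ Set.univ) ∧
      ∀ a t w, Φ (e a t, w) = φ a (t, w) := by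
  classical
  let Φ : Q × W → Z := fun p => if h : ∃ a t, e a t = p.1 then
    φ h.choose (h.choose_spec.choose, p.2) else Classical.arbitrary Z
  have hΦ : ∀ a t w, Φ (e a t, w) = φ a (t, w) := fun a t w => by
    have h : ∃ b s, e b s = e a t := ⟨a, t, rfl⟩
    simp only [Φ, dif_pos h]
    exact hφ _ _ _ _ h.choose_spec.choose_spec w
  refine ⟨Φ, ?_, hΦ⟩
  rw [Set.iUnion_prod_const]
  refine (locallyFinite_of_finite _).continuousOn_iUnion
    (fun a => (he a).isClosed_range.prod isClosed_univ) fun a => ?_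
  have hq : Topology.IsClosedEmbedding (Prod.map (e a) id : F a × W → Q × W) :=
    (he a).prodMap .id
  have : Set.range (e a) ×ˢ (Set.univ : Set W) =
      (Prod.map (e a) id : F a × W → Q × W) '' Set.univ := by
    rw [Set.image_univ, Set.range_prodMap, Set.range_id]
  rw [this, hq.isInducing.continuousOn_image_iff, continuousOn_univ]
  refine (φ a).continuous.congr fun p => (hΦ a p.1 p.2).symm

/-! ### Maps out of realizations -/

namespace Realization

variable {J : Type} [SmallCategory J] {ι : J ⥤ SimplexCategory} {X : Jᵒᵖ ⥤ TopCat.{w}}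

variable (ι X) in
/-- The point of the realization represented by a pair of points. -/
def point (j : J) (x : X.obj (op j)) (t : SimplexCategory.toTop₀.obj (ι.obj j)) : Realization ι X :=
  Quot.mk _ ⟨j, x, t⟩

theorem exists_point (z : Realization ι X) : ∃ j x t, point ι X j x t = z := by
  obtain ⟨⟨j, x, t⟩, rfl⟩ := Quot.exists_rep z
  exact ⟨j, x, t, rfl⟩

theorem point_map {m n : J} (f : m ⟶ n) (x : X.obj (op n))
    (t : SimplexCategory.toTop₀.obj (ι.obj m)) :
    point ι X m (X.map f.op x) t = point ι X n x (SimplexCategory.toTop₀.map (ι.map f) t) :=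
  Quot.sound (.glue f x t)

theorem continuous_point (j : J) :
    Continuous fun p : X.obj (op j) × SimplexCategory.toTop₀.obj (ι.obj j) =>
      point ι X j p.1 p.2 :=
  continuous_quot_mk.comp (@continuous_sigmaMk J
    (fun j => X.obj (op j) × SimplexCategory.toTop₀.obj (ι.obj j)) _ j)

/-- A product of a quotient map with W need not be a quotient map. For locally compact W the map can
be curried into `C(W, Z)`, where only the quotient topology of the realization is involved. -/
theorem continuous_of_point_prod {W Z : Type*} [TopologicalSpace W] [LocallyCompactSpace W]
    [TopologicalSpace Z] {F : Realization ι X × W → Z}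
    (h : ∀ j, Continuous fun p : (X.obj (op j) × SimplexCategory.toTop₀.obj (ι.obj j)) × W =>
      F (point ι X j p.1.1 p.1.2, p.2)) : Continuous F := by
  let G : Realization ι X → C(W, Z) := fun z => ⟨fun w => F (z, w), by
    obtain ⟨j, x, t, rfl⟩ := exists_point z
    exact (h j).comp (by fun_prop : Continuous fun w : W => ((x, t), w))⟩
  have hG : Continuous G := by
    refine continuous_coinduced_dom.2 (continuous_sigma fun j => ?_)
    exact ContinuousMap.continuous_of_continuous_uncurry _ (h j)
  exact ContinuousMap.continuous_uncurry_of_continuous ⟨G, hG⟩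

end Realization

/-! ### Maps out of geometric realizations of simplicial sets -/

section Cell

/-- The characteristic map of a simplex. -/
noncomputable def cell (K : SSet.{w}) {q : SimplexCategory} (τ : K.obj (op q)) :
    C(stdSimplex ℝ (Fin (q.len + 1)), SSet.toTop.obj K) :=
  TopCat.toSSetObjEquiv _ (op q) ((sSetTopAdj.unit.app K).app (op q) τ)

variable {K : SSet.{w}}

theorem cell_map {p q : SimplexCategory} (β : p ⟶ q) (τ : K.obj (op q))
    (u : stdSimplex ℝ (Fin (p.len + 1))) :
    cell K (K.map β.op τ) u = cell K τ (stdSimplex.map β u) := by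
  have h := ConcreteCategory.congr_hom ((sSetTopAdj.unit.app K).naturality β.op) τ
  have h2 := TopCat.toSSetObjEquiv_naturality_apply β ((sSetTopAdj.unit.app K).app (op q) τ) u
  refine Eq.trans ?_ h2
  exact congrArg (fun z => TopCat.toSSetObjEquiv _ (op p) z u) h

theorem map_cell {L : SSet.{w}} (g : K ⟶ L) {q : SimplexCategory} (τ : K.obj (op q))
    (u : stdSimplex ℝ (Fin (q.len + 1))) :
    SSet.toTop.map g (cell K τ u) = cell L (g.app _ τ) u := by
  have h := ConcreteCategory.congr_hom (NatTrans.congr_app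
    (sSetTopAdj.unit.naturality g) (op q)) τ
  exact congrArg (fun z => TopCat.toSSetObjEquiv _ (op q) z u) h.symm

/-- A compatible family on cells is a simplicial map to the singular set of Z, and the adjunction
turns it into a continuous map. -/
theorem exists_desc (Z : TopCat.{w})
    (φ : ∀ (q : SimplexCategory), K.obj (op q) → C(stdSimplex ℝ (Fin (q.len + 1)), Z))
    (hφ : ∀ (p q : SimplexCategory) (β : p ⟶ q) (τ : K.obj (op q)) (u),
      φ p (K.map β.op τ) u = φ q τ (stdSimplex.map β u)) :
    ∃ F : C(SSet.toTop.obj K, Z), ∀ (q : SimplexCategory) (τ : K.obj (op q)) (u),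
      F (cell K τ u) = φ q τ u := by
  let η : K ⟶ TopCat.toSSet.obj Z :=
    { app := fun q => TypeCat.ofHom fun τ => (TopCat.toSSetObjEquiv Z q).symm (φ q.unop τ)
      naturality := fun q p β => by
        ext τ
        apply (TopCat.toSSetObjEquiv Z p).injective
        ext u
        exact hφ p.unop q.unop β.unop τ u }
  refine ⟨((sSetTopAdj.homEquiv K Z).symm η).hom, fun q τ u => ?_⟩
  have h : sSetTopAdj.unit.app K ≫ TopCat.toSSet.map ((sSetTopAdj.homEquiv K Z).symm η) = η :=
    (sSetTopAdj.homEquiv_unit K Z _).symm.trans (Equiv.apply_symm_apply _ _)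
  have h2 := ConcreteCategory.congr_hom (NatTrans.congr_app h (op q)) τ
  exact congrArg (fun z => TopCat.toSSetObjEquiv _ (op q) z u) h2

theorem hom_ext_cell {Z : Type w} [TopologicalSpace Z] {F G : C(SSet.toTop.obj K, Z)}
    (h : ∀ (q : SimplexCategory) (τ : K.obj (op q)) u, F (cell K τ u) = G (cell K τ u)) :
    F = G := by
  have : TopCat.ofHom (X := SSet.toTop.obj K) (Y := TopCat.of Z) F = TopCat.ofHom G := by
    apply (sSetTopAdj.homEquiv _ _).injective
    ext q τ
    apply (TopCat.toSSetObjEquiv _ q).injective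
    ext u
    rw [Adjunction.homEquiv_unit, Adjunction.homEquiv_unit]
    exact h q.unop τ u
  exact congrArg TopCat.Hom.hom this

/-- A point missed by all cells could not be detected by maps out of the realization, contradicting
`hom_ext_cell`. -/
theorem exists_cell (z : SSet.toTop.obj K) :
    ∃ (q : SimplexCategory) (τ : K.obj (op q)) (u : _), cell K τ u = z := by
  by_contra! h
  -- With the indiscrete topology every predicate is continuous, in particular "equal to z".
  let : TopologicalSpace (ULift.{w} Prop) := ⊤
  have := hom_ext_cell (K := K) (Z := ULift.{w} Prop) (F := ⟨fun y => ⟨y = z⟩, continuous_top⟩)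
    (G := ⟨fun _ => ⟨False⟩, continuous_top⟩) fun q τ u => by simp [h q τ u]
  have h2 := congrArg ULift.down (ContinuousMap.congr_fun this z)
  simp at h2

end Cell

/-! ### Semi-simplicial realizations and levelwise equivalences -/

open scoped Simplicial
open SemiSimplexCategory

/-- Recursive choice of a sequence subject to compatibility conditions between its terms. -/
theorem exists_compatible_seq {T : ℕ → Type*} (P : ∀ n, T n → Prop)
    (R : ∀ m n, T m → T n → Prop)
    (step : ∀ (n : ℕ) (s : ∀ m, m < n → T m), (∀ m hm, P m (s m hm)) →
      (∀ m m' (h : m < m') (h' : m' < n), R m m' (s m (h.trans h')) (s m' h')) →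
      ∃ t : T n, P n t ∧ ∀ m hm, R m n (s m hm) t) :
    ∃ s : ∀ n, T n, (∀ n, P n (s n)) ∧ ∀ m n, m < n → R m n (s m) (s n) := by
  classical
  -- Valid initial segments of length n. Extensions do not alter earlier terms, so the diagonal of
  -- the resulting tower is the required sequence.
  let S (n : ℕ) := {s : ∀ m, m < n → T m // (∀ m hm, P m (s m hm)) ∧
    ∀ m m' (h : m < m') (h' : m' < n), R m m' (s m (h.trans h')) (s m' h')}
  have ext : ∀ n (s : S n), ∃ s' : S (n + 1), ∀ m (hm : m < n),
      s'.1 m (hm.trans n.lt_succ_self) = s.1 m hm := by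
    intro n s
    obtain ⟨t, ht, hR⟩ := step n s.1 s.2.1 s.2.2
    let f : ∀ m, m < n + 1 → T m := fun m hm =>
      if h : m < n then s.1 m h else (show n = m by omega) ▸ t
    have f1 : ∀ m (h : m < n) h', f m h' = s.1 m h := fun m h h' => dif_pos h
    have f2 : ∀ h', f n h' = t := fun h' => dif_neg (lt_irrefl n)
    refine ⟨⟨f, fun m hm => ?_, fun m m' h h' => ?_⟩, fun m hm => f1 m hm (hm.trans n.lt_succ_self)⟩
    · rcases (Nat.lt_succ_iff_lt_or_eq.1 hm) with h | rfl
      · rw [f1 m h hm]; exact s.2.1 m h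
      · rw [f2 hm]; exact ht
    · rcases (Nat.lt_succ_iff_lt_or_eq.1 h') with h'' | rfl
      · rw [f1 m (h.trans h'') (h.trans h'), f1 m' h'' h']
        exact s.2.2 m m' h h''
      · rw [f1 m h (h.trans h'), f2 h']
        exact hR m h
  choose next hnext using ext
  let seq : ∀ n, S n := fun n => Nat.rec ⟨fun m hm => absurd hm (Nat.not_lt_zero m),
    fun m hm => absurd hm (Nat.not_lt_zero m), fun m m' _ h' => absurd h' (Nat.not_lt_zero m')⟩
    (fun n s => next n s) n
  have hseq : ∀ n m (hm : m < n), (seq n).1 m hm = (seq (m + 1)).1 m m.lt_succ_self := by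
    intro n
    induction n with
    | zero => intro m hm; exact absurd hm (Nat.not_lt_zero m)
    | succ n ih =>
      intro m hm
      rcases (Nat.lt_succ_iff_lt_or_eq.1 hm) with h | rfl
      · exact (hnext n (seq n) m h).trans (ih m h)
      · rfl
  refine ⟨fun n => (seq (n + 1)).1 n n.lt_succ_self, fun n => (seq (n + 1)).2.1 n _,
    fun m n h => ?_⟩
  have := (seq (n + 1)).2.2 m n h n.lt_succ_self
  rwa [hseq (n + 1) m] at this

namespace Realization

theorem semiSimplexCategory_eq_id {n : SemiSimplexCategory} (θ : n ⟶ n) : θ = 𝟙 n :=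
  toSimplexCategory.map_injective (by
    rw [CategoryTheory.Functor.map_id]
    exact SimplexCategory.eq_id_of_mono _)

theorem map_homEquiv_id (n : ℕ) (t : stdSimplex ℝ (Fin (n + 1))) :
    stdSimplex.map (homEquiv (𝟙 ⦋n⦌ₛ)) t = t :=
  stdSimplex.map_id_apply t

theorem le_of_hom {m n : ℕ} (θ : ⦋m⦌ₛ ⟶ ⦋n⦌ₛ) : m ≤ n := by
  have := Fintype.card_le_of_injective _ (homEquiv θ).injective
  simpa using this

theorem exists_face_of_mem_bdry {n : ℕ} {t : stdSimplex ℝ (Fin (n + 1))}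
    (ht : t ∈ (Radial.simplex n).bdry) :
    ∃ m < n, ∃ (θ : ⦋m⦌ₛ ⟶ ⦋n⦌ₛ) (s : _), stdSimplex.map (homEquiv θ) s = t := by
  obtain ⟨i, hi⟩ := Radial.mem_bdry_simplex.1 ht
  obtain ⟨m, θ, s, rfl, hs⟩ := exists_support t
  refine ⟨m, lt_of_le_of_ne (le_of_hom (homEquiv.symm θ)) ?_, homEquiv.symm θ, s, rfl⟩
  rintro rfl
  obtain ⟨j, rfl⟩ := Finite.surjective_of_injective θ.injective i
  rw [map_apply_of_injective θ.injective] at hi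
  exact (hs j).ne' hi

theorem map_mem_bdry {m n : ℕ} (h : m < n) (θ : ⦋m⦌ₛ ⟶ ⦋n⦌ₛ) (t : stdSimplex ℝ (Fin (m + 1))) :
    stdSimplex.map (homEquiv θ) t ∈ (Radial.simplex n).bdry := by
  refine Radial.mem_bdry_simplex.2 (map_mem_of_notSurjective (fun hs => ?_) t)
  have := Fintype.card_le_of_surjective _ hs
  simp at this
  omega

variable {X Y : SemiSimplexCategoryᵒᵖ ⥤ TopCat.{w}} (η : X ⟶ Y)
  {D : Type} [TopologicalSpace D] {Z : Type w} [TopologicalSpace Z]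

/-- A compatible family of maps on the spaces `X_m × Δ^m × W` for `m < n` defines a map on
`X_n × ∂Δ^n × W`. -/
theorem exists_glue_faces [Nonempty Z] {W : Type*} [TopologicalSpace W] (n : ℕ)
    (φ : ∀ m < n, C(X.obj (op (⦋m⦌ₛ)) × stdSimplex ℝ (Fin (m + 1)) × W, Z))
    (hφ : ∀ m k (h : m < k) (hk : k < n) (θ : ⦋m⦌ₛ ⟶ ⦋k⦌ₛ) a t w,
      φ m (h.trans hk) (X.map θ.op a, t, w) = φ k hk (a, stdSimplex.map (homEquiv θ) t, w)) :
    ∃ Φ : X.obj (op ⦋n⦌ₛ) × stdSimplex ℝ (Fin (n + 1)) × W → Z,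
      ContinuousOn Φ {p | p.2.1 ∈ (Radial.simplex n).bdry} ∧
      ∀ m (h : m < n) (θ : ⦋m⦌ₛ ⟶ ⦋n⦌ₛ) a t w,
        Φ (a, stdSimplex.map (homEquiv θ) t, w) = φ m h (X.map θ.op a, t, w) := by
  -- The compatibility also holds for m = k, because an injective monotone endomorphism of [m] is
  -- the identity.
  have hφ' : ∀ m k (h : m < n) (hk : k < n) (θ : ⦋m⦌ₛ ⟶ ⦋k⦌ₛ) a t w,
      φ m h (X.map θ.op a, t, w) = φ k hk (a, stdSimplex.map (homEquiv θ) t, w) := by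
    intro m k h hk θ a t w
    rcases (le_of_hom θ).lt_or_eq with hlt | rfl
    · exact hφ m k hlt hk θ a t w
    · rw [semiSimplexCategory_eq_id θ, map_homEquiv_id]
      simp
  obtain ⟨Φ, hΦ, hΦ'⟩ := exists_glue (Q := stdSimplex ℝ (Fin (n + 1)))
    (W := X.obj (op ⦋n⦌ₛ) × W) (Z := Z)
    (A := Σ m : Fin n, (Fin (m.1 + 1) ↪o Fin (n + 1)))
    (F := fun a => stdSimplex ℝ (Fin (a.1.1 + 1)))
    (fun a => stdSimplex.map a.2) (fun a => isClosedEmbedding_map_stdSimplex a.2.injective)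
    (fun a => ⟨fun p => φ a.1.1 a.1.2 (X.map ((homEquiv (n := ⦋a.1.1⦌ₛ) (m := ⦋n⦌ₛ)).symm a.2).op p.2.1, p.1, p.2.2),
      by fun_prop⟩) (by
    rintro ⟨⟨m, hm⟩, θ⟩ ⟨⟨k, hk⟩, θ'⟩ t t' e ⟨a, w⟩
    -- A point on two faces lies on their common face, and compatibility compares both values with
    -- the one there.
    obtain ⟨c, κ, κ', s, hκ, rfl, rfl⟩ := exists_common_face θ θ' e
    have hc : c < n := by
      have := Fintype.card_le_of_injective _ κ.injective
      simp at this
      omega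
    change φ m hm (X.map (homEquiv.symm θ).op a, _, w) =
      φ k hk (X.map (homEquiv.symm θ').op a, _, w)
    have e1 := hφ' c m hc hm (homEquiv.symm κ) (X.map (homEquiv.symm θ).op a) s w
    have e2 := hφ' c k hc hk (homEquiv.symm κ') (X.map (homEquiv.symm θ').op a) s w
    have e3 : homEquiv.symm κ ≫ homEquiv.symm θ = homEquiv.symm κ' ≫ homEquiv.symm θ' := by
      apply homEquiv.injective
      rw [homEquiv_comp, homEquiv_comp]
      simp only [Equiv.apply_symm_apply]
      exact RelEmbedding.ext hκ
    refine e1.symm.trans (Eq.trans ?_ e2)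
    rw [← ConcreteCategory.comp_apply, ← ConcreteCategory.comp_apply, ← Functor.map_comp,
      ← Functor.map_comp, ← op_comp, ← op_comp, e3])
  refine ⟨fun p => Φ (p.2.1, (p.1, p.2.2)), hΦ.comp (by fun_prop) ?_, ?_⟩
  · rintro ⟨a, t, w⟩ ht
    obtain ⟨m, hm, θ, s, rfl⟩ := exists_face_of_mem_bdry ht
    exact ⟨Set.mem_iUnion.2 ⟨⟨⟨m, hm⟩, homEquiv θ⟩, s, rfl⟩, Set.mem_univ _⟩
  · intro m h θ a t w
    exact hΦ' ⟨⟨m, h⟩, homEquiv θ⟩ t (a, w)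

/-- Induction over the simplicial degree. Without degeneracies, a map on the realization is a
sequence of maps on X_n × Δ^n whose restrictions to X_n × ∂Δ^n are given by the earlier ones, so
each step is a relative extension problem for f_n × id. The inverses `c n` for different n need not
be related. -/
theorem hasDualLifting_map (c : ∀ n : ℕ, CompatibleInverse (η.app (op ⦋n⦌ₛ)).hom)
    [LocallyCompactSpace D] (R : Radial D) :
    HasDualLifting (Realization.map toSimplexCategory η) R := by
  classical
  intro Z _ x y₀ hy₀ hxy
  -- Gluing over the faces uses a default value in Z. If Z is empty, then so are both source and
  -- target times D: a point of the target is carried back to the source by a levelwise inverse.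
  rcases isEmpty_or_nonempty Z with hZ | hZ
  · have hQ : IsEmpty (Realization toSimplexCategory Y × D) := ⟨fun p => by
      obtain ⟨j, b, t, e⟩ := exists_point p.1
      exact hZ.false (x (point toSimplexCategory X j ((c j.len).inv b) t, p.2))⟩
    have hP : IsEmpty (Realization toSimplexCategory X × D) := ⟨fun p => hZ.false (x p)⟩
    exact ⟨⟨fun p => isEmptyElim p, continuous_of_discreteTopology⟩,
      ⟨fun p => isEmptyElim p.1, continuous_of_discreteTopology⟩,
      fun q d => (hQ.false (q, d)).elim, fun q d => (hP.false (q, d)).elim,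
      fun q d => (hP.false (q, d)).elim, fun q d => (hP.false (q, d)).elim⟩
  let T (n : ℕ) := C(Y.obj (op ⦋n⦌ₛ) × stdSimplex ℝ (Fin (n + 1)) × D, Z) ×
    C(X.obj (op ⦋n⦌ₛ) × stdSimplex ℝ (Fin (n + 1)) × (D × I), Z)
  let xp (n : ℕ) (a : X.obj (op ⦋n⦌ₛ)) (t : stdSimplex ℝ (Fin (n + 1))) :=
    point toSimplexCategory X ⦋n⦌ₛ a t
  let yp (n : ℕ) (b : Y.obj (op ⦋n⦌ₛ)) (t : stdSimplex ℝ (Fin (n + 1))) :=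
    point toSimplexCategory Y ⦋n⦌ₛ b t
  have hxp : ∀ m n (θ : ⦋m⦌ₛ ⟶ ⦋n⦌ₛ) a t,
    xp m (X.map θ.op a) t = xp n a (stdSimplex.map (homEquiv θ) t) := fun m n θ a t =>
      point_map (ι := toSimplexCategory) θ a t
  have hyp : ∀ m n (θ : ⦋m⦌ₛ ⟶ ⦋n⦌ₛ) a t,
    yp m (Y.map θ.op a) t = yp n a (stdSimplex.map (homEquiv θ) t) := fun m n θ a t =>
      point_map (ι := toSimplexCategory) θ a t
  have hxc : ∀ n, Continuous fun p : X.obj (op ⦋n⦌ₛ) × stdSimplex ℝ (Fin (n + 1)) =>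
    xp n p.1 p.2 := fun n => continuous_point (ι := toSimplexCategory) (X := X) ⦋n⦌ₛ
  have hyc : ∀ n, Continuous fun p : Y.obj (op ⦋n⦌ₛ) × stdSimplex ℝ (Fin (n + 1)) =>
    yp n p.1 p.2 := fun n => continuous_point (ι := toSimplexCategory) (X := Y) ⦋n⦌ₛ
  have hη : ∀ m n (θ : ⦋m⦌ₛ ⟶ ⦋n⦌ₛ) a,
    η.app (op ⦋m⦌ₛ) (X.map θ.op a) = Y.map θ.op (η.app (op ⦋n⦌ₛ) a) := fun m n θ a =>
      ConcreteCategory.congr_hom (η.naturality θ.op) a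
  have hmap : ∀ n a t, Realization.map toSimplexCategory η (xp n a t) =
    yp n (η.app (op ⦋n⦌ₛ) a) t := fun n a t => rfl
  -- The data in degree n are the new map on Y_n × Δ^n × D and the homotopy on X_n × Δ^n × D. The
  -- conditions fix both over the boundary of D and both ends of the homotopy.
  obtain ⟨s, hs, hs'⟩ := exists_compatible_seq (T := T)
    (fun n s => (∀ b t, ∀ d ∈ R.bdry, s.1 (b, t, d) = y₀ (yp n b t, d)) ∧
      (∀ a t, ∀ d ∈ R.bdry, ∀ r, s.2 (a, t, (d, r)) = x (xp n a t, d)) ∧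
      (∀ a t d, s.2 (a, t, (d, 0)) = x (xp n a t, d)) ∧
      (∀ a t d, s.2 (a, t, (d, 1)) = s.1 (η.app (op ⦋n⦌ₛ) a, t, d)))
    (fun m n s s' => ∀ θ : ⦋m⦌ₛ ⟶ ⦋n⦌ₛ,
      (∀ b t d, s.1 (Y.map θ.op b, t, d) = s'.1 (b, stdSimplex.map (homEquiv θ) t, d)) ∧
      ∀ a t d, s.2 (X.map θ.op a, t, d) = s'.2 (a, stdSimplex.map (homEquiv θ) t, d)) (by
    intro n s hs hs'
    obtain ⟨Φ, hΦ, hΦ'⟩ := exists_glue_faces (X := Y) n (fun m hm => (s m hm).1)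
      fun m k h hk θ a t w => (hs' m k h hk θ).1 a t w
    obtain ⟨Ψ, hΨ, hΨ'⟩ := exists_glue_faces (X := X) n (fun m hm => (s m hm).2)
      fun m k h hk θ a t w => (hs' m k h hk θ).2 a t w
    have hΦR : ∀ b, ∀ t ∈ (Radial.simplex n).bdry, ∀ d ∈ R.bdry,
        Φ (b, t, d) = y₀ (yp n b t, d) := by
      intro b t ht d hd
      obtain ⟨m, hm, θ, u, rfl⟩ := exists_face_of_mem_bdry ht
      rw [hΦ' m hm, (hs m hm).1 _ _ d hd, hyp]
    have hΨR : ∀ a, ∀ t ∈ (Radial.simplex n).bdry, ∀ d ∈ R.bdry, ∀ r,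
        Ψ (a, t, (d, r)) = x (xp n a t, d) := by
      intro a t ht d hd r
      obtain ⟨m, hm, θ, u, rfl⟩ := exists_face_of_mem_bdry ht
      rw [hΨ' m hm, (hs m hm).2.1 _ _ d hd, hxp]
    -- The prescriptions over ∂D and over ∂Δ^n agree on the overlap by `hΦR` and `hΨR`, so
    -- preferring ∂D in the case distinction is harmless.
    let yb : Y.obj (op ⦋n⦌ₛ) × stdSimplex ℝ (Fin (n + 1)) × D → Z := fun p =>
      if p.2.2 ∈ R.bdry then y₀ (yp n p.1 p.2.1, p.2.2) else Φ p
    let hb : (X.obj (op ⦋n⦌ₛ) × stdSimplex ℝ (Fin (n + 1)) × D) × I → Z := fun p =>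
      if p.1.2.2 ∈ R.bdry then x (xp n p.1.1 p.1.2.1, p.1.2.2)
      else Ψ (p.1.1, p.1.2.1, (p.1.2.2, p.2))
    -- The space X_n contributes no boundary: extension is relative to ∂(Δ^n × D) only, and X_n may
    -- be arbitrary.
    let RX := (Radial.noBdry (X.obj (op ⦋n⦌ₛ))).prod ((Radial.simplex n).prod R)
    let RY := (Radial.noBdry (Y.obj (op ⦋n⦌ₛ))).prod ((Radial.simplex n).prod R)
    have memX : ∀ p, p ∈ RX.bdry ↔ p.2.1 ∈ (Radial.simplex n).bdry ∨ p.2.2 ∈ R.bdry := by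
      intro p
      simp [RX, Radial.mem_bdry_prod]
    have memY : ∀ p, p ∈ RY.bdry ↔ p.2.1 ∈ (Radial.simplex n).bdry ∨ p.2.2 ∈ R.bdry := by
      intro p
      simp [RY, Radial.mem_bdry_prod]
    have yb1 : ∀ b t, ∀ d ∈ R.bdry, yb (b, t, d) = y₀ (yp n b t, d) := fun b t d hd => if_pos hd
    have yb2 : ∀ b, ∀ t ∈ (Radial.simplex n).bdry, ∀ d, yb (b, t, d) = Φ (b, t, d) := by
      intro b t ht d
      by_cases hd : d ∈ R.bdry
      · rw [yb1 b t d hd, hΦR b t ht d hd]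
      · exact if_neg hd
    have hb1 : ∀ a t, ∀ d ∈ R.bdry, ∀ r, hb ((a, t, d), r) = x (xp n a t, d) :=
      fun a t d hd r => if_pos hd
    have hb2 : ∀ a, ∀ t ∈ (Radial.simplex n).bdry, ∀ d r,
        hb ((a, t, d), r) = Ψ (a, t, (d, r)) := by
      intro b t ht d r
      by_cases hd : d ∈ R.bdry
      · rw [hb1 b t d hd, hΨR b t ht d hd]
      · exact if_neg hd
    have hyb : ContinuousOn yb RY.bdry := by
      have e : RY.bdry = {p | p.2.1 ∈ (Radial.simplex n).bdry} ∪ {p | p.2.2 ∈ R.bdry} :=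
        Set.ext memY
      rw [e]
      refine ContinuousOn.union_of_isClosed (hΦ.congr fun p hp => yb2 p.1 p.2.1 hp p.2.2)
        (ContinuousOn.congr ?_ fun p hp => yb1 p.1 p.2.1 p.2.2 hp)
        ((Radial.isClosed_bdry _).preimage (by fun_prop))
        (R.isClosed_bdry.preimage (by fun_prop))
      have h := hyc n
      exact hy₀.comp (Continuous.continuousOn (by fun_prop)) fun p hp => ⟨trivial, hp⟩
    have hhb : ContinuousOn hb (RX.bdry ×ˢ Set.univ) := by
      have e : RX.bdry ×ˢ (Set.univ : Set I) =
          {p | p.1.2.1 ∈ (Radial.simplex n).bdry} ∪ {p | p.1.2.2 ∈ R.bdry} := by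
        ext p
        simp [memX]
      rw [e]
      refine ContinuousOn.union_of_isClosed
        ((hΨ.comp (f := fun p : (X.obj (op ⦋n⦌ₛ) × stdSimplex ℝ (Fin (n + 1)) × D) × I =>
          (p.1.1, p.1.2.1, (p.1.2.2, p.2))) (Continuous.continuousOn (by fun_prop))
          fun p hp => hp).congr fun p hp => hb2 p.1.1 p.1.2.1 hp p.1.2.2 p.2)
        (ContinuousOn.congr ?_ fun p hp => hb1 p.1.1 p.1.2.1 p.1.2.2 hp p.2)
        ((Radial.isClosed_bdry _).preimage (by fun_prop))
        (R.isClosed_bdry.preimage (by fun_prop))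
      have h := hxc n
      exact Continuous.continuousOn (by fun_prop)
    obtain ⟨y', h', hy', hh', h0, h1⟩ :=
      ((c n).prod (stdSimplex ℝ (Fin (n + 1)) × D)).exists_dual_lift RX RY
        (fun p hp => (memY _).2 ((memX _).1 hp)) (fun p hp => (memX _).2 ((memY _).1 hp))
        (fun p hp _ => (memX _).2 ((memX _).1 hp)) (fun p hp _ => (memY _).2 ((memY _).1 hp))
        ⟨fun p => x (xp n p.1 p.2.1, p.2.2), by have h := hxc n; fun_prop⟩ yb hyb hb hhb (by
          rintro ⟨a, t, d⟩ hp
          rcases (memX _).1 hp with ht | hd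
          · obtain ⟨m, hm, θ, u, rfl⟩ := exists_face_of_mem_bdry ht
            rw [hb2 _ _ ht, hΨ' m hm, (hs m hm).2.2.1, hxp]
            rfl
          · exact hb1 _ _ _ hd _) (by
          rintro ⟨a, t, d⟩ hp
          change _ = yb (η.app (op ⦋n⦌ₛ) a, t, d)
          rcases (memX _).1 hp with ht | hd
          · obtain ⟨m, hm, θ, u, rfl⟩ := exists_face_of_mem_bdry ht
            rw [hb2 _ _ ht, hΨ' m hm, (hs m hm).2.2.2, yb2 _ _ ht, hΦ' m hm, hη]
          · rw [hb1 _ _ _ hd, yb1 _ _ _ hd, ← hmap, hxy _ _ hd])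
    refine ⟨⟨y', ⟨fun p => h' ((p.1, p.2.1, p.2.2.1), p.2.2.2), by fun_prop⟩⟩,
      ⟨fun b t d hd => ?_, fun a t d hd r => ?_, fun a t d => h0 _, fun a t d => h1 _⟩,
      fun m hm θ => ⟨fun b t d => ?_, fun a t d => ?_⟩⟩
    · rw [hy' (b, t, d) ((memY _).2 (Or.inr hd)), yb1 _ _ _ hd]
    · change h' ((a, t, d), r) = _
      rw [hh' (a, t, d) ((memX _).2 (Or.inr hd)), hb1 _ _ _ hd]
    · have ht := map_mem_bdry hm θ t
      rw [hy' (b, stdSimplex.map (homEquiv θ) t, d) ((memY _).2 (Or.inl ht)), yb2 _ _ ht, hΦ' m hm]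
    · have ht := map_mem_bdry hm θ t
      change _ = h' ((a, _, d.1), d.2)
      rw [hh' (a, stdSimplex.map (homEquiv θ) t, d.1) ((memX _).2 (Or.inl ht)), hb2 _ _ ht, hΨ' m hm])
  -- The sequence is compatible for m < n by construction; the remaining case m = n involves only
  -- the identity.
  have hs1 : ∀ m n (θ : ⦋m⦌ₛ ⟶ ⦋n⦌ₛ),
      (∀ b t d, (s m).1 (Y.map θ.op b, t, d) = (s n).1 (b, stdSimplex.map (homEquiv θ) t, d)) ∧
      ∀ a t d, (s m).2 (X.map θ.op a, t, d) = (s n).2 (a, stdSimplex.map (homEquiv θ) t, d) := by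
    intro m n θ
    rcases (le_of_hom θ).lt_or_eq with hlt | rfl
    · exact hs' m n hlt θ
    · rw [semiSimplexCategory_eq_id θ]
      refine ⟨fun b t d => ?_, fun b t d => ?_⟩ <;> rw [map_homEquiv_id] <;> simp
  let y' : Realization toSimplexCategory Y → D → Z := Quot.lift
    (fun p d => (s p.1.len).1 (p.2.1, p.2.2, d)) (by
      rintro _ _ ⟨θ, b, t⟩
      funext d
      exact (hs1 _ _ θ).1 b t d)
  let h' : Realization toSimplexCategory X → D × I → Z := Quot.lift
    (fun p d => (s p.1.len).2 (p.2.1, p.2.2, d)) (by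
      rintro _ _ ⟨θ, b, t⟩
      funext d
      exact (hs1 _ _ θ).2 b t d)
  refine ⟨⟨fun p => y' p.1 p.2, continuous_of_point_prod fun j => ?_⟩,
    ⟨fun p => h' p.1.1 (p.1.2, p.2), ?_⟩, fun q d hd => ?_, fun p d => ?_, fun p d => ?_,
    fun p d hd r => ?_⟩
  · exact (s j.len).1.continuous.comp (Homeomorph.prodAssoc _ _ _).continuous
  · have : Continuous fun p : Realization toSimplexCategory X × (D × I) => h' p.1 p.2 :=
      continuous_of_point_prod fun j => (s j.len).2.continuous.comp
        (Homeomorph.prodAssoc _ _ _).continuous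
    exact this.comp (by fun_prop : Continuous fun p :
      (Realization toSimplexCategory X × D) × I => (p.1.1, (p.1.2, p.2)))
  · obtain ⟨j, b, t, rfl⟩ := exists_point q
    exact (hs j.len).1 b t d hd
  · obtain ⟨j, a, t, rfl⟩ := exists_point p
    exact (hs j.len).2.2.1 a t d
  · obtain ⟨j, a, t, rfl⟩ := exists_point p
    exact (hs j.len).2.2.2 a t d
  · obtain ⟨j, a, t, rfl⟩ := exists_point p
    exact (hs j.len).2.1 a t d hd r

end Realization

/-! ### Natural families on bisimplicial sets -/

/-- A category with a notion of faces, such that every morphism which is not a split epimorphism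
factors through a face. -/
structure FaceSystem (J : Type) [SmallCategory J] where
  deg : J → ℕ
  face : ∀ {d c : J}, (d ⟶ c) → Prop
  deg_lt : ∀ {d c : J} (μ : d ⟶ c), face μ → deg d < deg c
  factor : ∀ {d c : J} (f : d ⟶ c), (∃ s, s ≫ f = 𝟙 c) ∨
    ∃ (b : J) (ε : d ⟶ b) (μ : b ⟶ c), face μ ∧ ε ≫ μ = f
  -- Distinct degeneracies are told apart by their sections. This replaces the uniqueness part of
  -- the Eilenberg–Zilber lemma.
  exists_section : ∀ {d c : J} (f g : d ⟶ c), (∃ s, s ≫ f = 𝟙 c) → f ≠ g →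
    ∃ s, s ≫ f = 𝟙 c ∧ s ≫ g ≠ 𝟙 c
  eq_id : ∀ {c : J} (s k : c ⟶ c), s ≫ k = 𝟙 c → k = 𝟙 c

/-- Compatible families are constructed by extension from the proper faces. -/
theorem FaceSystem.exists_natural_family {J : Type} [SmallCategory J] (𝓕 : FaceSystem J)
    {S : J → Type*} {H : J → Type*}
    (rs : ∀ {c d : J}, (d ⟶ c) → S c → S d) (rs_id : ∀ c (τ : S c), rs (𝟙 c) τ = τ)
    (rs_comp : ∀ {b c d : J} (f : c ⟶ b) (g : d ⟶ c) (τ : S b), rs (g ≫ f) τ = rs g (rs f τ))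
    (rh : ∀ {c d : J}, (d ⟶ c) → H c → H d)
    (rh_comp : ∀ {b c d : J} (f : c ⟶ b) (g : d ⟶ c) (h : H b), rh (g ≫ f) h = rh g (rh f h))
    (P : ∀ c, S c → H c → Prop)
    (hP : ∀ {c d : J} (f : d ⟶ c) (τ : S c) (h : H c), P c τ h → P d (rs f τ) (rh f h))
    (ext : ∀ (c : J) (τ : S c) (k : ∀ d (μ : d ⟶ c), 𝓕.face μ → H d),
      (∀ d μ hμ, P d (rs μ τ) (k d μ hμ)) →
      (∀ d μ hμ b (f : b ⟶ d) hf, rh f (k d μ hμ) = k b (f ≫ μ) hf) →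
      ∃ h : H c, P c τ h ∧ ∀ d μ hμ, rh μ h = k d μ hμ) :
    ∃ h : ∀ c, S c → H c, (∀ c τ, P c τ (h c τ)) ∧
      ∀ {c d : J} (f : d ⟶ c) (τ : S c), h d (rs f τ) = rh f (h c τ) := by
  classical
  -- Partial families: relations that satisfy P, are closed under restriction, and are
  -- single-valued. A maximal one turns out to be total, so no normal form for degenerate simplices
  -- is needed.
  let Q : Set (Set (Σ c, S c × H c)) := {A | (∀ c τ h, ⟨c, τ, h⟩ ∈ A → P c τ h) ∧
    (∀ c d (f : d ⟶ c) τ h, ⟨c, τ, h⟩ ∈ A → ⟨d, rs f τ, rh f h⟩ ∈ A) ∧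
    (∀ c τ h h', ⟨c, τ, h⟩ ∈ A → ⟨c, τ, h'⟩ ∈ A → h = h')}
  obtain ⟨A, ⟨A1, A2, A3⟩, hmax⟩ : ∃ A, Maximal (· ∈ Q) A := by
    refine zorn_subset Q fun 𝒞 h𝒞 hch => ⟨⋃₀ 𝒞, ⟨?_, ?_, ?_⟩, fun s hs => Set.subset_sUnion_of_mem hs⟩
    · rintro c τ h ⟨A, hA, hm⟩
      exact (h𝒞 hA).1 c τ h hm
    · rintro c d f τ h ⟨A, hA, hm⟩
      exact ⟨A, hA, (h𝒞 hA).2.1 c d f τ h hm⟩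
    · rintro c τ h h' ⟨A, hA, hm⟩ ⟨A', hA', hm'⟩
      rcases hch.total hA hA' with hle | hle
      · exact (h𝒞 hA').2.2 c τ h h' (hle hm) hm'
      · exact (h𝒞 hA).2.2 c τ h h' hm (hle hm')
  have key : ∀ n c, 𝓕.deg c = n → ∀ τ : S c, ∃ h, ⟨c, τ, h⟩ ∈ A := by
    intro n
    induction n using Nat.strong_induction_on with
    | _ n ih =>
    intro c hc τ
    by_contra hτ
    have hface : ∀ d (μ : d ⟶ c), 𝓕.face μ → ∃ h, ⟨d, rs μ τ, h⟩ ∈ A := fun d μ hμ =>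
      ih _ (hc ▸ 𝓕.deg_lt μ hμ) d rfl _
    choose k hk using hface
    -- A value e at τ is obtained from the values on the proper faces, which exist by induction on
    -- the degree.
    obtain ⟨e, he, hek⟩ := ext c τ k (fun d μ hμ => A1 _ _ _ (hk d μ hμ))
      (fun d μ hμ b f hf => A3 _ (rs f (rs μ τ)) _ _ (A2 _ _ f _ _ (hk d μ hμ))
        (rs_comp μ f τ ▸ hk b (f ≫ μ) hf))
    -- Along a map without section, restriction factors through a face, where e agrees with the
    -- values already present.
    have hmem : ∀ d (f : d ⟶ c), (¬ ∃ s, s ≫ f = 𝟙 c) → ⟨d, rs f τ, rh f e⟩ ∈ A := by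
      intro d f hf
      rcases 𝓕.factor f with h | ⟨b, ε, μ, hμ, rfl⟩
      · exact (hf h).elim
      · rw [rs_comp, rh_comp, hek b μ hμ]
        exact A2 _ _ ε _ _ (hk b μ hμ)
    -- Along a split epimorphism no value can be present yet: a section would restrict it to a value
    -- at τ.
    have hsec : ∀ d (f : d ⟶ c), (∃ s, s ≫ f = 𝟙 c) → ∀ h, ⟨d, rs f τ, h⟩ ∉ A := by
      rintro d f ⟨s, hs⟩ h hA
      have := A2 _ _ s _ _ hA
      rw [← rs_comp, hs, rs_id] at this
      exact hτ ⟨_, this⟩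
    -- All restrictions of e are added. Only single-valuedness needs an argument.
    let A' : Set (Σ c, S c × H c) := A ∪ {p | ∃ f : p.1 ⟶ c, rs f τ = p.2.1 ∧ rh f e = p.2.2}
    have memA' : ∀ d (τ' : S d) h, (⟨d, τ', h⟩ : Σ c, S c × H c) ∈ A' →
        (⟨d, τ', h⟩ : Σ c, S c × H c) ∈ A ∨ ∃ f : d ⟶ c, rs f τ = τ' ∧ rh f e = h :=
      fun _ _ _ h => h
    have hA' : A' ∈ Q := by
      refine ⟨?_, ?_, ?_⟩
      · intro d τ' h hm
        rcases memA' _ _ _ hm with hA | ⟨f, rfl, rfl⟩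
        · exact A1 _ _ _ hA
        · exact hP f τ e he
      · intro d d' g τ' h hm
        rcases memA' _ _ _ hm with hA | ⟨f, rfl, rfl⟩
        · exact Or.inl (A2 _ _ g _ _ hA)
        · exact Or.inr ⟨g ≫ f, rs_comp f g τ, rh_comp f g e⟩
      · have aux : ∀ d (f : d ⟶ c) h, ⟨d, rs f τ, h⟩ ∈ A → h = rh f e := fun d f h hA => by
          by_cases hf : ∃ s, s ≫ f = 𝟙 c
          · exact (hsec d f hf h hA).elim
          · exact A3 _ _ _ _ hA (hmem d f hf)
        intro d τ' h h' hm hm'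
        rcases memA' _ _ _ hm with hA | ⟨f, rfl, rfl⟩ <;>
          rcases memA' _ _ _ hm' with hA' | ⟨g, hg, hg'⟩
        · exact A3 _ _ _ _ hA hA'
        · subst hg hg'
          exact aux _ _ _ hA
        · exact (aux _ _ _ hA').symm
        · subst hg'
          by_cases hs : ∃ s, s ≫ f = 𝟙 c
          · by_cases hfg : f = g
            · rw [hfg]
            -- Suppose f ≠ g restrict τ to the same element, with f split epi. For a section s of f
            -- that is not one of g, τ is its own restriction along s ≫ g, which is not split epi
            -- since otherwise it would be the identity. So τ already has a value.
            · obtain ⟨s, hs, hs'⟩ := 𝓕.exists_section f g hs hfg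
              have e1 : rs (s ≫ g) τ = τ := by rw [rs_comp, hg, ← rs_comp, hs, rs_id]
              have e2 := hmem c (s ≫ g) (by
                rintro ⟨s', hs''⟩
                exact hs' (𝓕.eq_id _ _ hs''))
              rw [e1] at e2
              exact (hτ ⟨_, e2⟩).elim
          · have := hmem d f hs
            rw [← hg] at this
            exact aux _ _ _ this
    have : (⟨c, τ, rh (𝟙 c) e⟩ : Σ c, S c × H c) ∈ A :=
      hmax hA' Set.subset_union_left (Or.inr ⟨𝟙 c, rs_id c τ, rfl⟩)
    exact hτ ⟨_, this⟩
  choose h hh using fun c τ => key _ c rfl τ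
  exact ⟨h, fun c τ => A1 _ _ _ (hh c τ),
    fun f τ => A3 _ _ _ _ (hh _ _) (A2 _ _ f _ _ (hh _ τ))⟩

/-- A set-theoretic section of a monotone surjection between linear orders is automatically
monotone, so its value over f x can be prescribed freely. -/
theorem exists_orderHom_section {m n : SimplexCategory} (f : m ⟶ n) (hf : Function.Surjective f)
    (x : Fin (m.len + 1)) : ∃ s : n ⟶ m, s ≫ f = 𝟙 n ∧ s (f x) = x := by
  classical
  choose r hr using hf
  let s : Fin (n.len + 1) → Fin (m.len + 1) := fun j => if j = f x then x else r j
  have hs : ∀ j, f (s j) = j := fun j => by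
    by_cases h : j = f x
    · simp [s, h]
    · simp [s, h, hr]
  refine ⟨SimplexCategory.Hom.mk ⟨s, fun i j hij => ?_⟩, ?_, ?_⟩
  · rcases hij.eq_or_lt with rfl | hij
    · rfl
    · by_contra! hlt
      have := f.toOrderHom.monotone hlt.le
      change f (s j) ≤ f (s i) at this
      rw [hs, hs] at this
      exact absurd hij (not_lt.2 this)
  · ext j : 3
    exact hs j
  · exact if_pos rfl

theorem surjective_of_len_le_image {m n : SimplexCategory} (f : m ⟶ n)
    (h : n.len ≤ (image f).len) : Function.Surjective f := by
  have hmono := SimplexCategory.mono_iff_injective.1 (inferInstance : Mono (image.ι f))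
  have hepi := SimplexCategory.epi_iff_surjective.1 (inferInstance : Epi (factorThruImage f))
  have e : (image f).len = n.len := le_antisymm (SimplexCategory.len_le_of_mono (image.ι f)) h
  have hb := (Fintype.bijective_iff_injective_and_card (image.ι f)).2 ⟨hmono, by simp [e]⟩
  have := hb.2.comp hepi
  intro y
  obtain ⟨x, hx⟩ := this y
  exact ⟨x, (ConcreteCategory.congr_hom (image.fac f) x).symm.trans hx⟩

/-- The faces in the category of bisimplices. -/
def bisimplexFaceSystem : FaceSystem (SimplexCategory × SimplexCategory) where
  deg c := c.1.len + c.2.len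
  face {d c} μ := Function.Injective μ.1 ∧ Function.Injective μ.2 ∧
    d.1.len + d.2.len < c.1.len + c.2.len
  deg_lt _ h := h.2.2
  factor {d c} f := by
    by_cases hs : Function.Surjective f.1 ∧ Function.Surjective f.2
    · obtain ⟨s, hs1, -⟩ := exists_orderHom_section f.1 hs.1 0
      obtain ⟨s', hs2, -⟩ := exists_orderHom_section f.2 hs.2 0
      exact Or.inl ⟨Prod.mkHom s s', Prod.ext hs1 hs2⟩
    · refine Or.inr ⟨(image f.1, image f.2), Prod.mkHom (factorThruImage f.1) (factorThruImage f.2),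
        Prod.mkHom (image.ι f.1) (image.ι f.2), ⟨SimplexCategory.mono_iff_injective.1
          (inferInstanceAs (Mono (image.ι f.1))), SimplexCategory.mono_iff_injective.1
          (inferInstanceAs (Mono (image.ι f.2))), ?_⟩, Prod.ext (image.fac _) (image.fac _)⟩
      have h1 := SimplexCategory.len_le_of_mono (image.ι f.1)
      have h2 := SimplexCategory.len_le_of_mono (image.ι f.2)
      by_contra h
      change ¬ ((image f.1).len + (image f.2).len < _) at h
      exact hs ⟨surjective_of_len_le_image f.1 (by omega),
        surjective_of_len_le_image f.2 (by omega)⟩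
  exists_section {d c} f g hs hfg := by
    obtain ⟨s, hs⟩ := hs
    have hs1 : s.1 ≫ f.1 = 𝟙 _ := congrArg Prod.fst hs
    have hs2 : s.2 ≫ f.2 = 𝟙 _ := congrArg Prod.snd hs
    have h1 : Function.Surjective f.1 := fun x =>
      ⟨s.1 x, ConcreteCategory.congr_hom hs1 x⟩
    have h2 : Function.Surjective f.2 := fun x =>
      ⟨s.2 x, ConcreteCategory.congr_hom hs2 x⟩
    -- In a factor where f and g differ at some x, the section of f through x is not a section of g.
    by_cases hfg1 : f.1 = g.1
    · have hfg2 : f.2 ≠ g.2 := fun h => hfg (Prod.ext hfg1 h)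
      obtain ⟨x, hx⟩ : ∃ x, f.2 x ≠ g.2 x := by
        by_contra! h
        exact hfg2 (SimplexCategory.Hom.ext _ _ (OrderHom.ext _ _ (funext h)))
      obtain ⟨r, hr, hrx⟩ := exists_orderHom_section f.2 h2 x
      refine ⟨Prod.mkHom s.1 r, Prod.ext hs1 hr, fun e => hx ?_⟩
      have := ConcreteCategory.congr_hom (congrArg Prod.snd e) (f.2 x)
      change g.2 (r (f.2 x)) = f.2 x at this
      rw [← this, hrx]
    · obtain ⟨x, hx⟩ : ∃ x, f.1 x ≠ g.1 x := by
        by_contra! h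
        exact hfg1 (SimplexCategory.Hom.ext _ _ (OrderHom.ext _ _ (funext h)))
      obtain ⟨r, hr, hrx⟩ := exists_orderHom_section f.1 h1 x
      refine ⟨Prod.mkHom r s.2, Prod.ext hr hs2, fun e => hx ?_⟩
      have := ConcreteCategory.congr_hom (congrArg Prod.fst e) (f.1 x)
      change g.1 (r (f.1 x)) = f.1 x at this
      rw [← this, hrx]
  eq_id {c} s k h := by
    have h1 : s.1 ≫ k.1 = 𝟙 _ := congrArg Prod.fst h
    have h2 : s.2 ≫ k.2 = 𝟙 _ := congrArg Prod.snd h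
    have : Epi k.1 := epi_of_epi_fac h1
    have : Epi k.2 := epi_of_epi_fac h2
    exact Prod.ext (SimplexCategory.eq_id_of_epi _) (SimplexCategory.eq_id_of_epi _)

/-! ### Convex combinations of points of a simplex -/

/-- The point `(1 - s) a + s b`. -/
noncomputable def mix {L : Type} [Fintype L] (s : I) (a b : stdSimplex ℝ L) : stdSimplex ℝ L :=
  ⟨(1 - (s : ℝ)) • a.1 + (s : ℝ) • b.1,
    convex_stdSimplex ℝ L a.2 b.2 (sub_nonneg.2 s.2.2) s.2.1 (by ring)⟩

section

variable {L M : Type} [Fintype L] [Fintype M]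

theorem mix_apply (s : I) (a b : stdSimplex ℝ L) (x : L) :
    mix s a b x = (1 - (s : ℝ)) * a x + (s : ℝ) * b x := rfl

theorem mix_zero (a b : stdSimplex ℝ L) : mix 0 a b = a :=
  stdSimplex.ext (funext fun x => by simp [mix_apply])

theorem mix_one (a b : stdSimplex ℝ L) : mix 1 a b = b :=
  stdSimplex.ext (funext fun x => by simp [mix_apply])

theorem mix_self (s : I) (a : stdSimplex ℝ L) : mix s a a = a :=
  stdSimplex.ext (funext fun x => by rw [mix_apply]; ring)

theorem map_stdSimplex_apply [DecidableEq M] (f : L → M) (a : stdSimplex ℝ L) (y : M) :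
    stdSimplex.map f a y = ∑ x with f x = y, a x := by
  rw [stdSimplex.map_coe, FunOnFinite.linearMap_apply_apply]

theorem map_mix (f : L → M) (s : I) (a b : stdSimplex ℝ L) :
    stdSimplex.map f (mix s a b) = mix s (stdSimplex.map f a) (stdSimplex.map f b) := by
  classical
  refine stdSimplex.ext (funext fun y => ?_)
  rw [mix_apply, map_stdSimplex_apply, map_stdSimplex_apply, map_stdSimplex_apply,
    Finset.mul_sum, Finset.mul_sum, ← Finset.sum_add_distrib]
  rfl

theorem continuous_mix {W : Type*} [TopologicalSpace W] {s : W → I} {a b : W → stdSimplex ℝ L}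
    (hs : Continuous s) (ha : Continuous a) (hb : Continuous b) :
    Continuous fun p => mix (s p) (a p) (b p) := by
  refine Continuous.subtype_mk (continuous_pi fun x => ?_) _
  have h1 := (Radial.continuous_stdSimplex_apply x).comp ha
  have h2 := (Radial.continuous_stdSimplex_apply x).comp hb
  exact ((continuous_const.sub (continuous_subtype_val.comp hs)).mul h1).add
    ((continuous_subtype_val.comp hs).mul h2)

end

/-! ### The realization of the semi-simplicial set underlying a standard simplex -/

/-- The semi-simplicial set underlying the standard simplex, as a semi-simplicial space. -/
def fatSpace (p : SimplexCategory) : SemiSimplexCategoryᵒᵖ ⥤ TopCat.{0} :=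
  toSimplexCategory.op ⋙ yoneda.obj p ⋙ TopCat.discrete

/-- The realization of the semi-simplicial set underlying the standard simplex. -/
abbrev Fat (p : SimplexCategory) : Type := Realization toSimplexCategory (fatSpace p)

namespace Fat

variable {p q : SimplexCategory}

/-- The point represented by a simplex and a point of the topological simplex. -/
def mk {m : ℕ} (α : Fin (m + 1) →o Fin (p.len + 1)) (t : stdSimplex ℝ (Fin (m + 1))) : Fat p :=
  Realization.point toSimplexCategory (fatSpace p) ⦋m⦌ₛ
    (SimplexCategory.Hom.mk (a := ⦋m⦌) (b := p) α) t

theorem mk_face {k m : ℕ} (κ : Fin (k + 1) ↪o Fin (m + 1)) (α : Fin (m + 1) →o Fin (p.len + 1))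
    (t : stdSimplex ℝ (Fin (k + 1))) :
    mk (α.comp κ.toOrderHom) t = mk α (stdSimplex.map κ t) :=
  Realization.point_map (ι := toSimplexCategory) (X := fatSpace p)
    ((homEquiv (n := ⦋k⦌ₛ) (m := ⦋m⦌ₛ)).symm κ) (SimplexCategory.Hom.mk (a := ⦋m⦌) (b := p) α) t

theorem exists_mk (z : Fat p) : ∃ (m : ℕ) (α : Fin (m + 1) →o Fin (p.len + 1)) (t : _),
    mk α t = z ∧ ∀ i, 0 < t i := by
  obtain ⟨j, α, t, rfl⟩ := Realization.exists_point z
  obtain ⟨m, θ, s, rfl, hs⟩ := exists_support (L := Fin (j.len + 1)) t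
  exact ⟨m, _, s, mk_face θ (SimplexCategory.Hom.toOrderHom α) s, hs⟩

theorem continuous_mk {m : ℕ} (α : Fin (m + 1) →o Fin (p.len + 1)) : Continuous (mk α) :=
  (Realization.continuous_point (ι := toSimplexCategory) (X := fatSpace p) ⦋m⦌ₛ).comp
    (continuous_const.prodMk continuous_id :
      Continuous fun t : stdSimplex ℝ (Fin (m + 1)) =>
        (show (fatSpace p).obj (op ⦋m⦌ₛ) from SimplexCategory.Hom.mk (a := ⦋m⦌) (b := p) α, t))

/-- Definition of maps on `Fat p`. -/
def desc {Z : Type*} (F : ∀ m : ℕ, (Fin (m + 1) →o Fin (p.len + 1)) →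
      stdSimplex ℝ (Fin (m + 1)) → Z)
    (hF : ∀ (k m : ℕ) (κ : Fin (k + 1) ↪o Fin (m + 1)) α t,
      F k (α.comp κ.toOrderHom) t = F m α (stdSimplex.map κ t)) (z : Fat p) : Z :=
  Quot.lift (fun z : (Σ j : SemiSimplexCategory, (fatSpace p).obj (op j) ×
    SimplexCategory.toTop₀.obj (toSimplexCategory.obj j)) =>
      F z.1.len (SimplexCategory.Hom.toOrderHom (show ⦋z.1.len⦌ ⟶ p from z.2.1)) z.2.2) (by
    rintro _ _ ⟨f, α, t⟩
    exact hF _ _ (homEquiv f) _ _) z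

theorem continuous_of_mk_prod {W Z : Type*} [TopologicalSpace W] [LocallyCompactSpace W]
    [TopologicalSpace Z] {F : Fat p × W → Z}
    (h : ∀ (m : ℕ) (α : Fin (m + 1) →o Fin (p.len + 1)),
      Continuous fun z : stdSimplex ℝ (Fin (m + 1)) × W => F (mk α z.1, z.2)) :
    Continuous F := by
  refine Realization.continuous_of_point_prod fun j => ?_
  have : DiscreteTopology ((fatSpace p).obj (op j)) :=
    inferInstanceAs (DiscreteTopology (TopCat.discrete.obj _))
  have : Continuous fun z : (fatSpace p).obj (op j) × (stdSimplex ℝ (Fin (j.len + 1)) × W) =>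
      F (Realization.point toSimplexCategory (fatSpace p) j z.1 z.2.1, z.2.2) :=
    continuous_prod_of_discrete_left.2 fun α => h j.len (SimplexCategory.Hom.toOrderHom α)
  exact this.comp (Homeomorph.prodAssoc _ _ _).continuous

theorem continuous_of_mk {Z : Type*} [TopologicalSpace Z] {F : Fat p → Z}
    (h : ∀ (m : ℕ) (α : Fin (m + 1) →o Fin (p.len + 1)), Continuous fun t => F (mk α t)) :
    Continuous F :=
  (continuous_of_mk_prod (W := Unit) (F := fun z => F z.1) fun m α =>
    (h m α).comp continuous_fst).comp (by fun_prop : Continuous fun z : Fat p => (z, ()))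

/-- The functoriality of `Fat`. -/
def map (θ : p ⟶ q) : C(Fat p, Fat q) :=
  Realization.map toSimplexCategory (X := fatSpace p) (Y := fatSpace q)
    (Functor.whiskerLeft toSimplexCategory.op
      (Functor.whiskerRight (yoneda.map θ) TopCat.discrete))

theorem map_mk (θ : p ⟶ q) {m : ℕ} (α : Fin (m + 1) →o Fin (p.len + 1)) (t) :
    map θ (mk α t) = mk ((SimplexCategory.Hom.toOrderHom θ).comp α) t := rfl

/-- The canonical map to the topological simplex. -/
noncomputable def toSimplex (p : SimplexCategory) : C(Fat p, stdSimplex ℝ (Fin (p.len + 1))) where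
  toFun := desc (fun _ α t => stdSimplex.map α t) fun _ _ κ α t =>
    (stdSimplex.map_comp_apply κ α t).symm
  continuous_toFun := continuous_of_mk fun _ α => stdSimplex.continuous_map α

theorem toSimplex_mk {m : ℕ} (α : Fin (m + 1) →o Fin (p.len + 1)) (t) :
    toSimplex p (mk α t) = stdSimplex.map α t := rfl

theorem toSimplex_map (θ : p ⟶ q) (z : Fat p) :
    toSimplex q (map θ z) = stdSimplex.map θ (toSimplex p z) := by
  obtain ⟨m, α, t, rfl, -⟩ := exists_mk z
  rw [map_mk, toSimplex_mk, toSimplex_mk, stdSimplex.map_comp_apply]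
  rfl

/-- The inclusion of the top-dimensional nondegenerate simplex. -/
def ofSimplex (p : SimplexCategory) : C(stdSimplex ℝ (Fin (p.len + 1)), Fat p) :=
  ⟨mk OrderHom.id, continuous_mk _⟩

theorem toSimplex_ofSimplex (t : stdSimplex ℝ (Fin (p.len + 1))) :
    toSimplex p (ofSimplex p t) = t :=
  stdSimplex.map_id_apply t

/-- Injectivity is essential: under a degeneracy the top simplex goes to a degenerate simplex, which
is a separate cell of the fat simplex. -/
theorem map_ofSimplex_of_injective (θ : p ⟶ q) (hθ : Function.Injective θ) (t) :
    map θ (ofSimplex p t) = ofSimplex q (stdSimplex.map θ t) :=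
  mk_face (OrderEmbedding.ofStrictMono θ
    ((SimplexCategory.Hom.toOrderHom θ).monotone.strictMono_of_injective hθ)) OrderHom.id t

theorem map_comp (θ : p ⟶ q) {r : SimplexCategory} (θ' : q ⟶ r) (z : Fat p) :
    map (θ ≫ θ') z = map θ' (map θ z) := by
  obtain ⟨m, α, t, rfl, -⟩ := exists_mk z
  rfl

theorem map_id (z : Fat p) : map (𝟙 p) z = z := by
  obtain ⟨m, α, t, rfl, -⟩ := exists_mk z
  rfl

/-- A point of `Fat q` over a face lies in the image of that face. -/
theorem mem_range_map (θ : p ⟶ q) (hθ : Function.Injective θ) {z : Fat q} {t : _}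
    (h : toSimplex q z = stdSimplex.map θ t) : z ∈ Set.range (map θ) := by
  obtain ⟨m, α, s, rfl, hs⟩ := exists_mk z
  obtain ⟨κ, hκ⟩ := exists_factor_of_pos α (OrderEmbedding.ofStrictMono θ
    ((SimplexCategory.Hom.toOrderHom θ).monotone.strictMono_of_injective hθ)) hs h
  refine ⟨mk κ s, ?_⟩
  rw [map_mk]
  congr 1
  exact OrderHom.ext _ _ (funext hκ)

theorem exists_retraction (θ : p ⟶ q) (hθ : Function.Injective θ) :
    ∃ r : q ⟶ p, θ ≫ r = 𝟙 p := by
  -- The retraction sends j to the greatest i with θ i ≤ j. If there is none, the empty supremum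
  -- gives 0.
  refine ⟨SimplexCategory.Hom.mk ⟨fun j => (Finset.univ.filter fun i => θ i ≤ j).sup id,
    fun j k hjk => Finset.sup_mono fun i => ?_⟩, ?_⟩
  · simp only [Finset.mem_filter, Finset.mem_univ, true_and]
    exact fun h => h.trans hjk
  · have hs := (SimplexCategory.Hom.toOrderHom θ).monotone.strictMono_of_injective hθ
    ext i : 3
    change (Finset.univ.filter fun k => θ k ≤ θ i).sup id = i
    refine le_antisymm (Finset.sup_le fun k hk => ?_)
      (Finset.le_sup (f := id) (by simp))
    exact hs.le_iff_le.1 (Finset.mem_filter.1 hk).2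

/-- A retraction of θ induces a continuous left inverse, and the range is closed as the preimage of
a face of the topological simplex. -/
theorem isClosedEmbedding_map (θ : p ⟶ q) (hθ : Function.Injective θ) :
    Topology.IsClosedEmbedding (map θ) := by
  obtain ⟨r, hr⟩ := exists_retraction θ hθ
  have hl : Function.LeftInverse (map r) (map θ) := fun z => by rw [← map_comp, hr, map_id]
  refine ⟨hl.isEmbedding (map r).continuous (map θ).continuous, ?_⟩
  have : Set.range (map θ) = toSimplex q ⁻¹' (Set.range (stdSimplex.map θ)) := by
    ext z
    constructor
    · rintro ⟨y, rfl⟩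
      exact ⟨toSimplex p y, (toSimplex_map θ y).symm⟩
    · rintro ⟨t, ht⟩
      exact mem_range_map θ hθ ht.symm
  rw [this]
  exact (isClosedEmbedding_map_stdSimplex hθ).isClosed_range.preimage (toSimplex q).continuous

/-! #### Points indexed by arbitrary finite linear orders -/

section

variable {L : Type} [LinearOrder L] [Fintype L]

/-- The point represented by an order-preserving map out of a finite linear order. -/
noncomputable def ofOrder [Nonempty L] (α : L →o Fin (p.len + 1)) (t : stdSimplex ℝ L) : Fat p :=
  let e : Fin (Fintype.card L - 1 + 1) ≃o L :=
    Fintype.orderIsoFinOfCardEq L (Nat.succ_pred_eq_of_pos Fintype.card_pos).symm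
  mk (α.comp (e : Fin (Fintype.card L - 1 + 1) →o L)) (stdSimplex.map e.symm t)

theorem ofOrder_fin [Nonempty L] (α : L →o Fin (p.len + 1)) {m : ℕ} (κ : Fin (m + 1) ↪o L)
    (t : stdSimplex ℝ (Fin (m + 1))) :
    mk (α.comp κ.toOrderHom) t = ofOrder α (stdSimplex.map κ t) := by
  let e : Fin (Fintype.card L - 1 + 1) ≃o L :=
    Fintype.orderIsoFinOfCardEq L (Nat.succ_pred_eq_of_pos Fintype.card_pos).symm
  let κ' : Fin (m + 1) ↪o Fin (Fintype.card L - 1 + 1) := κ.trans e.symm.toOrderEmbedding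
  have h := mk_face κ' (α.comp (e : Fin (Fintype.card L - 1 + 1) →o L)) t
  have e1 : (α.comp (e : Fin (Fintype.card L - 1 + 1) →o L)).comp
      κ'.toOrderHom = α.comp κ.toOrderHom := by
    ext x : 2
    exact congrArg α (e.apply_symm_apply _)
  rw [e1] at h
  refine h.trans ?_
  change mk _ _ = mk _ (stdSimplex.map e.symm (stdSimplex.map κ t))
  rw [stdSimplex.map_comp_apply]
  rfl

theorem ofOrder_embedding {M : Type} [LinearOrder M] [Fintype M] [Nonempty L] [Nonempty M]
    (α : L →o Fin (p.len + 1)) (κ : M ↪o L) (t : stdSimplex ℝ M) :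
    ofOrder (α.comp κ.toOrderHom) t = ofOrder α (stdSimplex.map κ t) := by
  let e : Fin (Fintype.card M - 1 + 1) ≃o M :=
    Fintype.orderIsoFinOfCardEq M (Nat.succ_pred_eq_of_pos Fintype.card_pos).symm
  let κ' : Fin (Fintype.card M - 1 + 1) ↪o L := e.toOrderEmbedding.trans κ
  refine (ofOrder_fin α κ' (stdSimplex.map e.symm t)).trans ?_
  rw [stdSimplex.map_comp_apply]
  congr 2
  funext x
  exact congrArg κ (e.apply_symm_apply x)

theorem continuous_ofOrder [Nonempty L] (α : L →o Fin (p.len + 1)) : Continuous (ofOrder α) :=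
  (continuous_mk _).comp (stdSimplex.continuous_map _)

theorem toSimplex_ofOrder [Nonempty L] (α : L →o Fin (p.len + 1)) (t : stdSimplex ℝ L) :
    toSimplex p (ofOrder α t) = stdSimplex.map α t := by
  refine (stdSimplex.map_comp_apply _ _ _).trans ?_
  congr 1
  funext x
  exact congrArg α (OrderIso.apply_symm_apply _ x)

end

/-! #### The fat simplex deforms to the topological simplex -/

/-- A linear order containing both the vertices of `[p]` and of `[m]`. -/
abbrev Blocks (p : SimplexCategory) (m : ℕ) : Type := Fin (p.len + 1) ×ₗ Fin (m + 2)

namespace Blocks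

variable {m k : ℕ}

/-- The projection to `[p]`. -/
def fst : Blocks p m →o Fin (p.len + 1) := ⟨fun x => (ofLex x).1, Prod.Lex.monotone_fst_ofLex⟩

/-- The first vertex of each block. -/
def bot : Fin (p.len + 1) ↪o Blocks p m :=
  OrderEmbedding.ofStrictMono (fun i => toLex (i, 0)) fun _ _ h => Prod.Lex.toLex_lt_toLex.2 (Or.inl h)

/-- The inclusion of `[m]`. -/
def incl (α : Fin (m + 1) →o Fin (p.len + 1)) : Fin (m + 1) ↪o Blocks p m :=
  OrderEmbedding.ofStrictMono (fun a => toLex (α a, a.succ)) fun _ _ h =>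
    Prod.Lex.toLex_lt_toLex.2 (((α.monotone h.le).lt_or_eq).imp id fun e =>
      ⟨e, Fin.succ_lt_succ_iff.2 h⟩)

theorem strictMono_cons (κ : Fin (k + 1) ↪o Fin (m + 1)) :
    StrictMono (Fin.cons 0 fun a => (κ a).succ : Fin (k + 2) → Fin (m + 2)) := by
  intro a b h
  induction b using Fin.cases with
  | zero => simp at h
  | succ b =>
    induction a using Fin.cases with
    | zero => simp
    | succ a => simpa using h

/-- The functoriality in `[m]`. -/
def face (κ : Fin (k + 1) ↪o Fin (m + 1)) : Blocks p k ↪o Blocks p m :=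
  OrderEmbedding.ofStrictMono
    (fun x => toLex ((ofLex x).1, (Fin.cons 0 fun a => (κ a).succ : Fin (k + 2) → Fin (m + 2))
      (ofLex x).2)) fun _ _ h =>
    Prod.Lex.toLex_lt_toLex.2 ((Prod.Lex.lt_iff.1 h).imp id fun h => ⟨h.1, strictMono_cons κ h.2⟩)

end Blocks

/-- The weights of the deformation. -/
noncomputable def contractWeights {m : ℕ} (α : Fin (m + 1) →o Fin (p.len + 1))
    (t : stdSimplex ℝ (Fin (m + 1))) (s : I) : stdSimplex ℝ (Blocks p m) :=
  mix s (stdSimplex.map Blocks.bot (stdSimplex.map α t)) (stdSimplex.map (Blocks.incl α) t)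

theorem contractWeights_face {m k : ℕ} (κ : Fin (k + 1) ↪o Fin (m + 1))
    (α : Fin (m + 1) →o Fin (p.len + 1)) (t : stdSimplex ℝ (Fin (k + 1))) (s : I) :
    stdSimplex.map (Blocks.face κ) (contractWeights (α.comp κ.toOrderHom) t s) =
      contractWeights α (stdSimplex.map κ t) s := by
  rw [contractWeights, contractWeights, map_mix]
  simp only [stdSimplex.map_comp_apply]
  rfl

/-- The deformation of the fat simplex onto the topological simplex. -/
noncomputable def contract (p : SimplexCategory) : C(Fat p × I, Fat p) where
  -- Each block {i} × [m + 1] holds a bottom vertex (i, 0) and slots for the vertices of [m] over i.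
  -- Both the top simplex of [p] (by `bot`) and the simplex α (by `incl α`) are faces of this one
  -- large simplex over [p], so the straight segment between their points gives a path in `Fat p`.
  -- The maps `Blocks.face` make it independent of the representative.
  toFun z := desc (fun m α t => ofOrder (Blocks.fst (m := m)) (contractWeights α t z.2))
    (fun k m κ α t => by
      rw [← contractWeights_face, ← ofOrder_embedding]
      rfl) z.1
  continuous_toFun := by
    refine continuous_of_mk_prod fun m α => ?_
    have h1 := stdSimplex.continuous_map (S := ℝ) α
    have h2 := stdSimplex.continuous_map (S := ℝ) (Blocks.bot (p := p) (m := m))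
    have h3 := stdSimplex.continuous_map (S := ℝ) (Blocks.incl α)
    have h4 := continuous_mix (continuous_snd (X := stdSimplex ℝ (Fin (m + 1))) (Y := I))
      (h2.comp (h1.comp continuous_fst)) (h3.comp continuous_fst)
    exact (continuous_ofOrder (Blocks.fst (p := p) (m := m))).comp h4

theorem contract_mk {m : ℕ} (α : Fin (m + 1) →o Fin (p.len + 1)) (t) (s : I) :
    contract p (mk α t, s) = ofOrder Blocks.fst (contractWeights α t s) := rfl

theorem contract_zero (z : Fat p) : contract p (z, 0) = ofSimplex p (toSimplex p z) := by
  obtain ⟨m, α, t, rfl, -⟩ := exists_mk z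
  rw [contract_mk, contractWeights, mix_zero, ← ofOrder_fin]
  rfl

theorem contract_one (z : Fat p) : contract p (z, 1) = z := by
  obtain ⟨m, α, t, rfl, -⟩ := exists_mk z
  rw [contract_mk, contractWeights, mix_one, ← ofOrder_fin]
  rfl

/-- Both ends of the segment have the same image in Δ^p, so the deformation is fibrewise over Δ^p.
This is the strict compatibility, with the constant homotopy downstairs. -/
theorem toSimplex_contract (z : Fat p) (s : I) : toSimplex p (contract p (z, s)) = toSimplex p z := by
  obtain ⟨m, α, t, rfl, -⟩ := exists_mk z
  rw [contract_mk, toSimplex_ofOrder, contractWeights, map_mix]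
  simp only [stdSimplex.map_comp_apply]
  exact mix_self s (stdSimplex.map α t)

/-- The topological simplex is a deformation retract of the fat simplex. -/
noncomputable def compatibleInverse (p : SimplexCategory) : CompatibleInverse (toSimplex p) where
  inv := ofSimplex p
  left := contract p
  right := ContinuousMap.fst
  left_zero := contract_zero
  left_one := contract_one
  right_zero y := (toSimplex_ofSimplex y).symm
  right_one _ := rfl
  compat := toSimplex_contract

/-! #### The radial structure of the fat simplex -/

/-- Pushing outward subtracts a nonnegative amount from t_i and divides by M ≥ 1/2. The factor 2
bounds the quotients used to lift the rescaling to the fat simplex; in particular, zero coordinates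
stay zero. -/
theorem simplexPush_le {n : ℕ} (t : stdSimplex ℝ (Fin (n + 1))) (m : ℝ) (i : Fin (n + 1)) :
    Radial.simplexPush t (min m 1) i ≤ 2 * t i := by
  rw [Radial.simplexPush_apply]
  have h1 := Radial.le_simplexGauge t i
  have h2 := Radial.simplexGauge_le_one t
  set M := max (1 / 2) (max (min m 1) (Radial.simplexGauge n t)) with hM
  have hM1 : 1 / 2 ≤ M := le_max_left _ _
  have hM2 : M ≤ 1 := max_le (by norm_num) (max_le (min_le_right _ _) h2)
  have hM3 : 1 - (n + 1 : ℝ) * t i ≤ M := h1.trans ((le_max_right _ _).trans (le_max_right _ _))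
  have hn : (0 : ℝ) < n + 1 := by positivity
  have ht := stdSimplex.zero_le t i
  have hM0 : 0 < M := by linarith
  have e : 1 / (n + 1 : ℝ) + (t i - 1 / (n + 1 : ℝ)) / M = (t i - (1 - M) / (n + 1)) / M := by
    field_simp
    ring
  rw [e, div_le_iff₀ hM0]
  have : 0 ≤ (1 - M) / (n + 1 : ℝ) := div_nonneg (by linarith) hn.le
  nlinarith

/-- Redistribution of weights according to prescribed weights of the fibres. -/
theorem sum_reweight {X Y : Type} [Fintype X] [Fintype Y] [DecidableEq Y] (f : X → Y)
    (t : stdSimplex ℝ X) (T : stdSimplex ℝ Y) {c : ℝ} (hT : ∀ y, T y ≤ c * stdSimplex.map f t y)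
    (y : Y) : ∑ x with f x = y, t x * T (f x) / stdSimplex.map f t (f x) = T y := by
  have : ∑ x with f x = y, t x * T (f x) / stdSimplex.map f t (f x) =
      ∑ x with f x = y, t x * (T y / stdSimplex.map f t y) :=
    Finset.sum_congr rfl fun x hx => by rw [(Finset.mem_filter.1 hx).2, mul_div_assoc]
  rw [this, ← Finset.sum_mul, ← map_stdSimplex_apply]
  by_cases h : stdSimplex.map f t y = 0
  · have h1 := hT y
    rw [h, mul_zero] at h1
    rw [h, le_antisymm h1 (stdSimplex.zero_le T y)]
    simp
  · exact mul_div_cancel₀ _ h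

/-- Where c vanishes so does a, and the bound a b / c ≤ r a forces the quotient to tend to 0. -/
theorem continuous_mul_div {W : Type*} [TopologicalSpace W] {a b c : W → ℝ} (ha : Continuous a)
    (hb : Continuous b) (hc : Continuous c) (h0 : ∀ p, 0 ≤ a p) (hac : ∀ p, a p ≤ c p)
    (h1 : ∀ p, 0 ≤ b p) {r : ℝ} (hbc : ∀ p, b p ≤ r * c p) :
    Continuous fun p => a p * b p / c p := by
  rw [continuous_iff_continuousAt]
  intro p
  by_cases hp : c p = 0
  · have hap : a p = 0 := le_antisymm (hp ▸ hac p) (h0 p)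
    have e : a p * b p / c p = 0 := by rw [hp, div_zero]
    rw [ContinuousAt, e]
    have hlim : Filter.Tendsto (fun p => a p * r) (𝓝 p) (𝓝 0) := by
      have := (ha.tendsto p).mul_const r
      rwa [hap, zero_mul] at this
    refine squeeze_zero (fun z => div_nonneg (mul_nonneg (h0 z) (h1 z)) ((h0 z).trans (hac z)))
      (fun z => ?_) hlim
    rcases ((h0 z).trans (hac z)).eq_or_lt with hz | hz
    · have : a z = 0 := le_antisymm (hz ▸ hac z) (h0 z)
      rw [this]
      simp
    · rw [mul_div_assoc]
      exact mul_le_mul_of_nonneg_left ((div_le_iff₀ hz).2 (hbc z)) (h0 z)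
  · exact ContinuousAt.div (ha.mul hb).continuousAt hc.continuousAt hp

/-- The weights of the rescaling of the fat simplex. -/
noncomputable def pushWeights {m : ℕ} (α : Fin (m + 1) →o Fin (p.len + 1))
    (t : stdSimplex ℝ (Fin (m + 1))) (r : ℝ) : stdSimplex ℝ (Fin (m + 1)) :=
  -- The total weight over each vertex of [p] is replaced by its pushed value, keeping the
  -- proportions within the fibre. The cap at 1 makes `simplexPush_le` available for every real r.
  ⟨fun x => t x * Radial.simplexPush (stdSimplex.map α t) (min r 1) (α x) /
    stdSimplex.map α t (α x), fun x => div_nonneg (mul_nonneg (stdSimplex.zero_le _ _)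
      (stdSimplex.zero_le _ _)) (stdSimplex.zero_le _ _), by
    rw [← Finset.sum_fiberwise Finset.univ α, Finset.sum_congr rfl fun y _ =>
      sum_reweight α t _ (simplexPush_le (stdSimplex.map α t) r) y]
    exact stdSimplex.sum_eq_one _⟩

theorem pushWeights_apply {m : ℕ} (α : Fin (m + 1) →o Fin (p.len + 1))
    (t : stdSimplex ℝ (Fin (m + 1))) (r : ℝ) (x) :
    pushWeights α t r x = t x * Radial.simplexPush (stdSimplex.map α t) (min r 1) (α x) /
      stdSimplex.map α t (α x) := rfl

theorem map_pushWeights {m : ℕ} (α : Fin (m + 1) →o Fin (p.len + 1))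
    (t : stdSimplex ℝ (Fin (m + 1))) (r : ℝ) :
    stdSimplex.map α (pushWeights α t r) = Radial.simplexPush (stdSimplex.map α t) (min r 1) := by
  refine stdSimplex.ext (funext fun y => ?_)
  rw [map_stdSimplex_apply]
  exact sum_reweight α t _ (simplexPush_le (stdSimplex.map α t) r) y

theorem pushWeights_face {m k : ℕ} (κ : Fin (k + 1) ↪o Fin (m + 1))
    (α : Fin (m + 1) →o Fin (p.len + 1)) (t : stdSimplex ℝ (Fin (k + 1))) (r : ℝ) :
    stdSimplex.map κ (pushWeights (α.comp κ.toOrderHom) t r) =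
      pushWeights α (stdSimplex.map κ t) r := by
  have e : stdSimplex.map (α.comp κ.toOrderHom) t = stdSimplex.map α (stdSimplex.map κ t) :=
    (stdSimplex.map_comp_apply κ α t).symm
  refine stdSimplex.ext (funext fun y => ?_)
  by_cases hy : y ∈ Set.range κ
  · obtain ⟨x, rfl⟩ := hy
    rw [map_apply_of_injective κ.injective, pushWeights_apply, pushWeights_apply,
      map_apply_of_injective κ.injective, e]
    rfl
  · rw [map_apply_of_notMem_range _ hy, pushWeights_apply, map_apply_of_notMem_range _ hy]
    simp

theorem continuous_pushWeights {m : ℕ} (α : Fin (m + 1) →o Fin (p.len + 1)) :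
    Continuous fun z : stdSimplex ℝ (Fin (m + 1)) × ℝ => pushWeights α z.1 z.2 := by
  refine Continuous.subtype_mk (continuous_pi fun x => ?_) _
  have h1 := stdSimplex.continuous_map (S := ℝ) α
  have h2 : Continuous fun z : stdSimplex ℝ (Fin (m + 1)) × ℝ =>
      Radial.simplexPush (stdSimplex.map α z.1) (min z.2 1) :=
    Radial.continuous_simplexPush.comp (f := fun z : stdSimplex ℝ (Fin (m + 1)) × ℝ =>
      (stdSimplex.map α z.1, min z.2 1)) (by fun_prop)
  refine continuous_mul_div ((Radial.continuous_stdSimplex_apply x).comp continuous_fst)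
    ((Radial.continuous_stdSimplex_apply (α x)).comp h2)
    ((Radial.continuous_stdSimplex_apply (α x)).comp (h1.comp continuous_fst))
    (fun z => stdSimplex.zero_le _ _) (fun z => ?_) (fun z => stdSimplex.zero_le _ _)
    (fun z => simplexPush_le (stdSimplex.map α z.1) z.2 (α x))
  rw [map_stdSimplex_apply]
  exact Finset.single_le_sum (f := fun x => z.1 x) (fun i _ => stdSimplex.zero_le _ _) (by simp)

/-- The radial structure of the fat simplex, over that of the topological simplex. -/
noncomputable def radial (p : SimplexCategory) : Radial (Fat p) where
  gauge z := Radial.simplexGauge p.len (toSimplex p z)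
  push z r := desc (fun _ α t => mk α (pushWeights α t r)) (fun k m κ α t => by
    rw [← pushWeights_face, mk_face]) z
  continuous_gauge := Radial.continuous_simplexGauge.comp (toSimplex p).continuous
  continuous_push := continuous_of_mk_prod fun m α =>
    (continuous_mk α).comp (continuous_pushWeights α)
  gauge_nonneg z := (Radial.simplex p.len).gauge_nonneg _
  gauge_le z := Radial.simplexGauge_le_one _
  gauge_push z r h1 h2 := by
    obtain ⟨m, α, t, rfl, -⟩ := exists_mk z
    change Radial.simplexGauge p.len (stdSimplex.map α (pushWeights α t r)) = _
    rw [map_pushWeights, min_eq_left h2, Radial.simplexGauge_push _ _ h1]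
    rfl
  push_eq z r h1 h2 h := by
    obtain ⟨m, α, t, rfl, -⟩ := exists_mk z
    change mk α (pushWeights α t r) = mk α t
    congr 1
    refine stdSimplex.ext (funext fun x => ?_)
    have e : Radial.simplexPush (stdSimplex.map α t) r = stdSimplex.map α t :=
      (Radial.simplex p.len).push_eq _ _ h1 h2 h
    rw [pushWeights_apply, min_eq_left h2, e]
    -- If the whole fibre has weight 0, then so does x, in agreement with the value of division by
    -- 0.
    by_cases hx : stdSimplex.map α t (α x) = 0
    · rw [hx, div_zero]
      rw [map_stdSimplex_apply, Finset.sum_eq_zero_iff_of_nonneg fun i _ => stdSimplex.zero_le t i]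
        at hx
      exact (hx x (by simp)).symm
    · exact mul_div_cancel_right₀ _ hx

theorem mem_bdry_radial {z : Fat p} :
    z ∈ (radial p).bdry ↔ toSimplex p z ∈ (Radial.simplex p.len).bdry := Iff.rfl

end Fat

/-! ### The two realizations of a bisimplicial set -/

/-- Maps out of the realization of a bisimplicial set are compatible families. -/
theorem Realization.exists_desc {J : Type} [SmallCategory J] (ι : J ⥤ SimplexCategory)
    (T : Jᵒᵖ ⥤ SSet.{w}) {W : Type} [TopologicalSpace W] [LocallyCompactSpace W] {Z : Type w}
    [TopologicalSpace Z]
    (ψ : ∀ (j : J) (q : SimplexCategory), (T.obj (op j)).obj (op q) →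
      C(stdSimplex ℝ (Fin ((ι.obj j).len + 1)) × stdSimplex ℝ (Fin (q.len + 1)) × W, Z))
    (hq : ∀ (j : J) (k q : SimplexCategory) (β : k ⟶ q) τ t u y,
      ψ j k ((T.obj (op j)).map β.op τ) (t, u, y) = ψ j q τ (t, stdSimplex.map β u, y))
    (hp : ∀ (i j : J) (θ : i ⟶ j) (q : SimplexCategory) τ t u y,
      ψ i q ((T.map θ.op).app (op q) τ) (t, u, y) =
        ψ j q τ (stdSimplex.map (ι.map θ) t, u, y)) :
    ∃ F : C(Realization ι (T ⋙ SSet.toTop) × W, Z), ∀ j q τ t u y,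
      F (Realization.point ι (T ⋙ SSet.toTop) j (cell (T.obj (op j)) τ u) t, y) =
        ψ j q τ (t, u, y) := by
  -- The simplex and parameter coordinates are curried away first, so that each level only needs a
  -- map out of the realization of a simplicial set into a function space.
  have ex : ∀ j, ∃ G : C(SSet.toTop.obj (T.obj (op j)),
      C(stdSimplex ℝ (Fin ((ι.obj j).len + 1)) × W, Z)), ∀ q τ u t y,
      G (cell (T.obj (op j)) τ u) (t, y) = ψ j q τ (t, u, y) := by
    intro j
    obtain ⟨G, hG⟩ := CobordismCategory.exists_desc (K := T.obj (op j))
      (TopCat.of C(stdSimplex ℝ (Fin ((ι.obj j).len + 1)) × W, Z))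
      (fun q τ => ContinuousMap.curry ⟨fun z : stdSimplex ℝ (Fin (q.len + 1)) ×
        (stdSimplex ℝ (Fin ((ι.obj j).len + 1)) × W) => ψ j q τ (z.2.1, z.1, z.2.2), by fun_prop⟩)
      (fun k q β τ u => ContinuousMap.ext fun z => hq j k q β τ z.1 u z.2)
    exact ⟨G, fun q τ u t y => by rw [hG]; rfl⟩
  choose G hG using ex
  let F : Realization ι (T ⋙ SSet.toTop) → W → Z :=
    Quot.lift (fun z y => G z.1 z.2.1 (z.2.2, y)) (by
      rintro _ _ ⟨θ, x, t⟩
      funext y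
      obtain ⟨q, τ, u, rfl⟩ := exists_cell (K := T.obj (op _)) x
      dsimp only
      have e : (T ⋙ SSet.toTop).map θ.op (cell _ τ u) = cell _ ((T.map θ.op).app (op q) τ) u :=
        map_cell _ _ _
      rw [e]
      exact (hG _ _ _ _ _ _).trans ((hp _ _ θ q τ t u y).trans (hG _ _ _ _ _ _).symm))
  refine ⟨⟨fun z => F z.1 z.2, Realization.continuous_of_point_prod fun j => ?_⟩,
    fun j q τ t u y => hG _ _ _ _ _ _⟩
  have h := ContinuousMap.continuous_uncurry_of_continuous (G j)
  exact h.comp (Homeomorph.prodAssoc _ _ _).continuous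

/-- The faces are intersected in the topological simplex. Points of `Fat` over a face come from the
fat face, which reduces the statement to simplices. -/
theorem Fat.exists_common {p q r : SimplexCategory} (θ : p ⟶ r) (θ' : q ⟶ r)
    (hθ : Function.Injective θ) (hθ' : Function.Injective θ') {a : Fat p} {b : Fat q}
    (h : Fat.map θ a = Fat.map θ' b) :
    ∃ (c : SimplexCategory) (κ : c ⟶ p) (κ' : c ⟶ q) (s : Fat c), Function.Injective κ ∧
      Function.Injective κ' ∧ κ ≫ θ = κ' ≫ θ' ∧ a = Fat.map κ s ∧ b = Fat.map κ' s := by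
  have h2 := congrArg (Fat.toSimplex r) h
  rw [Fat.toSimplex_map, Fat.toSimplex_map] at h2
  obtain ⟨c, κ, κ', s, hκ, hs, hs'⟩ := exists_common_face
    (OrderEmbedding.ofStrictMono θ
      ((SimplexCategory.Hom.toOrderHom θ).monotone.strictMono_of_injective hθ))
    (OrderEmbedding.ofStrictMono θ'
      ((SimplexCategory.Hom.toOrderHom θ').monotone.strictMono_of_injective hθ')) h2
  let k : ⦋c⦌ ⟶ p := SimplexCategory.Hom.mk κ.toOrderHom
  let k' : ⦋c⦌ ⟶ q := SimplexCategory.Hom.mk κ'.toOrderHom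
  have e : k ≫ θ = k' ≫ θ' := by
    ext x : 3
    exact hκ x
  have hk : Function.Injective k := κ.injective
  have hk' : Function.Injective k' := κ'.injective
  obtain ⟨z, hz⟩ := Fat.mem_range_map k hk (z := a) hs
  refine ⟨⦋c⦌, k, k', z, hk, hk', e, hz.symm, ?_⟩
  apply (Fat.isClosedEmbedding_map θ' hθ').injective
  rw [← h, ← hz, ← Fat.map_comp, ← Fat.map_comp, e]

theorem exists_common {p q r : SimplexCategory} (θ : p ⟶ r) (θ' : q ⟶ r)
    (hθ : Function.Injective θ) (hθ' : Function.Injective θ')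
    {a : stdSimplex ℝ (Fin (p.len + 1))} {b : stdSimplex ℝ (Fin (q.len + 1))}
    (h : stdSimplex.map θ a = stdSimplex.map θ' b) :
    ∃ (c : SimplexCategory) (κ : c ⟶ p) (κ' : c ⟶ q) (s : stdSimplex ℝ (Fin (c.len + 1))),
      Function.Injective κ ∧ Function.Injective κ' ∧ κ ≫ θ = κ' ≫ θ' ∧
      a = stdSimplex.map κ s ∧ b = stdSimplex.map κ' s := by
  obtain ⟨c, κ, κ', s, hκ, hs, hs'⟩ := exists_common_face
    (OrderEmbedding.ofStrictMono θ
      ((SimplexCategory.Hom.toOrderHom θ).monotone.strictMono_of_injective hθ))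
    (OrderEmbedding.ofStrictMono θ'
      ((SimplexCategory.Hom.toOrderHom θ').monotone.strictMono_of_injective hθ')) h
  refine ⟨⦋c⦌, SimplexCategory.Hom.mk κ.toOrderHom, SimplexCategory.Hom.mk κ'.toOrderHom, s,
    κ.injective, κ'.injective, ?_, hs, hs'⟩
  ext x : 3
  exact hκ x

theorem len_le_of_injective {p q : SimplexCategory} (θ : p ⟶ q) (h : Function.Injective θ) :
    p.len ≤ q.len := by
  have : Mono θ := SimplexCategory.mono_iff_injective.2 h
  exact SimplexCategory.len_le_of_mono θ

theorem not_surjective_of_len_lt {p q : SimplexCategory} (θ : p ⟶ q) (h : p.len < q.len) :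
    ¬ Function.Surjective θ := by
  intro hs
  have : Epi θ := SimplexCategory.epi_iff_surjective.2 hs
  have := SimplexCategory.len_le_of_epi θ
  omega

/-- A product of two points, one of which lies in the boundary, comes from a proper face. -/
theorem exists_face_prod {p q : SimplexCategory} {r : Fat p} {u : stdSimplex ℝ (Fin (q.len + 1))}
    (h : r ∈ (Fat.radial p).bdry ∨ u ∈ (Radial.simplex q.len).bdry) :
    ∃ (d : SimplexCategory × SimplexCategory) (μ : d ⟶ (p, q)) (r' : Fat d.1)
      (u' : stdSimplex ℝ (Fin (d.2.len + 1))), bisimplexFaceSystem.face μ ∧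
      Fat.map μ.1 r' = r ∧ stdSimplex.map μ.2 u' = u := by
  rcases h with h | h
  · obtain ⟨m, hm, θ, s, hs⟩ := Realization.exists_face_of_mem_bdry h
    have hinj : Function.Injective (toSimplexCategory.map θ) := (homEquiv θ).injective
    obtain ⟨r', rfl⟩ := Fat.mem_range_map (toSimplexCategory.map θ) hinj (z := r) hs.symm
    exact ⟨(⦋m⦌, q), Prod.mkHom (toSimplexCategory.map θ) (𝟙 q), r', u,
      ⟨hinj, fun _ _ h => h, Nat.add_lt_add_right hm _⟩, rfl, stdSimplex.map_id_apply u⟩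
  · obtain ⟨m, hm, θ, s, hs⟩ := Realization.exists_face_of_mem_bdry h
    exact ⟨(p, ⦋m⦌), Prod.mkHom (𝟙 p) (toSimplexCategory.map θ), r, s,
      ⟨fun _ _ h => h, (homEquiv θ).injective, Nat.add_lt_add_left hm _⟩, Fat.map_id r, hs⟩

theorem mem_bdry_of_face {d c : SimplexCategory × SimplexCategory} (μ : d ⟶ c)
    (hμ : bisimplexFaceSystem.face μ) (r : Fat d.1) (u : stdSimplex ℝ (Fin (d.2.len + 1))) :
    Fat.map μ.1 r ∈ (Fat.radial c.1).bdry ∨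
      stdSimplex.map μ.2 u ∈ (Radial.simplex c.2.len).bdry := by
  have h1 := len_le_of_injective μ.1 hμ.1
  have h2 := len_le_of_injective μ.2 hμ.2.1
  have h3 := hμ.2.2
  rcases h1.lt_or_eq with h | h
  · left
    rw [Fat.mem_bdry_radial, Fat.toSimplex_map]
    exact Radial.mem_bdry_simplex.2 (map_mem_of_notSurjective (not_surjective_of_len_lt _ h) _)
  · right
    exact Radial.mem_bdry_simplex.2
      (map_mem_of_notSurjective (not_surjective_of_len_lt _ (by omega)) _)

/-- A compatible family of maps on the proper faces of a product of simplices defines a map on the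
boundary. -/
theorem exists_glue_bisimplex {Z W : Type*} [TopologicalSpace Z] [Nonempty Z] [TopologicalSpace W]
    (c : SimplexCategory × SimplexCategory)
    (k : ∀ (d : SimplexCategory × SimplexCategory) (μ : d ⟶ c), bisimplexFaceSystem.face μ →
      C((Fat d.1 × stdSimplex ℝ (Fin (d.2.len + 1))) × W, Z))
    (hk : ∀ (d : SimplexCategory × SimplexCategory) (μ : d ⟶ c) hμ
      (b : SimplexCategory × SimplexCategory) (f : b ⟶ d) hf r u y,
      k d μ hμ ((Fat.map f.1 r, stdSimplex.map f.2 u), y) = k b (f ≫ μ) hf ((r, u), y)) :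
    ∃ Φ : (Fat c.1 × stdSimplex ℝ (Fin (c.2.len + 1))) × W → Z,
      ContinuousOn Φ {z | z.1.1 ∈ (Fat.radial c.1).bdry ∨
        z.1.2 ∈ (Radial.simplex c.2.len).bdry} ∧
      ∀ d μ hμ r u y, Φ ((Fat.map μ.1 r, stdSimplex.map μ.2 u), y) = k d μ hμ ((r, u), y) := by
  -- Finitely many faces suffice: their dimensions are bounded, and every object of the simplex
  -- category is some [a].
  let A := Σ ab : {ab : Fin (c.1.len + 1) × Fin (c.2.len + 1) //
    ab.1.1 + ab.2.1 < c.1.len + c.2.len}, {μ : ((⦋ab.1.1.1⦌, ⦋ab.1.2.1⦌) :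
      SimplexCategory × SimplexCategory) ⟶ c // bisimplexFaceSystem.face μ}
  have fin : ∀ a b : SimplexCategory, Finite (a ⟶ b) := fun a b =>
    Finite.of_injective (fun f : a ⟶ b => (f : Fin (a.len + 1) → Fin (b.len + 1)))
      fun f g h => SimplexCategory.Hom.ext _ _ (OrderHom.ext _ _ h)
  have : Finite A := by
    have : ∀ ab : SimplexCategory × SimplexCategory, Finite (ab ⟶ c) := fun ab =>
      Finite.of_injective (fun f : ab ⟶ c => ((f.1, f.2) : (ab.1 ⟶ c.1) × (ab.2 ⟶ c.2)))
        fun f g h => Prod.ext (Prod.ext_iff.1 h).1 (Prod.ext_iff.1 h).2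
    infer_instance
  obtain ⟨Φ, hΦ, hΦ'⟩ := exists_glue (A := A)
    (F := fun a => Fat ⦋a.1.1.1.1⦌ × stdSimplex ℝ (Fin (a.1.1.2.1 + 1)))
    (fun a => Prod.map (Fat.map a.2.1.1) (stdSimplex.map a.2.1.2))
    (fun a => (Fat.isClosedEmbedding_map _ a.2.2.1).prodMap
      (isClosedEmbedding_map_stdSimplex a.2.2.2.1))
    (fun a => k _ a.2.1 a.2.2) (by
      rintro ⟨⟨ab, hab⟩, μ, hμ⟩ ⟨⟨ab', hab'⟩, μ', hμ'⟩ ⟨r, u⟩ ⟨r', u'⟩ e y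
      obtain ⟨e1, e2⟩ := Prod.ext_iff.1 e
      -- Two faces of a product meet in the product of the intersections of their factors; `hk`
      -- compares both maps with the one on this common face.
      obtain ⟨b1, κ1, κ1', s1, hκ1, hκ1', h1, rfl, rfl⟩ := Fat.exists_common _ _ hμ.1 hμ'.1 e1
      obtain ⟨b2, κ2, κ2', s2, hκ2, hκ2', h2, rfl, rfl⟩ := exists_common _ _ hμ.2.1 hμ'.2.1 e2
      have hf : bisimplexFaceSystem.face (Prod.mkHom κ1 κ2 ≫ μ) :=
        ⟨hμ.1.comp hκ1, hμ.2.1.comp hκ2, (Nat.add_le_add (len_le_of_injective κ1 hκ1)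
          (len_le_of_injective κ2 hκ2)).trans_lt hμ.2.2⟩
      have hf' : Prod.mkHom κ1 κ2 ≫ μ = Prod.mkHom κ1' κ2' ≫ μ' := Prod.ext h1 h2
      refine (hk _ μ hμ (b1, b2) (Prod.mkHom κ1 κ2) hf s1 s2 y).trans ?_
      refine Eq.trans ?_ (hk _ μ' hμ' (b1, b2) (Prod.mkHom κ1' κ2') (hf' ▸ hf) s1 s2 y).symm
      congr 2)
  have hΦ2 : ∀ d μ hμ r u y,
      Φ ((Fat.map μ.1 r, stdSimplex.map μ.2 u), y) = k d μ hμ ((r, u), y) := by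
    rintro ⟨d1, d2⟩ μ hμ r u y
    exact hΦ' ⟨⟨(⟨d1.len, Nat.lt_succ_of_le (len_le_of_injective μ.1 hμ.1)⟩,
      ⟨d2.len, Nat.lt_succ_of_le (len_le_of_injective μ.2 hμ.2.1)⟩), hμ.2.2⟩, μ, hμ⟩ (r, u) y
  refine ⟨Φ, hΦ.mono ?_, hΦ2⟩
  rintro ⟨⟨r, u⟩, y⟩ h
  obtain ⟨⟨d1, d2⟩, μ, r', u', hμ, rfl, rfl⟩ := exists_face_prod h
  exact ⟨Set.mem_iUnion.2 ⟨⟨⟨(⟨d1.len, Nat.lt_succ_of_le (len_le_of_injective μ.1 hμ.1)⟩,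
      ⟨d2.len, Nat.lt_succ_of_le (len_le_of_injective μ.2 hμ.2.1)⟩), hμ.2.2⟩, μ, hμ⟩,
      (r', u'), rfl⟩, trivial⟩

/-! ### Points and fat cells of bisimplicial realizations -/

section

variable {T : SimplexCategoryᵒᵖ ⥤ SSet.{w}}

/-- The morphism of the simplex category given by an order-preserving map. -/
abbrev toHom {m : ℕ} {p : SimplexCategory} (α : Fin (m + 1) →o Fin (p.len + 1)) : ⦋m⦌ ⟶ p :=
  SimplexCategory.Hom.mk α

/-- The point of the realization of a bisimplicial set given by a bisimplex. -/
noncomputable def bipoint {J : Type} [SmallCategory J] (ι : J ⥤ SimplexCategory)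
    (T : Jᵒᵖ ⥤ SSet.{w}) {j : J} {q : SimplexCategory} (τ : (T.obj (op j)).obj (op q))
    (u : stdSimplex ℝ (Fin (q.len + 1))) (t : stdSimplex ℝ (Fin ((ι.obj j).len + 1))) :
    Realization ι (T ⋙ SSet.toTop) :=
  Realization.point ι (T ⋙ SSet.toTop) j (cell (T.obj (op j)) τ u) t

section

variable {J : Type} [SmallCategory J] {ι : J ⥤ SimplexCategory} {T : Jᵒᵖ ⥤ SSet.{w}}

theorem bipoint_map {i j : J} (θ : i ⟶ j) {q : SimplexCategory} (τ : (T.obj (op j)).obj (op q))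
    (u : stdSimplex ℝ (Fin (q.len + 1))) (t : stdSimplex ℝ (Fin ((ι.obj i).len + 1))) :
    bipoint ι T ((T.map θ.op).app (op q) τ) u t =
      bipoint ι T τ u (stdSimplex.map (ι.map θ) t) := by
  have e : (T ⋙ SSet.toTop).map θ.op (cell _ τ u) = cell _ ((T.map θ.op).app (op q) τ) u :=
    map_cell _ _ _
  exact (congrArg (fun x => Realization.point ι (T ⋙ SSet.toTop) i x t) e.symm).trans
    (Realization.point_map (X := T ⋙ SSet.toTop) θ (cell (T.obj (op j)) τ u) t)

theorem bipoint_cell_map {j : J} {k q : SimplexCategory} (β : k ⟶ q)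
    (τ : (T.obj (op j)).obj (op q)) (u : stdSimplex ℝ (Fin (k.len + 1)))
    (t : stdSimplex ℝ (Fin ((ι.obj j).len + 1))) :
    bipoint ι T ((T.obj (op j)).map β.op τ) u t = bipoint ι T τ (stdSimplex.map β u) t :=
  congrArg (fun x => Realization.point ι (T ⋙ SSet.toTop) j x t) (cell_map β τ u)

theorem continuous_bipoint {j : J} {q : SimplexCategory} (τ : (T.obj (op j)).obj (op q)) :
    Continuous fun z : stdSimplex ℝ (Fin (q.len + 1)) × stdSimplex ℝ (Fin ((ι.obj j).len + 1)) =>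
      bipoint ι T τ z.1 z.2 :=
  (Realization.continuous_point (ι := ι) (X := T ⋙ SSet.toTop) j).comp
    (((cell _ τ).continuous.comp continuous_fst).prodMk continuous_snd)

theorem exists_bipoint (z : Realization ι (T ⋙ SSet.toTop)) :
    ∃ (j : J) (q : SimplexCategory) (τ : (T.obj (op j)).obj (op q)) (u : _) (t : _),
      bipoint ι T τ u t = z := by
  obtain ⟨j, x, t, rfl⟩ := Realization.exists_point z
  obtain ⟨q, τ, u, rfl⟩ := exists_cell (K := T.obj (op j)) x
  exact ⟨j, q, τ, u, t, rfl⟩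

end

theorem map_op_comp_app {a b c q : SimplexCategory} (f : b ⟶ a) (g : c ⟶ b)
    (τ : (T.obj (op a)).obj (op q)) :
    (T.map (g ≫ f).op).app (op q) τ = (T.map g.op).app (op q) ((T.map f.op).app (op q) τ) := by
  rw [op_comp, T.map_comp]
  rfl

/-- The map from the fat simplex to the semi-simplicial realization given by a bisimplex. -/
noncomputable def fatCell {p q : SimplexCategory} (τ : (T.obj (op p)).obj (op q)) :
    C(Fat p × stdSimplex ℝ (Fin (q.len + 1)),
      Realization toSimplexCategory ((toSimplexCategory.op ⋙ T) ⋙ SSet.toTop)) where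
  toFun z := Fat.desc (fun m α t => bipoint toSimplexCategory (toSimplexCategory.op ⋙ T)
      (j := ⦋m⦌ₛ) ((T.map (toHom α).op).app (op q) τ) z.2 t)
    (fun k m κ α t => by
      let θ : ⦋k⦌ₛ ⟶ ⦋m⦌ₛ := homEquiv.symm κ
      have h := bipoint_map (ι := toSimplexCategory) (T := toSimplexCategory.op ⋙ T) θ
        ((T.map (toHom α).op).app (op q) τ) z.2 t
      have e : (T.map (toHom (α.comp κ.toOrderHom)).op).app (op q) τ =
          (T.map (toSimplexCategory.map θ).op).app (op q) ((T.map (toHom α).op).app (op q) τ) := by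
        exact map_op_comp_app (toHom α) (toHom κ.toOrderHom) τ
      rw [e]
      exact h) z.1
  continuous_toFun := by
    refine Fat.continuous_of_mk_prod fun m α => ?_
    exact (continuous_bipoint (ι := toSimplexCategory) (T := toSimplexCategory.op ⋙ T)
      (j := ⦋m⦌ₛ) ((T.map (toHom α).op).app (op q) τ)).comp continuous_swap

variable {p q : SimplexCategory}

theorem fatCell_mk (τ : (T.obj (op p)).obj (op q)) {m : ℕ} (α : Fin (m + 1) →o Fin (p.len + 1))
    (t : stdSimplex ℝ (Fin (m + 1))) (u : stdSimplex ℝ (Fin (q.len + 1))) :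
    fatCell τ (Fat.mk α t, u) = bipoint toSimplexCategory (toSimplexCategory.op ⋙ T)
      (j := ⦋m⦌ₛ) ((T.map (toHom α).op).app (op q) τ) u t := rfl

/-- Restriction of bisimplices. -/
def restr {c d : SimplexCategory × SimplexCategory} (f : d ⟶ c)
    (τ : (T.obj (op c.1)).obj (op c.2)) : (T.obj (op d.1)).obj (op d.2) :=
  (T.map f.1.op).app (op d.2) ((T.obj (op c.1)).map f.2.op τ)

theorem restr_id (c : SimplexCategory × SimplexCategory) (τ : (T.obj (op c.1)).obj (op c.2)) :
    restr (𝟙 c) τ = τ := by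
  change (T.map (𝟙 c.1).op).app (op c.2) ((T.obj (op c.1)).map (𝟙 c.2).op τ) = τ
  rw [op_id, op_id, CategoryTheory.Functor.map_id, CategoryTheory.Functor.map_id]
  rfl

theorem restr_comp {b c d : SimplexCategory × SimplexCategory} (f : c ⟶ b) (g : d ⟶ c)
    (τ : (T.obj (op b.1)).obj (op b.2)) : restr (g ≫ f) τ = restr g (restr f τ) := by
  have h := ConcreteCategory.congr_hom ((T.map f.1.op).naturality g.2.op)
    ((T.obj (op b.1)).map f.2.op τ)
  change (T.map (g.1 ≫ f.1).op).app (op d.2) ((T.obj (op b.1)).map (g.2 ≫ f.2).op τ) = _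
  rw [op_comp, op_comp, T.map_comp, CategoryTheory.Functor.map_comp]
  exact congrArg ((T.map g.1.op).app (op d.2)) h

theorem fatCell_restr {c d : SimplexCategory × SimplexCategory} (f : d ⟶ c)
    (τ : (T.obj (op c.1)).obj (op c.2)) (r : Fat d.1) (u : stdSimplex ℝ (Fin (d.2.len + 1))) :
    fatCell (restr f τ) (r, u) = fatCell τ (Fat.map f.1 r, stdSimplex.map f.2 u) := by
  obtain ⟨m, α, t, rfl, -⟩ := Fat.exists_mk r
  rw [Fat.map_mk, fatCell_mk, fatCell_mk]
  refine Eq.trans ?_ (bipoint_cell_map (ι := toSimplexCategory) (T := toSimplexCategory.op ⋙ T)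
    (j := ⦋m⦌ₛ) f.2 _ u t)
  congr 1
  have h := ConcreteCategory.congr_hom ((T.map (toHom α ≫ f.1).op).naturality f.2.op) τ
  refine Eq.trans ?_ h
  rw [op_comp, T.map_comp]
  rfl

/-- Evaluation in the realization of the simplicial space. -/
theorem ofRestrict_fatCell (τ : (T.obj (op p)).obj (op q)) (r : Fat p)
    (u : stdSimplex ℝ (Fin (q.len + 1))) :
    Realization.ofRestrict toSimplexCategory (T ⋙ SSet.toTop) (fatCell τ (r, u)) =
      bipoint (𝟭 SimplexCategory) T τ u (Fat.toSimplex p r) := by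
  obtain ⟨m, α, t, rfl, -⟩ := Fat.exists_mk r
  exact bipoint_map (ι := 𝟭 SimplexCategory) (toHom α) τ u t

theorem fatCell_ofSimplex {p : SemiSimplexCategory}
    (τ : (T.obj (op (toSimplexCategory.obj p))).obj (op q))
    (t : stdSimplex ℝ (Fin (p.len + 1))) (u : stdSimplex ℝ (Fin (q.len + 1))) :
    fatCell τ (Fat.ofSimplex (toSimplexCategory.obj p) t, u) =
      bipoint toSimplexCategory (toSimplexCategory.op ⋙ T) τ u t := by
  refine (fatCell_mk (p := toSimplexCategory.obj p) τ OrderHom.id t u).trans ?_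
  have e : (T.map (toHom (p := toSimplexCategory.obj p) OrderHom.id).op).app (op q) τ = τ := by
    have e : toHom (p := toSimplexCategory.obj p) OrderHom.id = 𝟙 (toSimplexCategory.obj p) := rfl
    rw [e, op_id, CategoryTheory.Functor.map_id]
    rfl
  exact congrArg (fun τ => bipoint toSimplexCategory (toSimplexCategory.op ⋙ T) (j := p) τ u t) e

end

/-! ### Flattening homotopies on fat simplices -/

section

variable {T : SimplexCategoryᵒᵖ ⥤ SSet.{w}} {D : Type} [TopologicalSpace D] (R : Radial D)
  {Z : Type w} [TopologicalSpace Z]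
  (x : C(Realization toSimplexCategory ((toSimplexCategory.op ⋙ T) ⋙ SSet.toTop) × D, Z))

/-- The domain of the homotopy belonging to a bisimplex. -/
abbrev FatCyl (D : Type) (c : SimplexCategory × SimplexCategory) : Type :=
  (Fat c.1 × stdSimplex ℝ (Fin (c.2.len + 1)) × D) × I

/-- The functoriality of `FatCyl`. -/
noncomputable def FatCyl.map (D : Type) [TopologicalSpace D]
    {c d : SimplexCategory × SimplexCategory} (f : d ⟶ c) : C(FatCyl D d, FatCyl D c) where
  toFun z := ((Fat.map f.1 z.1.1, stdSimplex.map f.2 z.1.2.1, z.1.2.2), z.2)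
  continuous_toFun := by
    have := stdSimplex.continuous_map (S := ℝ) f.2
    fun_prop

theorem FatCyl.map_comp {b c d : SimplexCategory × SimplexCategory} (f : c ⟶ b) (g : d ⟶ c) :
    FatCyl.map D (g ≫ f) = (FatCyl.map D f).comp (FatCyl.map D g) := by
  refine ContinuousMap.ext fun z => Prod.ext (Prod.ext (Fat.map_comp g.1 f.1 z.1.1)
    (Prod.ext ?_ rfl)) rfl
  exact (stdSimplex.map_comp_apply g.2 f.2 z.1.2.1).symm

/-- A homotopy on the fat simplex that starts with the given map `x`, ends with a map that factors
through the topological simplex, and is constant on the boundary of `D`. -/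
structure IsFlattening {c : SimplexCategory × SimplexCategory} (τ : (T.obj (op c.1)).obj (op c.2))
    (h : C(FatCyl D c, Z)) : Prop where
  zero : ∀ r u d, h ((r, u, d), 0) = x (fatCell τ (r, u), d)
  one : ∀ r u d, h ((r, u, d), 1) = h ((Fat.ofSimplex _ (Fat.toSimplex _ r), u, d), 1)
  bdry : ∀ r u, ∀ d ∈ R.bdry, ∀ s, h ((r, u, d), s) = x (fatCell τ (r, u), d)

variable {R x}

/-- This covers degeneracies as well: the end condition says that the end map factors through
`toSimplex`, which is natural for all maps, unlike `ofSimplex`. -/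
theorem IsFlattening.comp_map {c d : SimplexCategory × SimplexCategory} (f : d ⟶ c)
    {τ : (T.obj (op c.1)).obj (op c.2)} {h : C(FatCyl D c, Z)} (hh : IsFlattening R x τ h) :
    IsFlattening R x (restr f τ) (h.comp (FatCyl.map D f)) where
  zero r u d := by
    rw [fatCell_restr]
    exact hh.zero _ _ _
  one r u d := by
    change h ((Fat.map f.1 r, _, _), 1) = h ((Fat.map f.1 _, _, _), 1)
    rw [hh.one, hh.one (Fat.map f.1 (Fat.ofSimplex _ (Fat.toSimplex _ r))), Fat.toSimplex_map,
      Fat.toSimplex_map, Fat.toSimplex_ofSimplex]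
  bdry r u d hd s := by
    rw [fatCell_restr]
    exact hh.bdry _ _ d hd s

/-- Flattenings extend from the proper faces. -/
theorem exists_isFlattening [Nonempty Z]
    {y₀ : Realization (𝟭 SimplexCategory) (T ⋙ SSet.toTop) × D → Z}
    (hy₀ : ContinuousOn y₀ (Set.univ ×ˢ R.bdry))
    (hxy : ∀ z, ∀ d ∈ R.bdry,
      x (z, d) = y₀ (Realization.ofRestrict toSimplexCategory (T ⋙ SSet.toTop) z, d))
    (c : SimplexCategory × SimplexCategory) (τ : (T.obj (op c.1)).obj (op c.2))
    (k : ∀ (d : SimplexCategory × SimplexCategory) (μ : d ⟶ c), bisimplexFaceSystem.face μ →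
      C(FatCyl D d, Z))
    (hk : ∀ d μ hμ, IsFlattening R x (restr μ τ) (k d μ hμ))
    (hk' : ∀ (d : SimplexCategory × SimplexCategory) (μ : d ⟶ c) hμ
      (b : SimplexCategory × SimplexCategory) (f : b ⟶ d) hf,
      (k d μ hμ).comp (FatCyl.map D f) = k b (f ≫ μ) hf) :
    ∃ h : C(FatCyl D c, Z), IsFlattening R x τ h ∧
      ∀ d μ hμ, h.comp (FatCyl.map D μ) = k d μ hμ := by
  classical
  obtain ⟨p, q⟩ := c
  obtain ⟨Φ, hΦ, hΦ'⟩ := exists_glue_bisimplex (W := D × I) (p, q)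
    (fun d μ hμ => (k d μ hμ).comp ⟨fun z => ((z.1.1, z.1.2, z.2.1), z.2.2), by fun_prop⟩)
    (fun d μ hμ b f hf r u y => ContinuousMap.congr_fun (hk' d μ hμ b f hf) ((r, u, y.1), y.2))
  replace hΦ' : ∀ d μ hμ r u y s, Φ ((Fat.map μ.1 r, stdSimplex.map μ.2 u), (y, s)) =
    k d μ hμ ((r, u, y), s) := fun d μ hμ r u y s => hΦ' d μ hμ r u (y, s)
  let B : Fat p → stdSimplex ℝ (Fin (q.len + 1)) → Prop := fun r u =>
    r ∈ (Fat.radial p).bdry ∨ u ∈ (Radial.simplex q.len).bdry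
  have hx1 : ∀ r u, ∀ d ∈ R.bdry, x (fatCell τ (r, u), d) =
      y₀ (bipoint (𝟭 SimplexCategory) T τ u (Fat.toSimplex p r), d) := fun r u d hd => by
    rw [hxy _ d hd, ofRestrict_fatCell]
  have Φ0 : ∀ r u, B r u → ∀ d, Φ ((r, u), (d, 0)) = x (fatCell τ (r, u), d) := by
    intro r u h d
    obtain ⟨b, μ, r', u', hμ, rfl, rfl⟩ := exists_face_prod h
    rw [hΦ' b μ hμ, (hk b μ hμ).zero, fatCell_restr]
  -- Faces are injective, so here `ofSimplex` does commute with them.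
  have Φ1 : ∀ r u, B r u → ∀ d,
      Φ ((r, u), (d, 1)) = Φ ((Fat.ofSimplex p (Fat.toSimplex p r), u), (d, 1)) := by
    intro r u h d
    obtain ⟨b, μ, r', u', hμ, rfl, rfl⟩ := exists_face_prod h
    rw [hΦ' b μ hμ, (hk b μ hμ).one, Fat.toSimplex_map, ← Fat.map_ofSimplex_of_injective μ.1 hμ.1,
      hΦ' b μ hμ]
  have ΦR : ∀ r u, B r u → ∀ d ∈ R.bdry, ∀ s,
      Φ ((r, u), (d, s)) = x (fatCell τ (r, u), d) := by
    intro r u h d hd s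
    obtain ⟨b, μ, r', u', hμ, rfl, rfl⟩ := exists_face_prod h
    rw [hΦ' b μ hμ, (hk b μ hμ).bdry _ _ d hd, fatCell_restr]
  -- The end map on Δ^p × Δ^q × D is prescribed by y₀ over ∂D, and by the end of the homotopies on
  -- the faces over ∂(Δ^p × Δ^q).
  let yb : stdSimplex ℝ (Fin (p.len + 1)) × stdSimplex ℝ (Fin (q.len + 1)) × D → Z := fun z =>
    if z.2.2 ∈ R.bdry then y₀ (bipoint (𝟭 SimplexCategory) T τ z.2.1 z.1, z.2.2)
    else Φ ((Fat.ofSimplex p z.1, z.2.1), (z.2.2, 1))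
  let hb : (Fat p × stdSimplex ℝ (Fin (q.len + 1)) × D) × I → Z := fun z =>
    if z.1.2.2 ∈ R.bdry then x (fatCell τ (z.1.1, z.1.2.1), z.1.2.2)
    else Φ ((z.1.1, z.1.2.1), (z.1.2.2, z.2))
  let RX := (Fat.radial p).prod ((Radial.simplex q.len).prod R)
  let RY := (Radial.simplex p.len).prod ((Radial.simplex q.len).prod R)
  have memX : ∀ r u d, (r, u, d) ∈ RX.bdry ↔ B r u ∨ d ∈ R.bdry := by
    intro r u d
    simp [RX, Radial.mem_bdry_prod, B, or_assoc]
  have memY : ∀ t u d, (t, u, d) ∈ RY.bdry ↔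
      (t ∈ (Radial.simplex p.len).bdry ∨ u ∈ (Radial.simplex q.len).bdry) ∨ d ∈ R.bdry := by
    intro t u d
    simp [RY, Radial.mem_bdry_prod, or_assoc]
  have memB : ∀ t u, (t ∈ (Radial.simplex p.len).bdry ∨ u ∈ (Radial.simplex q.len).bdry) →
      B (Fat.ofSimplex p t) u := by
    intro t u h
    refine h.imp (fun h => ?_) id
    rw [Fat.mem_bdry_radial, Fat.toSimplex_ofSimplex]
    exact h
  have yb1 : ∀ t u, ∀ d ∈ R.bdry, yb (t, u, d) = y₀ (bipoint (𝟭 SimplexCategory) T τ u t, d) :=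
    fun t u d hd => if_pos hd
  have yb2 : ∀ t u, B (Fat.ofSimplex p t) u → ∀ d,
      yb (t, u, d) = Φ ((Fat.ofSimplex p t, u), (d, 1)) := by
    intro t u ht d
    by_cases hd : d ∈ R.bdry
    · rw [yb1 t u d hd, ΦR _ _ ht d hd, hx1 _ _ d hd, Fat.toSimplex_ofSimplex]
    · exact if_neg hd
  have hb1 : ∀ r u, ∀ d ∈ R.bdry, ∀ s, hb ((r, u, d), s) = x (fatCell τ (r, u), d) :=
    fun r u d hd s => if_pos hd
  have hb2 : ∀ r u, B r u → ∀ d s, hb ((r, u, d), s) = Φ ((r, u), (d, s)) := by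
    intro r u hB d s
    by_cases hd : d ∈ R.bdry
    · rw [hb1 r u d hd, ΦR _ _ hB d hd]
    · exact if_neg hd
  have hbip := continuous_bipoint (ι := 𝟭 SimplexCategory) (T := T) τ
  have hyb : ContinuousOn yb RY.bdry := by
    have e : RY.bdry = {z | z.1 ∈ (Radial.simplex p.len).bdry ∨
        z.2.1 ∈ (Radial.simplex q.len).bdry} ∪ {z | z.2.2 ∈ R.bdry} :=
      Set.ext fun z => memY z.1 z.2.1 z.2.2
    rw [e]
    refine ContinuousOn.union_of_isClosed
      ((hΦ.comp (f := fun z : stdSimplex ℝ (Fin (p.len + 1)) × stdSimplex ℝ (Fin (q.len + 1)) × D =>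
        ((Fat.ofSimplex p z.1, z.2.1), (z.2.2, (1 : I)))) (Continuous.continuousOn (by fun_prop))
        fun z hz => memB z.1 z.2.1 hz).congr fun z hz => yb2 z.1 z.2.1 (memB _ _ hz) z.2.2)
      (ContinuousOn.congr ?_ fun z hz => yb1 z.1 z.2.1 z.2.2 hz) ?_
      (R.isClosed_bdry.preimage (by fun_prop))
    · exact hy₀.comp (f := fun z : stdSimplex ℝ (Fin (p.len + 1)) ×
        stdSimplex ℝ (Fin (q.len + 1)) × D => (bipoint (𝟭 SimplexCategory) T τ z.2.1 z.1, z.2.2))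
        (Continuous.continuousOn ((hbip.comp (f := fun z : stdSimplex ℝ (Fin (p.len + 1)) ×
        stdSimplex ℝ (Fin (q.len + 1)) × D => (z.2.1, z.1)) (by fun_prop)).prodMk (by fun_prop)))
        fun z hz => ⟨trivial, hz⟩
    · exact ((Radial.isClosed_bdry _).preimage (by fun_prop)).union
        ((Radial.isClosed_bdry _).preimage (by fun_prop))
  have hhb : ContinuousOn hb (RX.bdry ×ˢ Set.univ) := by
    have e : RX.bdry ×ˢ (Set.univ : Set I) =
        {z | B z.1.1 z.1.2.1} ∪ {z | z.1.2.2 ∈ R.bdry} := by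
      ext ⟨⟨r, u, d⟩, s⟩
      simp [memX]
    rw [e]
    refine ContinuousOn.union_of_isClosed
      ((hΦ.comp (f := fun z : (Fat p × stdSimplex ℝ (Fin (q.len + 1)) × D) × I =>
        ((z.1.1, z.1.2.1), (z.1.2.2, z.2))) (Continuous.continuousOn (by fun_prop))
        fun z hz => hz).congr fun z hz => hb2 z.1.1 z.1.2.1 hz z.1.2.2 z.2)
      (ContinuousOn.congr ?_ fun z hz => hb1 z.1.1 z.1.2.1 z.1.2.2 hz z.2) ?_
      (R.isClosed_bdry.preimage (by fun_prop))
    · exact Continuous.continuousOn (by fun_prop)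
    · exact ((Radial.isClosed_bdry _).preimage (by fun_prop)).union
        ((Radial.isClosed_bdry _).preimage (by fun_prop))
  -- Relative extension for the retraction of `Fat p` onto Δ^p. The required preservation of
  -- boundaries holds because `contract` moves points only within the fibres over Δ^p.
  obtain ⟨y', h', hy', hh', h0, h1⟩ := ((Fat.compatibleInverse p).prod
    (stdSimplex ℝ (Fin (q.len + 1)) × D)).exists_dual_lift RX RY
    (by
      rintro ⟨r, u, d⟩ h
      exact (memY _ _ _).2 ((memX _ _ _).1 h))
    (by
      rintro ⟨t, u, d⟩ h
      exact (memX _ _ _).2 (((memY _ _ _).1 h).imp_left (memB t u)))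
    (by
      rintro ⟨r, u, d⟩ h s
      refine (memX _ _ _).2 (((memX _ _ _).1 h).imp_left fun h => h.imp_left fun h => ?_)
      change Fat.contract p (r, s) ∈ _
      rw [Fat.mem_bdry_radial, Fat.toSimplex_contract]
      exact h)
    (by
      rintro ⟨t, u, d⟩ h s
      exact h)
    ⟨fun z => x (fatCell τ (z.1, z.2.1), z.2.2), by fun_prop⟩ yb hyb hb hhb
    (by
      rintro ⟨r, u, d⟩ h
      rcases (memX _ _ _).1 h with h | h
      · rw [hb2 r u h, Φ0 r u h]
        rfl
      · exact hb1 r u d h 0)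
    (by
      rintro ⟨r, u, d⟩ h
      change _ = yb (Fat.toSimplex p r, u, d)
      rcases (memX _ _ _).1 h with h | h
      · rw [hb2 r u h, Φ1 r u h, yb2]
        exact memB _ _ h
      · rw [hb1 r u d h 1, yb1 _ _ _ h, hx1 r u d h])
  have hfl : IsFlattening R x τ (c := (p, q)) h' := by
    refine ⟨fun r u d => h0 (r, u, d), fun r u d => ?_, fun r u d hd s => ?_⟩
    · refine (h1 (r, u, d)).trans (Eq.trans ?_ (h1 (Fat.ofSimplex p (Fat.toSimplex p r), u, d)).symm)
      change y' (Fat.toSimplex p r, u, d) = y' (Fat.toSimplex p (Fat.ofSimplex p _), u, d)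
      rw [Fat.toSimplex_ofSimplex]
    · rw [hh' _ ((memX r u d).2 (Or.inr hd)), hb1 r u d hd]
  refine ⟨h', hfl, fun d μ hμ => ContinuousMap.ext ?_⟩
  rintro ⟨⟨r, u, y⟩, s⟩
  have hB := mem_bdry_of_face μ hμ r u
  change h' ((Fat.map μ.1 r, stdSimplex.map μ.2 u, y), s) = _
  rw [hh' _ ((memX _ _ y).2 (Or.inl hB)), hb2 _ _ hB, hΦ' d μ hμ]

/-- The comparison map from the semi-simplicial realization of a bisimplicial set to its
realization has the extension property of a homotopy equivalence. -/
theorem hasDualLifting_ofRestrict (T : SimplexCategoryᵒᵖ ⥤ SSet.{w}) [LocallyCompactSpace D]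
    (R : Radial D) :
    HasDualLifting (Realization.ofRestrict toSimplexCategory (T ⋙ SSet.toTop)) R := by
  intro Z _ x y₀ hy₀ hxy
  change C(Realization toSimplexCategory ((toSimplexCategory.op ⋙ T) ⋙ SSet.toTop) × D, Z) at x
  rcases isEmpty_or_nonempty Z with hZ | hZ
  · have hQ : IsEmpty (Realization (𝟭 SimplexCategory) (T ⋙ SSet.toTop) × D) := ⟨fun z => by
      obtain ⟨j, q, τ, u, t, e⟩ := exists_bipoint z.1
      exact hZ.false (x (fatCell τ (Fat.ofSimplex j t, u), z.2))⟩
    have hP : IsEmpty (Realization toSimplexCategory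
      (toSimplexCategory.op ⋙ T ⋙ SSet.toTop) × D) := ⟨fun z => hZ.false (x z)⟩
    exact ⟨⟨fun p => isEmptyElim p, continuous_of_discreteTopology⟩,
      ⟨fun p => isEmptyElim p.1, continuous_of_discreteTopology⟩,
      fun q d => (hQ.false (q, d)).elim, fun q d => (hP.false (q, d)).elim,
      fun q d => (hP.false (q, d)).elim, fun q d => (hP.false (q, d)).elim⟩
  -- A choice of flattenings that is natural for faces and degeneracies in both directions.
  obtain ⟨h, hP, hn⟩ := bisimplexFaceSystem.exists_natural_family
    (S := fun c => (T.obj (op c.1)).obj (op c.2)) (H := fun c => C(FatCyl D c, Z))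
    (fun f τ => restr f τ) restr_id (fun f g τ => restr_comp f g τ)
    (fun f h => h.comp (FatCyl.map D f)) (fun f g h => by rw [FatCyl.map_comp]; rfl)
    (fun c τ h => IsFlattening R x τ h) (fun f τ h hh => hh.comp_map f)
    (fun c τ k hk hk' => exists_isFlattening hy₀ hxy c τ k hk hk')
  have hn2 : ∀ {c d : SimplexCategory × SimplexCategory} (f : d ⟶ c)
      (τ : (T.obj (op c.1)).obj (op c.2)) r u y s, h d (restr f τ) ((r, u, y), s) =
        h c τ ((Fat.map f.1 r, stdSimplex.map f.2 u, y), s) := fun f τ r u y s =>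
    ContinuousMap.congr_fun (hn f τ) ((r, u, y), s)
  have hnq : ∀ (p k q : SimplexCategory) (β : k ⟶ q) (τ : (T.obj (op p)).obj (op q)) r u y s,
      h (p, k) ((T.obj (op p)).map β.op τ) ((r, u, y), s) =
        h (p, q) τ ((r, stdSimplex.map β u, y), s) := by
    intro p k q β τ r u y s
    have e := hn2 (c := (p, q)) (d := (p, k)) (Prod.mkHom (𝟙 p) β) τ r u y s
    change _ = h (p, q) τ ((Fat.map (𝟙 p) r, stdSimplex.map β u, y), s) at e
    rw [Fat.map_id] at e
    rw [← e]
    congr 2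
    change _ = (T.map (𝟙 p).op).app (op k) ((T.obj (op p)).map β.op τ)
    rw [op_id, CategoryTheory.Functor.map_id]
    rfl
  have hnp : ∀ (i p q : SimplexCategory) (θ : i ⟶ p) (τ : (T.obj (op p)).obj (op q)) r u y s,
      h (i, q) ((T.map θ.op).app (op q) τ) ((r, u, y), s) =
        h (p, q) τ ((Fat.map θ r, u, y), s) := by
    intro i p q θ τ r u y s
    have e := hn2 (c := (p, q)) (d := (i, q)) (Prod.mkHom θ (𝟙 q)) τ r u y s
    change _ = h (p, q) τ ((Fat.map θ r, stdSimplex.map (𝟙 q : q ⟶ q) u, y), s) at e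
    have e2 : stdSimplex.map (𝟙 q : q ⟶ q) u = u := stdSimplex.map_id_apply u
    rw [e2] at e
    rw [← e]
    congr 2
    change _ = (T.map θ.op).app (op q) ((T.obj (op p)).map (𝟙 q).op τ)
    rw [op_id, CategoryTheory.Functor.map_id]
    rfl
  -- The ends of the flattenings, read on the top simplex. For a degeneracy θ the top simplex is not
  -- preserved, but the end value depends only on the image in Δ^p.
  obtain ⟨y', hy'⟩ := Realization.exists_desc (𝟭 SimplexCategory) T (W := D) (Z := Z)
    (fun p q τ => ⟨fun z => h (p, q) τ ((Fat.ofSimplex p z.1, z.2.1, z.2.2), 1), by fun_prop⟩)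
    (fun p k q β τ t u y => hnq p k q β τ _ u y 1)
    (fun i p θ q τ t u y => by
      refine (hnp i p q θ τ _ u y 1).trans (((hP (p, q) τ).one _ _ _).trans ?_)
      rw [Fat.toSimplex_map, Fat.toSimplex_ofSimplex]
      rfl)
  -- At intermediate times only injective maps have to be respected, as the homotopy lives on the
  -- semi-simplicial realization.
  obtain ⟨h', hh'⟩ := Realization.exists_desc toSimplexCategory (toSimplexCategory.op ⋙ T)
    (W := D × I) (Z := Z)
    (fun p q τ => ⟨fun z => h (toSimplexCategory.obj p, q) τ
      ((Fat.ofSimplex (toSimplexCategory.obj p) z.1, z.2.1, z.2.2.1), z.2.2.2), by fun_prop⟩)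
    (fun p k q β τ t u y => hnq (toSimplexCategory.obj p) k q β τ _ u y.1 y.2)
    (fun i p θ q τ t u y => by
      refine (hnp _ _ q (toSimplexCategory.map θ) τ _ u y.1 y.2).trans ?_
      rw [Fat.map_ofSimplex_of_injective _ (homEquiv θ).injective]
      rfl)
  refine ⟨y', h'.comp ⟨fun z => (z.1.1, (z.1.2, z.2)), by fun_prop⟩, fun z d hd => ?_,
    fun z d => ?_, fun z d => ?_, fun z d hd s => ?_⟩
  · obtain ⟨p, q, τ, u, t, rfl⟩ := exists_bipoint z
    refine (hy' p q τ t u d).trans (((hP (p, q) τ).bdry _ _ d hd 1).trans ?_)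
    refine (hxy _ d hd).trans ?_
    rw [ofRestrict_fatCell, Fat.toSimplex_ofSimplex]
  · obtain ⟨p, q, τ, u, t, rfl⟩ := exists_bipoint (ι := toSimplexCategory)
      (T := toSimplexCategory.op ⋙ T) z
    have e := (hP (toSimplexCategory.obj p, q) τ).zero
      (Fat.ofSimplex (toSimplexCategory.obj p) t) u d
    rw [fatCell_ofSimplex τ t u] at e
    exact (hh' p q τ t u (d, 0)).trans e
  · obtain ⟨p, q, τ, u, t, rfl⟩ := exists_bipoint (ι := toSimplexCategory)
      (T := toSimplexCategory.op ⋙ T) z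
    exact (hh' p q τ t u (d, 1)).trans (hy' (toSimplexCategory.obj p) q τ t u d).symm
  · obtain ⟨p, q, τ, u, t, rfl⟩ := exists_bipoint (ι := toSimplexCategory)
      (T := toSimplexCategory.op ⋙ T) z
    have e := (hP (toSimplexCategory.obj p, q) τ).bdry
      (Fat.ofSimplex (toSimplexCategory.obj p) t) u d hd s
    rw [fatCell_ofSimplex τ t u] at e
    exact (hh' p q τ t u (d, s)).trans e

end

/-! ### Decomposition of prisms into simplices -/

section Prism

/-- Möbius inversion on a finite poset: the sum over the elements strictly below y is known by
induction. -/
theorem eq_of_sum_le_eq {P : Type} [PartialOrder P] [Fintype P] [DecidableLE P] {f g : P → ℝ}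
    (h : ∀ y, ∑ x with x ≤ y, f x = ∑ x with x ≤ y, g x) : f = g := by
  classical
  funext y
  induction y using WellFoundedLT.induction with
  | ind y ih =>
    have e : (Finset.univ.filter fun x => x ≤ y) = insert y (Finset.univ.filter fun x => x < y) := by
      ext x
      simp [le_iff_eq_or_lt]
    have h1 := h y
    rw [e, Finset.sum_insert (by simp), Finset.sum_insert (by simp),
      Finset.sum_congr rfl fun x hx => ih x (Finset.mem_filter.1 hx).2] at h1
    exact add_right_cancel h1

theorem sum_filter_map_stdSimplex {X Y : Type} [Fintype X] [Fintype Y] (f : X → Y)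
    (t : stdSimplex ℝ X) (p : Y → Prop) [DecidablePred p] :
    ∑ y with p y, stdSimplex.map f t y = ∑ x with p (f x), t x := by
  classical
  simp_rw [map_stdSimplex_apply]
  rw [← Finset.sum_fiberwise_of_maps_to (s := Finset.univ.filter fun x => p (f x))
    (t := Finset.univ.filter p) (g := f) (by simp)]
  refine Finset.sum_congr rfl fun y hy => Finset.sum_congr ?_ fun _ _ => rfl
  ext x
  simp only [Finset.mem_filter, Finset.mem_univ, true_and] at hy ⊢
  constructor
  · rintro rfl
    exact ⟨hy, rfl⟩
  · exact fun h => h.2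

/-- The image of a point of a simplex in a chain of a product is determined by its projections to
the two factors. -/
theorem map_prod_eq {X Y P Q : Type} [LinearOrder X] [LinearOrder Y] [PartialOrder P]
    [PartialOrder Q] [Fintype X] [Fintype Y] [Fintype P] [Fintype Q]
    (θ : X →o P) (w : X →o Q) (θ' : Y →o P) (w' : Y →o Q)
    {t : stdSimplex ℝ X} {t' : stdSimplex ℝ Y}
    (h1 : stdSimplex.map θ t = stdSimplex.map θ' t')
    (h2 : stdSimplex.map w t = stdSimplex.map w' t') :
    stdSimplex.map (fun x => (θ x, w x)) t = stdSimplex.map (fun x => (θ' x, w' x)) t' := by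
  classical
  -- The two conditions cut out lower sets of the linear order X. These are nested, so the mass of
  -- the intersection is the minimum of the two masses, which depends only on the projections.
  have key : ∀ {X : Type} [LinearOrder X] [Fintype X] (θ : X →o P) (w : X →o Q)
      (t : stdSimplex ℝ X) (y : P × Q),
      ∑ x with x ≤ y, stdSimplex.map (fun x => (θ x, w x)) t x =
        min (∑ x with x ≤ y.1, stdSimplex.map θ t x) (∑ x with x ≤ y.2, stdSimplex.map w t x) := by
    intro X _ _ θ w t y
    rw [sum_filter_map_stdSimplex, sum_filter_map_stdSimplex, sum_filter_map_stdSimplex]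
    have hA : IsLowerSet {x | θ x ≤ y.1} := fun a b hab ha => (θ.monotone hab).trans ha
    have hB : IsLowerSet {x | w x ≤ y.2} := fun a b hab ha => (w.monotone hab).trans ha
    rcases hA.total hB with h | h
    · have hs : (Finset.univ.filter fun x => (θ x, w x) ≤ y) =
          Finset.univ.filter fun x => θ x ≤ y.1 := by
        ext x
        simp only [Finset.mem_filter, Finset.mem_univ, true_and, Prod.le_def]
        exact ⟨fun hx => hx.1, fun hx => ⟨hx, h hx⟩⟩
      rw [hs, min_eq_left]
      exact Finset.sum_le_sum_of_subset_of_nonneg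
        (fun x hx => by simpa using h (by simpa using hx)) fun _ _ _ => stdSimplex.zero_le _ _
    · have hs : (Finset.univ.filter fun x => (θ x, w x) ≤ y) =
          Finset.univ.filter fun x => w x ≤ y.2 := by
        ext x
        simp only [Finset.mem_filter, Finset.mem_univ, true_and, Prod.le_def]
        exact ⟨fun hx => hx.2, fun hx => ⟨h hx, hx⟩⟩
      rw [hs, min_eq_right]
      exact Finset.sum_le_sum_of_subset_of_nonneg
        (fun x hx => by simpa using h (by simpa using hx)) fun _ _ _ => stdSimplex.zero_le _ _
  refine stdSimplex.ext (eq_of_sum_le_eq fun y => ?_)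
  exact (key θ w t y).trans ((by rw [h1, h2]) : _ = _) |>.trans (key θ' w' t' y).symm

/-- The lexicographic pairing of two monotone maps. -/
def lexPair {X P Q : Type} [Preorder X] [PartialOrder P] [Preorder Q]
    (θ : X →o P) (w : X →o Q) : X →o P ×ₗ Q :=
  ⟨fun x => toLex (θ x, w x), fun _ _ h => Prod.Lex.toLex_mono ⟨θ.monotone h, w.monotone h⟩⟩

theorem map_lexPair_eq {X Y P Q : Type} [LinearOrder X] [LinearOrder Y] [PartialOrder P]
    [PartialOrder Q] [Fintype X] [Fintype Y] [Fintype P] [Fintype Q]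
    (θ : X →o P) (w : X →o Q) (θ' : Y →o P) (w' : Y →o Q)
    {t : stdSimplex ℝ X} {t' : stdSimplex ℝ Y}
    (h1 : stdSimplex.map θ t = stdSimplex.map θ' t')
    (h2 : stdSimplex.map w t = stdSimplex.map w' t') :
    stdSimplex.map (lexPair θ w) t = stdSimplex.map (lexPair θ' w') t' := by
  have := congrArg (stdSimplex.map (toLex : P × Q → P ×ₗ Q)) (map_prod_eq θ w θ' w' h1 h2)
  rw [stdSimplex.map_comp_apply, stdSimplex.map_comp_apply] at this
  exact this

/-- A nondegenerate representative of a point of a product of simplices. -/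
theorem exists_prod_support {P Q : Type} [LinearOrder P] [LinearOrder Q]
    [Fintype P] [Fintype Q] {r : ℕ} (θ : Fin (r + 1) →o P) (w : Fin (r + 1) →o Q)
    (t : stdSimplex ℝ (Fin (r + 1))) :
    ∃ (k : ℕ) (θ₀ : Fin (k + 1) →o P) (w₀ : Fin (k + 1) →o Q) (s : stdSimplex ℝ (Fin (k + 1))),
      stdSimplex.map θ₀ s = stdSimplex.map θ t ∧ stdSimplex.map w₀ s = stdSimplex.map w t ∧
      ∀ {r' : ℕ} (θ' : Fin (r' + 1) →o P) (w' : Fin (r' + 1) →o Q)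
        (t' : stdSimplex ℝ (Fin (r' + 1))), (∀ i, 0 < t' i) →
        stdSimplex.map θ' t' = stdSimplex.map θ t → stdSimplex.map w' t' = stdSimplex.map w t →
        ∃ κ : Fin (r' + 1) →o Fin (k + 1), θ₀.comp κ = θ' ∧ w₀.comp κ = w' ∧
          stdSimplex.map κ t' = s := by
  classical
  obtain ⟨r₁, ρ, t₁, rfl, ht₁⟩ := exists_support t
  obtain ⟨θ₁, hθ₁⟩ : ∃ θ₁, θ₁ = θ.comp ρ.toOrderHom := ⟨_, rfl⟩
  obtain ⟨w₁, hw₁⟩ : ∃ w₁, w₁ = w.comp ρ.toOrderHom := ⟨_, rfl⟩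
  have e1 : stdSimplex.map θ₁ t₁ = stdSimplex.map θ (stdSimplex.map ρ t₁) := by
    rw [stdSimplex.map_comp_apply, hθ₁]
    rfl
  have e2 : stdSimplex.map w₁ t₁ = stdSimplex.map w (stdSimplex.map ρ t₁) := by
    rw [stdSimplex.map_comp_apply, hw₁]
    rfl
  -- The lexicographic order on P × Q is linear and refines the product order, so the support of a
  -- point of the product becomes a genuine simplex α.
  obtain ⟨k, α, s, hs, hpos⟩ := exists_support (stdSimplex.map (lexPair θ₁ w₁) t₁)
  have fac : ∀ {r' : ℕ} (θ' : Fin (r' + 1) →o P) (w' : Fin (r' + 1) →o Q)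
      (t' : stdSimplex ℝ (Fin (r' + 1))), (∀ i, 0 < t' i) →
      stdSimplex.map θ' t' = stdSimplex.map θ₁ t₁ → stdSimplex.map w' t' = stdSimplex.map w₁ t₁ →
      ∃ κ : Fin (r' + 1) →o Fin (k + 1), (∀ x, α (κ x) = lexPair θ' w' x) ∧
        stdSimplex.map κ t' = s := by
    intro r' θ' w' t' ht' h1 h2
    have h := (map_lexPair_eq _ _ _ _ h1 h2).trans hs.symm
    obtain ⟨κ, hκ⟩ := exists_factor_of_pos (lexPair θ' w') α ht' h
    refine ⟨κ, hκ, map_stdSimplex_injective α.injective ?_⟩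
    rw [← h, stdSimplex.map_comp_apply]
    exact congrArg (fun f => stdSimplex.map f t') (funext hκ)
  obtain ⟨κ₁, hκ₁, hs₁⟩ := fac θ₁ w₁ t₁ ht₁ rfl rfl
  have hsurj : Function.Surjective κ₁ := by
    intro i
    by_contra h
    have := map_apply_of_notMem_range (f := κ₁) t₁ (y := i) (by simpa using h)
    rw [hs₁] at this
    exact (hpos i).ne' this
  -- A lexicographic chain need not be monotone in the second coordinate. This one is, being the
  -- image of a chain of the product under the surjection κ₁.
  have hmono : ∀ i j : Fin (k + 1), i ≤ j → ∃ x y, κ₁ x = i ∧ κ₁ y = j ∧ x ≤ y := by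
    intro i j hij
    obtain ⟨x, rfl⟩ := hsurj i
    obtain ⟨y, rfl⟩ := hsurj j
    rcases le_total x y with h | h
    · exact ⟨x, y, rfl, rfl, h⟩
    · exact ⟨x, x, rfl, hij.antisymm (κ₁.monotone h), le_rfl⟩
  let θ₀ : Fin (k + 1) →o P := ⟨fun i => (ofLex (α i)).1, fun i j hij => by
    obtain ⟨x, y, rfl, rfl, h⟩ := hmono i j hij
    simp only [hκ₁]
    exact θ₁.monotone h⟩
  let w₀ : Fin (k + 1) →o Q := ⟨fun i => (ofLex (α i)).2, fun i j hij => by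
    obtain ⟨x, y, rfl, rfl, h⟩ := hmono i j hij
    simp only [hκ₁]
    exact w₁.monotone h⟩
  have comp1 : ∀ {r' : ℕ} (θ' : Fin (r' + 1) →o P) (w' : Fin (r' + 1) →o Q)
      (κ : Fin (r' + 1) →o Fin (k + 1)), (∀ x, α (κ x) = lexPair θ' w' x) →
      θ₀.comp κ = θ' ∧ w₀.comp κ = w' := by
    intro r' θ' w' κ hκ
    constructor
    · ext x : 2
      exact congrArg (fun z => (ofLex z).1) (hκ x)
    · ext x : 2
      exact congrArg (fun z => (ofLex z).2) (hκ x)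
  refine ⟨k, θ₀, w₀, s, ?_, ?_, ?_⟩
  · rw [← e1, ← hs₁, stdSimplex.map_comp_apply, ← (comp1 θ₁ w₁ κ₁ hκ₁).1]
    rfl
  · rw [← e2, ← hs₁, stdSimplex.map_comp_apply, ← (comp1 θ₁ w₁ κ₁ hκ₁).2]
    rfl
  · intro r' θ' w' t' ht' h1 h2
    obtain ⟨κ, hκ, h⟩ := fac θ' w' t' ht' (h1.trans e1.symm) (h2.trans e2.symm)
    exact ⟨κ, (comp1 θ' w' κ hκ).1, (comp1 θ' w' κ hκ).2, h⟩

/-- A family of functions on the simplices of a product of two simplices which is natural with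
respect to restriction depends only on the point of the product. -/
theorem natural_prism_eq {Z : Type*} {P Q : Type} [LinearOrder P] [LinearOrder Q]
    [Fintype P] [Fintype Q]
    (V : ∀ (r : ℕ), (Fin (r + 1) →o P) → (Fin (r + 1) →o Q) → stdSimplex ℝ (Fin (r + 1)) → Z)
    (hV : ∀ {r r' : ℕ} (ρ : Fin (r' + 1) →o Fin (r + 1)) θ w t,
      V r' (θ.comp ρ) (w.comp ρ) t = V r θ w (stdSimplex.map ρ t))
    {r r' : ℕ} (θ : Fin (r + 1) →o P) (w : Fin (r + 1) →o Q) (t : stdSimplex ℝ (Fin (r + 1)))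
    (θ' : Fin (r' + 1) →o P) (w' : Fin (r' + 1) →o Q) (t' : stdSimplex ℝ (Fin (r' + 1)))
    (h1 : stdSimplex.map θ t = stdSimplex.map θ' t')
    (h2 : stdSimplex.map w t = stdSimplex.map w' t') : V r θ w t = V r' θ' w' t' := by
  obtain ⟨k, θ₀, w₀, s, e1, e2, h⟩ := exists_prod_support θ w t
  have key : ∀ {r' : ℕ} (θ' : Fin (r' + 1) →o P) (w' : Fin (r' + 1) →o Q)
      (t' : stdSimplex ℝ (Fin (r' + 1))), stdSimplex.map θ t = stdSimplex.map θ' t' →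
      stdSimplex.map w t = stdSimplex.map w' t' → V r' θ' w' t' = V k θ₀ w₀ s := by
    intro r' θ' w' t' h1 h2
    -- Discarding the zero weights makes the representative factor through the common nondegenerate
    -- simplex.
    obtain ⟨m, ρ, t'', rfl, hpos⟩ := exists_support t'
    obtain ⟨κ, h3, h4, h5⟩ := h (θ'.comp ρ.toOrderHom) (w'.comp ρ.toOrderHom) t'' hpos
      (by rw [h1, stdSimplex.map_comp_apply]; rfl) (by rw [h2, stdSimplex.map_comp_apply]; rfl)
    rw [← h5, ← hV κ, h3, h4]
    exact (hV ρ.toOrderHom θ' w' t'').symm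
  rw [key θ w t rfl rfl, key θ' w' t' h1 h2]

end Prism

/-! ### Maps out of prisms -/

section PrismMap

/-- The monotone map to `{0, 1}` with value `0` on the first `k` elements. -/
def step (n k : ℕ) : Fin n →o Fin 2 :=
  ⟨fun i => if i < k then 0 else 1, fun i j h => by
    have h : (i : ℕ) ≤ j := h
    dsimp only
    split_ifs
    exacts [le_rfl, Fin.zero_le _, by omega, le_rfl]⟩

theorem step_apply (n k : ℕ) (i : Fin n) : step n k i = if (i : ℕ) < k then 0 else 1 := rfl

/-- The `j`-th degeneracy. -/
def collapse (q : ℕ) (j : Fin (q + 1)) : Fin (q + 1 + 1) →o Fin (q + 1) :=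
  ⟨fun k => ⟨if (k : ℕ) ≤ j then k else k - 1, by split_ifs <;> omega⟩, fun i k h => by
    have h : (i : ℕ) ≤ k := h
    change (if (i : ℕ) ≤ j then (i : ℕ) else i - 1) ≤ (if (k : ℕ) ≤ j then (k : ℕ) else k - 1)
    split_ifs <;> omega⟩

theorem ext_stdSimplex_two {s t : stdSimplex ℝ (Fin 2)} (h : s 0 = t 0) : s = t := by
  refine stdSimplex.ext (funext fun i => ?_)
  have h1 := stdSimplex.sum_eq_one s
  have h2 := stdSimplex.sum_eq_one t
  rw [Fin.sum_univ_two] at h1 h2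
  fin_cases i
  · exact h
  · change s 1 = t 1
    linarith

/-- The simplices `collapse q j`, `step (q + 2) (j + 1)` cover the prism. -/
theorem exists_prism_point {q : ℕ} (u : stdSimplex ℝ (Fin (q + 1))) (v : stdSimplex ℝ (Fin 2)) :
    ∃ (j : Fin (q + 1)) (t : stdSimplex ℝ (Fin (q + 1 + 1))),
      stdSimplex.map (collapse q j) t = u ∧ stdSimplex.map (step (q + 1 + 1) (j + 1)) t = v := by
  -- Here a k is the sum of the first k coordinates of u. The simplex number j consists of the (u,
  -- v) with a j ≤ v 0 ≤ a (j + 1).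
  set a : ℕ → ℝ := fun k => stdSimplex.map (step (q + 1) k) u 0 with ha
  have h0 : a 0 = 0 := by
    refine map_apply_of_notMem_range u ?_
    rintro ⟨i, hi⟩
    simp [step_apply] at hi
  have h1 : a (q + 1) = 1 := by
    have : stdSimplex.map (step (q + 1) (q + 1)) u 1 = 0 := by
      refine map_apply_of_notMem_range u ?_
      rintro ⟨i, hi⟩
      simp [step_apply] at hi
      omega
    have h := stdSimplex.sum_eq_one (stdSimplex.map (step (q + 1) (q + 1)) u)
    rw [Fin.sum_univ_two, this, add_zero] at h
    exact h
  have hv0 := stdSimplex.zero_le v 0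
  have hv1 := stdSimplex.le_one v 0
  obtain ⟨j, hj1, hj2⟩ : ∃ j : Fin (q + 1), a j ≤ v 0 ∧ v 0 ≤ a (j + 1) := by
    by_contra! h
    have : ∀ k, k ≤ q + 1 → a k ≤ v 0 := by
      intro k
      induction k with
      | zero => intro _; rw [h0]; exact hv0
      | succ k ih => intro hk; exact (h ⟨k, by omega⟩ (ih (by omega))).le
    exact absurd (h ⟨q, by omega⟩ (this q (by omega))) (by
      change ¬ a (q + 1) < v 0
      rw [h1]
      exact not_lt.2 hv1)
  -- Lifts u to height a k: the first k vertices go to the bottom of the prism and the others to the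
  -- top. For k = j and k = j + 1 both lifts lie in the simplex number j.
  let f (k : ℕ) (i : Fin (q + 1)) : Fin (q + 1 + 1) := if (i : ℕ) < k then i.castSucc else i.succ
  have hf : ∀ k, k = (j : ℕ) ∨ k = j + 1 → ∀ i, collapse q j (f k i) = i := by
    intro k hk i
    apply Fin.ext
    change (if (f k i : ℕ) ≤ j then (f k i : ℕ) else f k i - 1) = i
    dsimp only [f]
    split_ifs <;> simp_all <;> omega
  have hf2 : ∀ k, k = (j : ℕ) ∨ k = j + 1 → ∀ i, step (q + 1 + 1) (j + 1) (f k i) = step (q + 1) k i := by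
    intro k hk i
    rw [step_apply, step_apply]
    dsimp only [f]
    split_ifs <;> simp_all <;> omega
  have hmap : ∀ k, k = (j : ℕ) ∨ k = j + 1 →
      stdSimplex.map (collapse q j) (stdSimplex.map (f k) u) = u ∧
      stdSimplex.map (step (q + 1 + 1) (j + 1)) (stdSimplex.map (f k) u) =
        stdSimplex.map (step (q + 1) k) u := by
    intro k hk
    rw [stdSimplex.map_comp_apply, stdSimplex.map_comp_apply]
    constructor
    · have : (collapse q j : _ → _).comp (f k) = id := funext (hf k hk)
      rw [this, stdSimplex.map_id_apply]
    · exact congrArg (fun g => stdSimplex.map g u) (funext (hf2 k hk))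
  -- Between these two lifts the height varies linearly over u, so it takes the value v 0.
  obtain ⟨s, hs⟩ : ∃ s : I, (1 - (s : ℝ)) * a j + s * a (j + 1) = v 0 := by
    have hc : ContinuousOn (fun s : ℝ => (1 - s) * a j + s * a (j + 1)) (Set.Icc 0 1) := by fun_prop
    obtain ⟨s, hs, h⟩ := intermediate_value_Icc zero_le_one hc
      (show v 0 ∈ _ from ⟨by simpa using hj1, by simpa using hj2⟩)
    exact ⟨⟨s, hs⟩, h⟩
  refine ⟨j, mix s (stdSimplex.map (f j) u) (stdSimplex.map (f (j + 1)) u), ?_, ?_⟩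
  · rw [map_mix, (hmap _ (.inl rfl)).1, (hmap _ (.inr rfl)).1, mix_self]
  · apply ext_stdSimplex_two
    rw [map_mix, (hmap _ (.inl rfl)).2, (hmap _ (.inr rfl)).2, mix_apply, ← hs]

/-- Maps out of a prism can be defined on its simplices. -/
theorem exists_prism {Z : Type*} [TopologicalSpace Z] {q : ℕ}
    (V : ∀ r : ℕ, (Fin (r + 1) →o Fin (q + 1)) → (Fin (r + 1) →o Fin 2) →
      C(stdSimplex ℝ (Fin (r + 1)), Z))
    (hV : ∀ {r r' : ℕ} (ρ : Fin (r' + 1) →o Fin (r + 1)) θ w t,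
      V r' (θ.comp ρ) (w.comp ρ) t = V r θ w (stdSimplex.map ρ t)) :
    ∃ f : C(stdSimplex ℝ (Fin (q + 1)) × stdSimplex ℝ (Fin 2), Z),
      ∀ (r : ℕ) (θ : Fin (r + 1) →o Fin (q + 1)) (w : Fin (r + 1) →o Fin 2) t,
      f (stdSimplex.map θ t, stdSimplex.map w t) = V r θ w t := by
  choose j t h1 h2 using fun p : stdSimplex ℝ (Fin (q + 1)) × stdSimplex ℝ (Fin 2) =>
    exists_prism_point p.1 p.2
  obtain ⟨f, hf⟩ : ∃ f : stdSimplex ℝ (Fin (q + 1)) × stdSimplex ℝ (Fin 2) → Z,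
      ∀ (r : ℕ) (θ : Fin (r + 1) →o Fin (q + 1)) (w : Fin (r + 1) →o Fin 2) t,
        f (stdSimplex.map θ t, stdSimplex.map w t) = V r θ w t := by
    refine ⟨fun p => V (q + 1) (collapse q (j p)) (step (q + 1 + 1) (j p + 1)) (t p), fun r θ w t => ?_⟩
    have a1 := h1 (stdSimplex.map θ t, stdSimplex.map w t)
    have a2 := h2 (stdSimplex.map θ t, stdSimplex.map w t)
    exact natural_prism_eq (fun r θ w t => V r θ w t) hV _ _ _ _ _ _ a1 a2
  let e : Fin (q + 1) × stdSimplex ℝ (Fin (q + 1 + 1)) →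
      stdSimplex ℝ (Fin (q + 1)) × stdSimplex ℝ (Fin 2) := fun p =>
    (stdSimplex.map (collapse q p.1) p.2, stdSimplex.map (step (q + 1 + 1) (p.1 + 1)) p.2)
  have he : Continuous e := continuous_prod_of_discrete_left.2 fun i =>
    (stdSimplex.continuous_map (collapse q i)).prodMk
      (stdSimplex.continuous_map (step (q + 1 + 1) (i + 1)))
  -- A continuous surjection from a compact space to a Hausdorff space. Continuity can therefore be
  -- checked on the q + 1 simplices of the prism.
  have hq : Topology.IsQuotientMap e := by
    refine he.isClosedMap.isQuotientMap he fun p => ⟨(j p, t p), ?_⟩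
    exact Prod.ext (h1 p) (h2 p)
  have hfe : Continuous (f ∘ e) := by
    refine continuous_prod_of_discrete_left.2 fun i => ?_
    have h := (V (q + 1) (collapse q i) (step (q + 1 + 1) (i + 1))).continuous
    rw [← funext (hf (q + 1) (collapse q i) (step (q + 1 + 1) (i + 1)))] at h
    exact h
  exact ⟨⟨f, hq.continuous_iff.2 hfe⟩, hf⟩

end PrismMap

/-! ### Homotopies of nerves from natural transformations -/

section NerveHomotopy

variable {A B : Type u} [Category.{v} A] [Category.{v} B] {F G : A ⥤ B}

/-- The functor on `[1] × A` given by a natural transformation of functors on `A`. -/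
def cylinderFunctor (ε : F ⟶ G) : Fin 2 × A ⥤ B :=
  Functor.uncurry.obj (ComposableArrows.mk₁ ε)

/-- The image of a simplex of a prism over a simplex of the nerve of `A`. -/
def prismSimplex (ε : F ⟶ G) {q r : ℕ} (τ : Fin (q + 1) ⥤ A) (θ : Fin (r + 1) →o Fin (q + 1))
    (w : Fin (r + 1) →o Fin 2) : Fin (r + 1) ⥤ B :=
  (w.monotone.functor.prod' (θ.monotone.functor ⋙ τ)) ⋙ cylinderFunctor ε

theorem cylinderFunctor_map_zero (ε : F ⟶ G) {a b : A} (f : ((0, a) : Fin 2 × A) ⟶ (0, b)) :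
    (cylinderFunctor ε).map f = F.map f.2 := by
  have h : f.1 = 𝟙 0 := Subsingleton.elim _ _
  change ((ComposableArrows.mk₁ ε).map f.1).app a ≫ F.map f.2 = F.map f.2
  rw [h, CategoryTheory.Functor.map_id]
  exact Category.id_comp _

theorem cylinderFunctor_map_one (ε : F ⟶ G) {a b : A} (f : ((1, a) : Fin 2 × A) ⟶ (1, b)) :
    (cylinderFunctor ε).map f = G.map f.2 := by
  have h : f.1 = 𝟙 1 := Subsingleton.elim _ _
  change ((ComposableArrows.mk₁ ε).map f.1).app a ≫ G.map f.2 = G.map f.2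
  rw [h, CategoryTheory.Functor.map_id]
  exact Category.id_comp _

theorem cylinderFunctor_map_zero_one (ε : F ⟶ G) {a b : A} (f : ((0, a) : Fin 2 × A) ⟶ (1, b)) :
    (cylinderFunctor ε).map f = ε.app a ≫ G.map f.2 := by
  have h : f.1 = homOfLE zero_le_one := Subsingleton.elim _ _
  change ((ComposableArrows.mk₁ ε).map f.1).app a ≫ G.map f.2 = ε.app a ≫ G.map f.2
  rw [h]
  rfl

theorem prismSimplex_zero (ε : F ⟶ G) {q : ℕ} (τ : Fin (q + 1) ⥤ A) :
    prismSimplex ε τ OrderHom.id (OrderHom.const _ 0) = τ ⋙ F :=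
  CategoryTheory.Functor.hext (fun _ => rfl) fun _ _ _ =>
    heq_of_eq (cylinderFunctor_map_zero ε _)

theorem prismSimplex_one (ε : F ⟶ G) {q : ℕ} (τ : Fin (q + 1) ⥤ A) :
    prismSimplex ε τ OrderHom.id (OrderHom.const _ 1) = τ ⋙ G :=
  CategoryTheory.Functor.hext (fun _ => rfl) fun _ _ _ =>
    heq_of_eq (cylinderFunctor_map_one ε _)

/-- The hypothesis says that the two transformations agree after applying K. On cylinders this
becomes an equality of functors, not merely a homotopy. -/
theorem cylinderFunctor_comp {K : A ⥤ B} {L : B ⥤ A} (ε : K ⋙ L ⟶ 𝟭 A) (ε' : L ⋙ K ⟶ 𝟭 B)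
    (h : ∀ a, K.map (ε.app a) = ε'.app (K.obj a)) :
    cylinderFunctor ε ⋙ K = (𝟭 (Fin 2)).prod K ⋙ cylinderFunctor ε' := by
  refine CategoryTheory.Functor.hext (fun ⟨i, a⟩ => ?_) fun ⟨i, a⟩ ⟨j, b⟩ f => ?_
  · fin_cases i <;> rfl
  · have hij := leOfHom f.1
    fin_cases i <;> fin_cases j
    · refine heq_of_eq ?_
      refine (congrArg K.map (cylinderFunctor_map_zero ε f)).trans ?_
      exact (cylinderFunctor_map_zero ε' (a := K.obj a) (b := K.obj b) (f.1, K.map f.2)).symm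
    · refine heq_of_eq ?_
      refine (congrArg K.map (cylinderFunctor_map_zero_one ε f)).trans ?_
      refine Eq.trans ?_
        (cylinderFunctor_map_zero_one ε' (a := K.obj a) (b := K.obj b) (f.1, K.map f.2)).symm
      exact (K.map_comp (ε.app a) ((𝟭 A).map f.2)).trans (congrArg (fun g => g ≫ K.map f.2) (h a))
    · exact absurd hij (by simp)
    · refine heq_of_eq ?_
      refine (congrArg K.map (cylinderFunctor_map_one ε f)).trans ?_
      exact (cylinderFunctor_map_one ε' (a := K.obj a) (b := K.obj b) (f.1, K.map f.2)).symm

theorem prismSimplex_comp {K : A ⥤ B} {L : B ⥤ A} (ε : K ⋙ L ⟶ 𝟭 A) (ε' : L ⋙ K ⟶ 𝟭 B)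
    (h : ∀ a, K.map (ε.app a) = ε'.app (K.obj a)) {q r : ℕ} (τ : Fin (q + 1) ⥤ A)
    (θ : Fin (r + 1) →o Fin (q + 1)) (w : Fin (r + 1) →o Fin 2) :
    prismSimplex ε τ θ w ⋙ K = prismSimplex ε' (τ ⋙ K) θ w :=
  congrArg (fun F => w.monotone.functor.prod' (θ.monotone.functor ⋙ τ) ⋙ F)
    (cylinderFunctor_comp ε ε' h)

/-- The homotopy is recorded on every simplex of each prism rather than only at its ends, so that
equations between homotopies can later be checked simplex by simplex. -/
theorem exists_prism_cell (ε : F ⟶ G) :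
    ∃ H : C(SSet.toTop.obj (nerve A) × I, SSet.toTop.obj (nerve B)),
      ∀ (q r : ℕ) (τ : Fin (q + 1) ⥤ A) (θ : Fin (r + 1) →o Fin (q + 1))
        (w : Fin (r + 1) →o Fin 2) (t : stdSimplex ℝ (Fin (r + 1))),
        H (cell (q := ⦋q⦌) (nerve A) τ (stdSimplex.map θ t),
          stdSimplexHomeomorphUnitInterval (stdSimplex.map w t)) =
        cell (q := ⦋r⦌) (nerve B) (prismSimplex ε τ θ w) t := by
  have hP : ∀ (q : ℕ) (τ : Fin (q + 1) ⥤ A),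
      ∃ f : C(stdSimplex ℝ (Fin (q + 1)) × stdSimplex ℝ (Fin 2), SSet.toTop.obj (nerve B)),
      ∀ (r : ℕ) (θ : Fin (r + 1) →o Fin (q + 1)) (w : Fin (r + 1) →o Fin 2) t,
        f (stdSimplex.map θ t, stdSimplex.map w t) =
          cell (q := ⦋r⦌) (nerve B) (prismSimplex ε τ θ w) t := by
    intro q τ
    refine exists_prism (fun r θ w => cell (q := ⦋r⦌) (nerve B) (prismSimplex ε τ θ w)) ?_
    intro r r' ρ θ w t
    exact cell_map (K := nerve B) (toHom ρ : ⦋r'⦌ ⟶ ⦋r⦌) (prismSimplex ε τ θ w) t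
  choose f hf using hP
  let φ (q : SimplexCategory) (τ : (nerve A).obj (op q)) :
      C(stdSimplex ℝ (Fin (q.len + 1)), C(I, SSet.toTop.obj (nerve B))) :=
    ContinuousMap.curry ((f q.len τ).comp ((ContinuousMap.id _).prodMap
      ⟨stdSimplexHomeomorphUnitInterval.symm, stdSimplexHomeomorphUnitInterval.symm.continuous⟩))
  obtain ⟨H, hH⟩ := exists_desc (K := nerve A) (TopCat.of C(I, SSet.toTop.obj (nerve B))) φ (by
    intro p q β τ u
    ext s
    change f p.len ((nerve A).map β.op τ) (u, stdSimplexHomeomorphUnitInterval.symm s) =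
      f q.len τ (stdSimplex.map β u, stdSimplexHomeomorphUnitInterval.symm s)
    -- Every point of the prism lies in one of its simplices, on which both maps are given by the
    -- same simplex of the nerve of B.
    obtain ⟨j, t, h1, h2⟩ := exists_prism_point u (stdSimplexHomeomorphUnitInterval.symm s)
    rw [← h1, ← h2, stdSimplex.map_comp_apply]
    exact (hf p.len _ _ (collapse p.len j) (step _ (j + 1)) t).trans
      (hf q.len τ _ (β.toOrderHom.comp (collapse p.len j)) (step _ (j + 1)) t).symm)
  refine ⟨⟨fun p => (H p.1 : C(I, SSet.toTop.obj (nerve B))) p.2,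
    ContinuousMap.continuous_uncurry_of_continuous H⟩, fun q r τ θ w t => ?_⟩
  have := hH ⦋q⦌ τ (stdSimplex.map θ t)
  have h2 := congrArg (fun g : C(I, SSet.toTop.obj (nerve B)) =>
    g (stdSimplexHomeomorphUnitInterval (stdSimplex.map w t))) this
  refine h2.trans ?_
  change f q τ (stdSimplex.map θ t, stdSimplexHomeomorphUnitInterval.symm
    (stdSimplexHomeomorphUnitInterval (stdSimplex.map w t))) = _
  rw [Homeomorph.symm_apply_apply, hf]

theorem map_const_stdSimplex {X : Type} [Fintype X] (i : Fin 2) (t : stdSimplex ℝ X) :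
    stdSimplex.map (fun _ => i) t = ⟨_, single_mem_stdSimplex ℝ i⟩ := by
  refine stdSimplex.ext (funext fun j => ?_)
  rw [map_stdSimplex_apply]
  by_cases h : i = j
  · subst h
    simp
  · simp [h, Ne.symm h]

/-- A natural transformation induces a homotopy of maps of classifying spaces. -/
theorem exists_nerve_homotopy (ε : F ⟶ G) :
    ∃ H : C(SSet.toTop.obj (nerve A) × I, SSet.toTop.obj (nerve B)),
      (∀ x, H (x, 0) = SSet.toTop.map (nerveMap F) x) ∧
      (∀ x, H (x, 1) = SSet.toTop.map (nerveMap G) x) ∧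
      ∀ (q r : ℕ) (τ : Fin (q + 1) ⥤ A) (θ : Fin (r + 1) →o Fin (q + 1))
        (w : Fin (r + 1) →o Fin 2) (t : stdSimplex ℝ (Fin (r + 1))),
        H (cell (q := ⦋q⦌) (nerve A) τ (stdSimplex.map θ t),
          stdSimplexHomeomorphUnitInterval (stdSimplex.map w t)) =
        cell (q := ⦋r⦌) (nerve B) (prismSimplex ε τ θ w) t := by
  obtain ⟨H, hH⟩ := exists_prism_cell ε
  have key : ∀ (i : Fin 2) (q : SimplexCategory) (τ : (nerve A).obj (op q)) u,
      H (cell (nerve A) τ u, stdSimplexHomeomorphUnitInterval ⟨_, single_mem_stdSimplex ℝ i⟩) =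
      cell (q := q) (nerve B) (prismSimplex ε τ OrderHom.id (OrderHom.const _ i)) u := by
    intro i q τ u
    have h := hH q.len q.len τ OrderHom.id (OrderHom.const _ i) u
    have h1 : stdSimplex.map (OrderHom.id (α := Fin (q.len + 1))) u = u :=
      stdSimplex.map_id_apply u
    have h2 : stdSimplex.map (OrderHom.const (Fin (q.len + 1)) i) u =
      ⟨_, single_mem_stdSimplex ℝ i⟩ := map_const_stdSimplex i u
    rw [h1, h2] at h
    exact h
  refine ⟨H, fun x => ?_, fun x => ?_, hH⟩
  · obtain ⟨q, τ, u, rfl⟩ := exists_cell x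
    refine (key 0 q τ u).trans ?_
    refine Eq.trans ?_ (map_cell (nerveMap F) τ u).symm
    exact congrArg (fun z => cell (q := q) (nerve B) z u) (prismSimplex_zero ε τ)
  · obtain ⟨q, τ, u, rfl⟩ := exists_cell x
    refine (key 1 q τ u).trans ?_
    refine Eq.trans ?_ (map_cell (nerveMap G) τ u).symm
    exact congrArg (fun z => cell (q := q) (nerve B) z u) (prismSimplex_one ε τ)

/-- The transformations supply the two homotopies, and the strict identity between them becomes the
compatibility condition. -/
theorem nonempty_compatibleInverse_nerve {K : A ⥤ B} {L : B ⥤ A} (ε : K ⋙ L ⟶ 𝟭 A)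
    (ε' : L ⋙ K ⟶ 𝟭 B) (h : ∀ a, K.map (ε.app a) = ε'.app (K.obj a)) :
    Nonempty (CompatibleInverse (SSet.toTop.map (nerveMap K)).hom) := by
  obtain ⟨H, h0, h1, hH⟩ := exists_nerve_homotopy ε
  obtain ⟨H', h0', h1', hH'⟩ := exists_nerve_homotopy ε'
  refine ⟨⟨(SSet.toTop.map (nerveMap L)).hom, H, H', fun x => ?_, fun x => ?_, fun y => ?_,
    fun y => ?_, fun x s => ?_⟩⟩
  · refine (h0 x).trans ?_
    obtain ⟨q, τ, u, rfl⟩ := exists_cell x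
    refine (map_cell (nerveMap (K ⋙ L)) τ u).trans ?_
    refine Eq.trans ?_ (congrArg (SSet.toTop.map (nerveMap L)) (map_cell (nerveMap K) τ u)).symm
    exact (map_cell (nerveMap L) ((nerveMap K).app (op q) τ) u).symm
  · refine (h1 x).trans ?_
    obtain ⟨q, τ, u, rfl⟩ := exists_cell x
    exact map_cell (nerveMap (𝟭 A)) τ u
  · refine (h0' y).trans ?_
    obtain ⟨q, τ, u, rfl⟩ := exists_cell y
    refine (map_cell (nerveMap (L ⋙ K)) τ u).trans ?_
    refine Eq.trans ?_ (congrArg (SSet.toTop.map (nerveMap K)) (map_cell (nerveMap L) τ u)).symm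
    exact (map_cell (nerveMap K) ((nerveMap L).app (op q) τ) u).symm
  · refine (h1' y).trans ?_
    obtain ⟨q, τ, u, rfl⟩ := exists_cell y
    exact map_cell (nerveMap (𝟭 B)) τ u
  · obtain ⟨q, τ, u, rfl⟩ := exists_cell x
    obtain ⟨j, t, e1, e2⟩ := exists_prism_point u (stdSimplexHomeomorphUnitInterval.symm s)
    have e3 : s = stdSimplexHomeomorphUnitInterval
        (stdSimplex.map (step (q.len + 1 + 1) (j + 1)) t) := by
      rw [e2, Homeomorph.apply_symm_apply]
    rw [← e1, e3]
    have a1 := hH q.len _ τ (collapse q.len j) (step (q.len + 1 + 1) (j + 1)) t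
    have a2 := hH' q.len _ (τ ⋙ K) (collapse q.len j) (step (q.len + 1 + 1) (j + 1)) t
    have a3 := map_cell (nerveMap K) (q := ⦋q.len + 1⦌)
      (prismSimplex ε τ (collapse q.len j) (step (q.len + 1 + 1) (j + 1))) t
    have a4 := map_cell (nerveMap K) (q := q) τ (stdSimplex.map (collapse q.len j) t)
    refine (congrArg (SSet.toTop.map (nerveMap K)) a1).trans (a3.trans ?_)
    refine Eq.trans ?_ (congrArg (fun z => H' (z, _)) a4.symm)
    refine Eq.trans ?_ a2.symm
    exact congrArg (fun z => cell (q := ⦋q.len + 1⦌) (nerve B) z t)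
      (prismSimplex_comp ε ε' h τ (collapse q.len j) (step (q.len + 1 + 1) (j + 1)))

end NerveHomotopy

/-! ### Zigzags and the functors on twisted arrow categories generated by them -/

section Zigzag

/-- A zigzag `c₀ ⟶ d₀ ⟵ c₁ ⟶ d₁ ⟵ ⋯`. -/
structure Zigzag (C : Type u) [Category.{v} C] where
  c : ℕ → C
  d : ℕ → C
  l : ∀ k, c k ⟶ d k
  r : ∀ k, c (k + 1) ⟶ d k

namespace Zigzag

variable {C : Type u} [Category.{v} C]

/-- A morphism of zigzags. -/
@[ext]
structure Hom (D E : Zigzag C) where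
  c : ∀ k, D.c k ⟶ E.c k
  d : ∀ k, D.d k ⟶ E.d k
  l_d : ∀ k, D.l k ≫ d k = c k ≫ E.l k
  r_d : ∀ k, D.r k ≫ d k = c (k + 1) ≫ E.r k

attribute [simp] Hom.l_d Hom.r_d

@[simp]
theorem Hom.l_d_assoc {D E : Zigzag C} (φ : Hom D E) (k : ℕ) {X : C} (f : E.d k ⟶ X) :
    D.l k ≫ φ.d k ≫ f = φ.c k ≫ E.l k ≫ f := by
  rw [← Category.assoc, φ.l_d, Category.assoc]

@[simp]
theorem Hom.r_d_assoc {D E : Zigzag C} (φ : Hom D E) (k : ℕ) {X : C} (f : E.d k ⟶ X) :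
    D.r k ≫ φ.d k ≫ f = φ.c (k + 1) ≫ E.r k ≫ f := by
  rw [← Category.assoc, φ.r_d, Category.assoc]

@[simps]
instance category : Category.{v} (Zigzag C) where
  Hom := Hom
  id D := ⟨fun _ => 𝟙 _, fun _ => 𝟙 _, by simp, by simp⟩
  comp f g := ⟨fun k => f.c k ≫ g.c k, fun k => f.d k ≫ g.d k, by simp, by simp⟩

/-- A cocone under the part of a zigzag which lies over an interval. -/
@[ext]
structure Cocone (D : Zigzag C) (x : Tw ℕ) (X : C) where
  ι : ∀ k, x.src ≤ k → k ≤ x.tgt → (D.c k ⟶ X)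
  κ : ∀ k, x.src ≤ k → k + 1 ≤ x.tgt → (D.d k ⟶ X)
  l_κ : ∀ k h₁ h₂, D.l k ≫ κ k h₁ h₂ = ι k h₁ (by omega)
  r_κ : ∀ k h₁ h₂, D.r k ≫ κ k h₁ h₂ = ι (k + 1) (by omega) h₂

namespace Cocone

variable {D E : Zigzag C} {x y : Tw ℕ} {X Y Z : C}

/-- The restriction of a cocone to a smaller interval. -/
def restrict (f : x ⟶ y) (u : D.Cocone y X) : D.Cocone x X where
  ι k h₁ h₂ := u.ι k ((leOfHom f).1.trans h₁) (h₂.trans (leOfHom f).2)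
  κ k h₁ h₂ := u.κ k ((leOfHom f).1.trans h₁) (h₂.trans (leOfHom f).2)
  l_κ k _ _ := u.l_κ k _ _
  r_κ k _ _ := u.r_κ k _ _

/-- The composition of a cocone with a morphism. -/
@[simps]
def comp (u : D.Cocone x X) (f : X ⟶ Y) : D.Cocone x Y where
  ι k h₁ h₂ := u.ι k h₁ h₂ ≫ f
  κ k h₁ h₂ := u.κ k h₁ h₂ ≫ f
  l_κ k h₁ h₂ := by rw [← u.l_κ k h₁ h₂, Category.assoc]
  r_κ k h₁ h₂ := by rw [← u.r_κ k h₁ h₂, Category.assoc]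

/-- The composition of a morphism of zigzags with a cocone. -/
@[simps]
def pre (φ : D ⟶ E) (u : E.Cocone x X) : D.Cocone x X where
  ι k h₁ h₂ := φ.c k ≫ u.ι k h₁ h₂
  κ k h₁ h₂ := φ.d k ≫ u.κ k h₁ h₂
  l_κ k h₁ h₂ := by rw [← u.l_κ k h₁ h₂, φ.l_d_assoc]
  r_κ k h₁ h₂ := by rw [← u.r_κ k h₁ h₂, φ.r_d_assoc]

theorem comp_comp (u : D.Cocone x X) (f : X ⟶ Y) (g : Y ⟶ Z) :
    u.comp (f ≫ g) = (u.comp f).comp g := by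
  ext <;> simp

theorem comp_id (u : D.Cocone x X) : u.comp (𝟙 X) = u := by
  ext <;> simp

/-- A cocone is universal if it is a colimit cocone. -/
def IsUniversal (u : D.Cocone x X) : Prop :=
  ∀ {Y : C} (v : D.Cocone x Y), ∃! f : X ⟶ Y, u.comp f = v

end Cocone

variable [UnpointedWaldhausenCategory C]

open UnpointedWaldhausenCategory

/-- Induction on the right end: lengthening the interval by one attaches d_j along c_j. This is a
pushout along the cofibration c_j → d_j, hence exists. -/
theorem exists_universal (D : Zigzag C) (hD : ∀ k, cof (D.l k)) (x : Tw ℕ) :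
    ∃ (X : C) (u : D.Cocone x X), u.IsUniversal := by
  obtain ⟨i, j, hij⟩ := x
  induction j, hij using Nat.le_induction with
  | base =>
    refine ⟨D.c i, ⟨fun k h₁ h₂ => eqToHom (congrArg D.c (le_antisymm h₂ h₁)),
      fun _ h₁ h₂ => absurd (h₁.trans_lt (Nat.lt_of_succ_le h₂)) (lt_irrefl _),
      fun _ h₁ h₂ => absurd (h₁.trans_lt (Nat.lt_of_succ_le h₂)) (lt_irrefl _),
      fun _ h₁ h₂ => absurd (h₁.trans_lt (Nat.lt_of_succ_le h₂)) (lt_irrefl _)⟩, fun {Y} v => ?_⟩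
    refine ⟨v.ι i le_rfl le_rfl, ?_, fun g hg => ?_⟩
    · ext k h₁ h₂
      · obtain rfl : k = i := le_antisymm h₂ h₁
        simp
      · exact absurd (h₁.trans_lt (Nat.lt_of_succ_le h₂)) (lt_irrefl _)
    · rw [← hg]
      simp
  | succ j hij ih =>
    obtain ⟨X, u, hu⟩ := ih
    have := hasPushout_of_cof (u.ι j hij le_rfl) (D.l j) (hD j)
    have e1 : ∀ {k}, k ≤ j + 1 → ¬ k ≤ j → k = j + 1 := by intros; omega
    have e2 : ∀ {k}, k + 1 ≤ j + 1 → ¬ k + 1 ≤ j → k = j := by intros; omega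
    -- The new vertex c_{j+1} enters through d_j, along the right-hand map of the zigzag.
    let p : D.Cocone ⟨i, j + 1, hij.trans j.le_succ⟩ (pushout (u.ι j hij le_rfl) (D.l j)) :=
      { ι := fun k h₁ h₂ => if h : k ≤ j then u.ι k h₁ h ≫ pushout.inl _ _ else
          eqToHom (congrArg D.c (e1 h₂ h)) ≫ D.r j ≫ pushout.inr _ _
        κ := fun k h₁ h₂ => if h : k + 1 ≤ j then u.κ k h₁ h ≫ pushout.inl _ _ else
          eqToHom (congrArg D.d (e2 h₂ h)) ≫ pushout.inr _ _
        l_κ := fun k h₁ h₂ => by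
          by_cases h : k + 1 ≤ j
          · have h' : k ≤ j := by omega
            simp only [h, h', dite_true]
            rw [← u.l_κ k h₁ h, Category.assoc]
          · obtain rfl := e2 h₂ h
            simp [pushout.condition]
        r_κ := fun k h₁ h₂ => by
          by_cases h : k + 1 ≤ j
          · simp only [h, dite_true]
            rw [← u.r_κ k h₁ h, Category.assoc]
          · obtain rfl := e2 h₂ h
            simp }
    have hp1 : ∀ k h₁ h₂ (h : k ≤ j), p.ι k h₁ h₂ = u.ι k h₁ h ≫ pushout.inl _ _ :=
      fun k h₁ h₂ h => dif_pos h
    have hp2 : ∀ k h₁ h₂ (h : k + 1 ≤ j), p.κ k h₁ h₂ = u.κ k h₁ h ≫ pushout.inl _ _ :=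
      fun k h₁ h₂ h => dif_pos h
    have hp3 : p.κ j hij le_rfl = pushout.inr _ _ := by
      refine (dif_neg (by simp)).trans ?_
      simp
    refine ⟨_, p, fun {Y} v => ?_⟩
    let r : (⟨i, j, hij⟩ : Tw ℕ) ⟶ ⟨i, j + 1, hij.trans j.le_succ⟩ := Tw.right hij j.le_succ
    obtain ⟨f, hf, hf'⟩ := hu (v.restrict r)
    have hfι : ∀ k h₁ h₂, u.ι k h₁ h₂ ≫ f = v.ι k h₁ (h₂.trans j.le_succ) := fun k h₁ h₂ =>
      congrArg (fun w => w.ι k h₁ h₂) hf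
    have hfκ : ∀ k h₁ h₂, u.κ k h₁ h₂ ≫ f = v.κ k h₁ (h₂.trans j.le_succ) := fun k h₁ h₂ =>
      congrArg (fun w => w.κ k h₁ h₂) hf
    refine ⟨pushout.desc f (v.κ j hij le_rfl) ?_, ?_, fun g hg => ?_⟩
    · rw [hfι, v.l_κ]
    · have hκ : ∀ k h₁ h₂, p.κ k h₁ h₂ ≫ pushout.desc f (v.κ j hij le_rfl) (by
          rw [hfι, v.l_κ]) = v.κ k h₁ h₂ := by
        intro k h₁ h₂
        by_cases h : k + 1 ≤ j
        · rw [hp2 k h₁ h₂ h, Category.assoc, pushout.inl_desc, hfκ]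
        · obtain rfl := e2 h₂ h
          rw [hp3, pushout.inr_desc]
      ext k h₁ h₂
      · change p.ι k h₁ h₂ ≫ _ = _
        by_cases h : k ≤ j
        · rw [hp1 k h₁ h₂ h, Category.assoc, pushout.inl_desc, hfι]
        · obtain rfl := e1 h₂ h
          rw [← p.r_κ j hij le_rfl, Category.assoc, hκ, v.r_κ]
      · exact hκ k h₁ h₂
    · apply pushout.hom_ext
      · rw [pushout.inl_desc]
        apply hf'
        rw [← hg]
        ext k h₁ h₂
        · change u.ι k h₁ h₂ ≫ _ ≫ g = p.ι k h₁ (h₂.trans j.le_succ) ≫ g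
          rw [hp1 k h₁ _ h₂, Category.assoc]
        · change u.κ k h₁ h₂ ≫ _ ≫ g = p.κ k h₁ (h₂.trans j.le_succ) ≫ g
          rw [hp2 k h₁ _ h₂, Category.assoc]
      · rw [pushout.inr_desc, ← hg]
        change _ = p.κ j hij le_rfl ≫ g
        rw [hp3]

end Zigzag

end Zigzag

/-! ### The functor generated by a zigzag -/

namespace Zigzag

section

variable {C : Type u} [Category.{v} C]

/-- The zigzag underlying a functor on a twisted arrow category. -/
def ofFunctor : (Tw ℕ ⥤ C) ⥤ Zigzag C where
  obj F :=
    { c := fun k => F.obj ⟨k, k, le_rfl⟩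
      d := fun k => F.obj ⟨k, k + 1, k.le_succ⟩
      l := fun k => F.map (Tw.right le_rfl k.le_succ)
      r := fun k => F.map (Tw.left k.le_succ le_rfl) }
  map α :=
    { c := fun k => α.app _
      d := fun k => α.app _
      l_d := fun k => α.naturality _
      r_d := fun k => α.naturality _ }

/-- The values of a functor form cocones under the underlying zigzag. -/
def functorCocone (F : Tw ℕ ⥤ C) (x : Tw ℕ) : (ofFunctor.obj F).Cocone x (F.obj x) where
  ι _ h₁ h₂ := F.map (homOfLE ⟨h₁, h₂⟩)
  κ _ h₁ h₂ := F.map (homOfLE ⟨h₁, h₂⟩)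
  l_κ _ _ _ := (F.map_comp _ _).symm
  r_κ _ _ _ := (F.map_comp _ _).symm

theorem functorCocone_comp_map (F : Tw ℕ ⥤ C) {x y : Tw ℕ} (f : x ⟶ y) :
    (functorCocone F x).comp (F.map f) = (functorCocone F y).restrict f := by
  ext k h₁ h₂
  · exact (F.map_comp _ _).symm
  · exact (F.map_comp _ _).symm

theorem comp_app_eq_of_comp_app_eq {J : Type*} [Category J] {G F : J ⥤ C} (α β : G ⟶ F)
    {X : C} {x y : J} {e : X ⟶ G.obj x} (f : x ⟶ y) {e' : X ⟶ G.obj y} (he : e ≫ G.map f = e')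
    (h : e ≫ α.app x = e ≫ β.app x) : e' ≫ α.app y = e' ≫ β.app y := by
  subst he
  rw [Category.assoc, Category.assoc, α.naturality, β.naturality, ← Category.assoc, h,
    Category.assoc]

end

variable {C : Type u} [Category.{v} C] [UnpointedWaldhausenCategory C]

open UnpointedWaldhausenCategory

section

variable (D : Zigzag C) (hD : ∀ k, cof (D.l k))

/-- The colimit of the part of a zigzag which lies over an interval. -/
noncomputable def fillObj (x : Tw ℕ) : C := (exists_universal D hD x).choose

/-- The colimit cocone. -/
noncomputable def fillCocone (x : Tw ℕ) : D.Cocone x (fillObj D hD x) :=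
  (exists_universal D hD x).choose_spec.choose

theorem isUniversal_fillCocone (x : Tw ℕ) : (fillCocone D hD x).IsUniversal :=
  (exists_universal D hD x).choose_spec.choose_spec

/-- The map out of a colimit given by a cocone. -/
noncomputable def desc {x : Tw ℕ} {Y : C} (v : D.Cocone x Y) : fillObj D hD x ⟶ Y :=
  (isUniversal_fillCocone D hD x v).choose

@[simp]
theorem comp_desc {x : Tw ℕ} {Y : C} (v : D.Cocone x Y) :
    (fillCocone D hD x).comp (desc D hD v) = v :=
  (isUniversal_fillCocone D hD x v).choose_spec.1

theorem fill_hom_ext {x : Tw ℕ} {Y : C} {f g : fillObj D hD x ⟶ Y}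
    (h : (fillCocone D hD x).comp f = (fillCocone D hD x).comp g) : f = g :=
  (isUniversal_fillCocone D hD x _).unique h rfl

theorem ι_desc {x : Tw ℕ} {Y : C} (v : D.Cocone x Y) (k : ℕ) (h₁ h₂) :
    (fillCocone D hD x).ι k h₁ h₂ ≫ desc D hD v = v.ι k h₁ h₂ :=
  congrArg (fun w => w.ι k h₁ h₂) (comp_desc D hD v)

theorem κ_desc {x : Tw ℕ} {Y : C} (v : D.Cocone x Y) (k : ℕ) (h₁ h₂) :
    (fillCocone D hD x).κ k h₁ h₂ ≫ desc D hD v = v.κ k h₁ h₂ :=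
  congrArg (fun w => w.κ k h₁ h₂) (comp_desc D hD v)

/-- The functor on the twisted arrow category generated by a zigzag. -/
noncomputable def fill : Tw ℕ ⥤ C where
  obj := fillObj D hD
  map {x y} f := desc D hD ((fillCocone D hD y).restrict f)
  map_id x := fill_hom_ext D hD (by
    rw [comp_desc, Cocone.comp_id]
    rfl)
  map_comp {x y z} f g := fill_hom_ext D hD (by
    rw [Cocone.comp_comp, comp_desc, comp_desc]
    exact congrArg (Cocone.restrict f) (comp_desc D hD ((fillCocone D hD z).restrict g)).symm)

theorem ι_map {x y : Tw ℕ} (f : x ⟶ y) (k : ℕ) (h₁ h₂) :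
    (fillCocone D hD x).ι k h₁ h₂ ≫ (fill D hD).map f =
      (fillCocone D hD y).ι k ((leOfHom f).1.trans h₁) (h₂.trans (leOfHom f).2) :=
  ι_desc D hD _ k h₁ h₂

theorem κ_map {x y : Tw ℕ} (f : x ⟶ y) (k : ℕ) (h₁ h₂) :
    (fillCocone D hD x).κ k h₁ h₂ ≫ (fill D hD).map f =
      (fillCocone D hD y).κ k ((leOfHom f).1.trans h₁) (h₂.trans (leOfHom f).2) :=
  κ_desc D hD _ k h₁ h₂

/-- The comparison of a zigzag with the zigzag underlying the functor it generates. -/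
noncomputable def unit : D ⟶ ofFunctor.obj (fill D hD) where
  c k := (fillCocone D hD ⟨k, k, le_rfl⟩).ι k le_rfl le_rfl
  d k := (fillCocone D hD ⟨k, k + 1, k.le_succ⟩).κ k le_rfl le_rfl
  l_d k := by
    exact (Cocone.l_κ _ k _ _).trans (ι_map D hD _ k le_rfl le_rfl).symm
  r_d k := by
    exact (Cocone.r_κ _ k _ _).trans (ι_map D hD _ (k + 1) le_rfl le_rfl).symm

/-- Over an interval of length 0 the diagram is the single object c_k. -/
theorem isIso_fillCocone_ι (k : ℕ) :
    IsIso ((fillCocone D hD ⟨k, k, le_rfl⟩).ι k le_rfl le_rfl) := by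
  let v : D.Cocone ⟨k, k, le_rfl⟩ (D.c k) :=
    ⟨fun m h₁ h₂ => eqToHom (congrArg D.c (le_antisymm h₂ h₁)),
      fun _ h₁ h₂ => absurd (h₁.trans_lt (Nat.lt_of_succ_le h₂)) (lt_irrefl _),
      fun _ h₁ h₂ => absurd (h₁.trans_lt (Nat.lt_of_succ_le h₂)) (lt_irrefl _),
      fun _ h₁ h₂ => absurd (h₁.trans_lt (Nat.lt_of_succ_le h₂)) (lt_irrefl _)⟩
  have h : (fillCocone D hD ⟨k, k, le_rfl⟩).ι k le_rfl le_rfl ≫ desc D hD v = 𝟙 _ := ι_desc D hD v k le_rfl le_rfl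
  refine ⟨desc D hD v, h, fill_hom_ext D hD ?_⟩
  ext m h₁ h₂
  · obtain rfl : m = k := le_antisymm h₂ h₁
    exact (Category.assoc _ _ _).symm.trans ((congrArg (fun f => f ≫ (fillCocone D hD ⟨m, m, le_rfl⟩).ι m le_rfl le_rfl) h).trans
      ((Category.id_comp _).trans (Category.comp_id _).symm))
  · exact absurd (h₁.trans_lt (Nat.lt_of_succ_le h₂)) (lt_irrefl _)

/-- Over an interval of length 1 the diagram c_k → d_k ← c_{k+1} has the terminal vertex d_k, which
is its colimit. -/
theorem isIso_fillCocone_κ (k : ℕ) :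
    IsIso ((fillCocone D hD ⟨k, k + 1, k.le_succ⟩).κ k le_rfl le_rfl) := by
  have hk : ∀ {m}, k ≤ m → m + 1 ≤ k + 1 → m = k := by intros; omega
  have hk' : ∀ {m}, k ≤ m → m ≤ k + 1 → m ≠ k → m = k + 1 := by intros; omega
  let v : D.Cocone ⟨k, k + 1, k.le_succ⟩ (D.d k) :=
    { ι := fun m h₁ h₂ => if h : m = k then eqToHom (congrArg D.c h) ≫ D.l k else
        eqToHom (congrArg D.c (hk' h₁ h₂ h)) ≫ D.r k
      κ := fun _ h₁ h₂ => eqToHom (congrArg D.d (hk h₁ h₂))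
      l_κ := fun m h₁ h₂ => by
        obtain rfl := hk h₁ h₂
        simp
      r_κ := fun m h₁ h₂ => by
        obtain rfl := hk h₁ h₂
        simp }
  have h : (fillCocone D hD ⟨k, k + 1, k.le_succ⟩).κ k le_rfl le_rfl ≫ desc D hD v = 𝟙 _ := κ_desc D hD v k le_rfl le_rfl
  have h2 : ∀ m h₁ h₂, (fillCocone D hD ⟨k, k + 1, k.le_succ⟩).κ m h₁ h₂ ≫
      desc D hD v ≫ (fillCocone D hD ⟨k, k + 1, k.le_succ⟩).κ k le_rfl le_rfl = (fillCocone D hD ⟨k, k + 1, k.le_succ⟩).κ m h₁ h₂ := by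
    intro m h₁ h₂
    obtain rfl := hk h₁ h₂
    exact (Category.assoc _ _ _).symm.trans ((congrArg (fun f => f ≫ (fillCocone D hD ⟨m, m + 1, m.le_succ⟩).κ m le_rfl le_rfl) h).trans
      (Category.id_comp _))
  refine ⟨desc D hD v, h, fill_hom_ext D hD ?_⟩
  ext m h₁ h₂
  · rw [Cocone.comp_id]
    rw [Cocone.comp_ι]
    by_cases hm : m = k
    · subst hm
      rw [← Cocone.l_κ _ m le_rfl le_rfl, Category.assoc, h2]
    · obtain rfl := hk' h₁ h₂ hm
      rw [← Cocone.r_κ _ k le_rfl le_rfl, Category.assoc, h2]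
  · rw [Cocone.comp_id]
    exact h2 m h₁ h₂

instance isIso_unit_c (k : ℕ) : IsIso ((unit D hD).c k) := isIso_fillCocone_ι D hD k

instance isIso_unit_d (k : ℕ) : IsIso ((unit D hD).d k) := isIso_fillCocone_κ D hD k

variable {D}

/-- The natural transformation out of `fill D` given by a morphism of zigzags. -/
noncomputable def lift {F : Tw ℕ ⥤ C} (φ : D ⟶ ofFunctor.obj F) : fill D hD ⟶ F where
  app x := desc D hD ((functorCocone F x).pre φ)
  naturality {x y} f := fill_hom_ext D hD (by
    refine (Cocone.comp_comp _ _ _).trans (Eq.trans ?_ (Cocone.comp_comp _ _ _).symm)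
    refine (congrArg (fun w => Cocone.comp w _) (comp_desc D hD _)).trans ?_
    refine (congrArg (Cocone.restrict f) (comp_desc D hD ((functorCocone F y).pre φ))).trans ?_
    refine Eq.trans ?_ (congrArg (fun w => Cocone.comp w _) (comp_desc D hD _)).symm
    refine (congrArg (Cocone.pre φ) (functorCocone_comp_map F f)).symm.trans ?_
    ext <;> simp)

theorem unit_lift {F : Tw ℕ ⥤ C} (φ : D ⟶ ofFunctor.obj F) :
    unit D hD ≫ ofFunctor.map (lift hD φ) = φ := by
  refine Hom.ext (funext fun k => ?_) (funext fun k => ?_)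
  · refine (ι_desc D hD _ k le_rfl le_rfl).trans ?_
    change φ.c k ≫ F.map (𝟙 _) = _
    rw [F.map_id]
    exact Category.comp_id _
  · refine (κ_desc D hD _ k le_rfl le_rfl).trans ?_
    change φ.d k ≫ F.map (𝟙 _) = _
    rw [F.map_id]
    exact Category.comp_id _

/-- The colimit over an interval is covered by its objects c_k and d_k, and naturality determines a
transformation from its components there. -/
theorem fill_natTrans_ext {F : Tw ℕ ⥤ C} {α β : fill D hD ⟶ F}
    (h : unit D hD ≫ ofFunctor.map α = unit D hD ≫ ofFunctor.map β) : α = β := by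
  ext x
  refine fill_hom_ext D hD ?_
  ext k h₁ h₂
  · exact comp_app_eq_of_comp_app_eq α β _
      (ι_map D hD (homOfLE ⟨h₁, h₂⟩ : (⟨k, k, le_rfl⟩ : Tw ℕ) ⟶ x) k le_rfl le_rfl)
      (congrArg (fun w => Hom.c w k) h)
  · exact comp_app_eq_of_comp_app_eq α β _
      (κ_map D hD (homOfLE ⟨h₁, h₂⟩ : (⟨k, k + 1, k.le_succ⟩ : Tw ℕ) ⟶ x) k le_rfl le_rfl)
      (congrArg (fun w => Hom.d w k) h)

end

end Zigzag

/-! ### Cobordism axioms for the generated functor -/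

namespace Zigzag

section

variable {C : Type u} [Category.{v} C] {D : Zigzag C}

/-- Cocones over overlapping intervals which agree on the intersection come from a unique cocone
over the union. -/
theorem Cocone.exists_amalgam {i j k l : ℕ} (hij : i ≤ j) (hjk : j ≤ k) (hkl : k ≤ l) {Y : C}
    (v : D.Cocone ⟨i, k, hij.trans hjk⟩ Y) (v' : D.Cocone ⟨j, l, hjk.trans hkl⟩ Y)
    (h : v.restrict (Tw.left hij hjk) = v'.restrict (Tw.right hjk hkl)) :
    ∃ u : D.Cocone ⟨i, l, hij.trans (hjk.trans hkl)⟩ Y,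
      u.restrict (Tw.right (hij.trans hjk) hkl) = v ∧
      u.restrict (Tw.left hij (hjk.trans hkl)) = v' := by
  have hι : ∀ m h₁ h₂ h₃ h₄, v.ι m h₁ h₂ = v'.ι m h₃ h₄ := fun m _ h₂ h₃ _ =>
    congrArg (fun w => w.ι m h₃ h₂) h
  have hκ : ∀ m h₁ h₂ h₃ h₄, v.κ m h₁ h₂ = v'.κ m h₃ h₄ := fun m _ h₂ h₃ _ =>
    congrArg (fun w => w.κ m h₃ h₂) h
  have e : ∀ {m}, ¬ m ≤ k → j ≤ m := by intros; omega
  have e' : ∀ {m}, ¬ m + 1 ≤ k → j ≤ m := by intros; omega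
  let u : D.Cocone ⟨i, l, hij.trans (hjk.trans hkl)⟩ Y :=
    { ι := fun m h₁ h₂ => if h : m ≤ k then v.ι m h₁ h else v'.ι m (e h) h₂
      κ := fun m h₁ h₂ => if h : m + 1 ≤ k then v.κ m h₁ h else v'.κ m (e' h) h₂
      l_κ := fun m h₁ h₂ => by
        by_cases h : m + 1 ≤ k
        · have h' : m ≤ k := by omega
          simp only [h, h', dite_true, v.l_κ]
        · by_cases h' : m ≤ k
          · simp only [h, h', dite_true, dite_false, v'.l_κ]
            exact (hι _ _ _ _ _).symm
          · simp only [h, h', dite_false, v'.l_κ]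
      r_κ := fun m h₁ h₂ => by
        by_cases h : m + 1 ≤ k
        · simp only [h, dite_true, v.r_κ]
        · simp only [h, dite_false, v'.r_κ] }
  refine ⟨u, ?_, ?_⟩
  · ext m h₁ h₂
    · exact dif_pos h₂
    · exact dif_pos h₂
  · ext m h₁ h₂
    · by_cases h : m ≤ k
      · exact (dif_pos h).trans (hι _ _ _ _ _)
      · exact dif_neg h
    · by_cases h : m + 1 ≤ k
      · exact (dif_pos h).trans (hκ _ _ _ _ _)
      · exact dif_neg h

theorem Cocone.ext_of_restrict {i j k l : ℕ} (hij : i ≤ j) (hjk : j ≤ k) (hkl : k ≤ l) {Y : C}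
    {u u' : D.Cocone ⟨i, l, hij.trans (hjk.trans hkl)⟩ Y}
    (h : u.restrict (Tw.right (hij.trans hjk) hkl) = u'.restrict (Tw.right (hij.trans hjk) hkl))
    (h' : u.restrict (Tw.left hij (hjk.trans hkl)) = u'.restrict (Tw.left hij (hjk.trans hkl))) :
    u = u' := by
  ext m h₁ h₂
  · by_cases hm : m ≤ k
    · exact congrArg (fun w => w.ι m h₁ hm) h
    · exact congrArg (fun w => w.ι m (by dsimp; omega) h₂) h'
  · by_cases hm : m + 1 ≤ k
    · exact congrArg (fun w => w.κ m h₁ hm) h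
    · exact congrArg (fun w => w.κ m (by dsimp; omega) h₂) h'

end

variable {C : Type u} [Category.{v} C] [UnpointedWaldhausenCategory C]

open UnpointedWaldhausenCategory

theorem cof_of_comp_eq {A B A' B' : C} {e : A ⟶ A'} {f : A ⟶ B} {e' : B ⟶ B'} {g : A' ⟶ B'}
    (he : IsIso e) (he' : IsIso e') (h : f ≫ e' = e ≫ g) (hf : cof f) : cof g := by
  rw [← (IsIso.inv_comp_eq e).2 h]
  exact cof_comp _ _ (cof_of_isIso _ inferInstance) (cof_comp _ _ hf (cof_of_isIso _ he'))

theorem weq_of_comp_eq {A B A' B' : C} {e : A ⟶ A'} {f : A ⟶ B} {e' : B ⟶ B'} {g : A' ⟶ B'}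
    (he : IsIso e) (he' : IsIso e') (h : f ≫ e' = e ≫ g) (hf : weq f) : weq g := by
  rw [← (IsIso.inv_comp_eq e).2 h]
  exact weq_comp _ _ (weq_of_isIso _ inferInstance) (weq_comp _ _ hf (weq_of_isIso _ he'))

section

variable (D : Zigzag C) (hD : ∀ k, cof (D.l k))

theorem comp_fill_map {x y : Tw ℕ} (f : x ⟶ y) :
    (fillCocone D hD x).comp ((fill D hD).map f) = (fillCocone D hD y).restrict f :=
  comp_desc D hD _

theorem comp_fill_map_comp {x y : Tw ℕ} (f : x ⟶ y) {Y : C} (g : (fill D hD).obj y ⟶ Y) :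
    (fillCocone D hD x).comp ((fill D hD).map f ≫ g) =
      ((fillCocone D hD y).comp g).restrict f :=
  (Cocone.comp_comp _ _ _).trans (congrArg (fun w => Cocone.comp w g) (comp_fill_map D hD f))

/-- Cocones over [i, l] are the same as pairs of cocones over [i, k] and [j, l] that agree on [j,
k]; corepresenting both sides gives the pushout square. -/
theorem isPushout_fill {i j k l : ℕ} (hij : i ≤ j) (hjk : j ≤ k) (hkl : k ≤ l) :
    IsPushout ((fill D hD).map (Tw.left hij hjk)) ((fill D hD).map (Tw.right hjk hkl))
      ((fill D hD).map (Tw.right (hij.trans hjk) hkl))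
      ((fill D hD).map (Tw.left hij (hjk.trans hkl))) := by
  have w : (fill D hD).map (Tw.left hij hjk) ≫ (fill D hD).map (Tw.right (hij.trans hjk) hkl) =
      (fill D hD).map (Tw.right hjk hkl) ≫ (fill D hD).map (Tw.left hij (hjk.trans hkl)) := by
    rw [← Functor.map_comp, ← Functor.map_comp]
    rfl
  have key : ∀ {Y : C} (a : (fill D hD).obj ⟨i, k, hij.trans hjk⟩ ⟶ Y)
      (b : (fill D hD).obj ⟨j, l, hjk.trans hkl⟩ ⟶ Y),
      (fill D hD).map (Tw.left hij hjk) ≫ a = (fill D hD).map (Tw.right hjk hkl) ≫ b →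
      ∃ g : (fill D hD).obj ⟨i, l, hij.trans (hjk.trans hkl)⟩ ⟶ Y,
        (fill D hD).map (Tw.right (hij.trans hjk) hkl) ≫ g = a ∧
        (fill D hD).map (Tw.left hij (hjk.trans hkl)) ≫ g = b := by
    intro Y a b hab
    obtain ⟨u, h1, h2⟩ := Cocone.exists_amalgam hij hjk hkl
      ((fillCocone D hD ⟨i, k, hij.trans hjk⟩).comp a)
      ((fillCocone D hD ⟨j, l, hjk.trans hkl⟩).comp b)
      ((comp_fill_map_comp D hD _ a).symm.trans
        ((congrArg (Cocone.comp _) hab).trans (comp_fill_map_comp D hD _ b)))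
    refine ⟨desc D hD u, fill_hom_ext D hD ?_, fill_hom_ext D hD ?_⟩
    · exact (comp_fill_map_comp D hD _ _).trans
        ((congrArg (Cocone.restrict _) (comp_desc D hD u)).trans h1)
    · exact (comp_fill_map_comp D hD _ _).trans
        ((congrArg (Cocone.restrict _) (comp_desc D hD u)).trans h2)
  have uniq : ∀ {Y : C} {g g' : (fill D hD).obj ⟨i, l, hij.trans (hjk.trans hkl)⟩ ⟶ Y},
      (fill D hD).map (Tw.right (hij.trans hjk) hkl) ≫ g =
        (fill D hD).map (Tw.right (hij.trans hjk) hkl) ≫ g' →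
      (fill D hD).map (Tw.left hij (hjk.trans hkl)) ≫ g =
        (fill D hD).map (Tw.left hij (hjk.trans hkl)) ≫ g' → g = g' := by
    intro Y g g' h h'
    refine fill_hom_ext D hD (Cocone.ext_of_restrict hij hjk hkl ?_ ?_)
    · exact (comp_fill_map_comp D hD _ g).symm.trans
        ((congrArg (Cocone.comp _) h).trans (comp_fill_map_comp D hD _ g'))
    · exact (comp_fill_map_comp D hD _ g).symm.trans
        ((congrArg (Cocone.comp _) h').trans (comp_fill_map_comp D hD _ g'))
  exact ⟨⟨w⟩, ⟨PushoutCocone.IsColimit.mk _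
    (fun s => (key s.inl s.inr s.condition).choose)
    (fun s => (key s.inl s.inr s.condition).choose_spec.1)
    (fun s => (key s.inl s.inr s.condition).choose_spec.2)
    (fun s m h1 h2 => uniq (h1.trans (key s.inl s.inr s.condition).choose_spec.1.symm)
      (h2.trans (key s.inl s.inr s.condition).choose_spec.2.symm))⟩⟩

/-- A horizontal map is a composite of one-step extensions, each a pushout of one of the
cofibrations c_k → d_k. -/
theorem isCob_fill : IsCob C (fill D hD) where
  isPushout := isPushout_fill D hD
  cof_right {i j k} hij hjk := by
    have h0 : ∀ j : ℕ, cof ((fill D hD).map (Tw.right le_rfl j.le_succ)) := by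
      intro j
      exact cof_of_comp_eq (isIso_unit_c D hD j) (isIso_unit_d D hD j) ((unit D hD).l_d j) (hD j)
    induction k, hjk using Nat.le_induction with
    | base => exact cof_of_isIso _ (inferInstanceAs (IsIso ((fill D hD).map (𝟙 _))))
    | succ k hjk ih =>
      have h := cof_of_isPushout (isPushout_fill D hD (hij.trans hjk) le_rfl k.le_succ) (h0 k)
      have := cof_comp _ _ ih h
      rwa [← Functor.map_comp] at this

end

/-- A natural transformation between cobordisms is a weak equivalence if it is one on objects and
elementary cobordisms. -/
theorem weq_of_generators {F G : Tw ℕ ⥤ C} (hF : IsCob C F) (hG : IsCob C G) (α : F ⟶ G)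
    (h₁ : ∀ k, weq (α.app ⟨k, k, le_rfl⟩)) (h₂ : ∀ k, weq (α.app ⟨k, k + 1, k.le_succ⟩))
    (x : Tw ℕ) : weq (α.app x) := by
  obtain ⟨i, j, hij⟩ := x
  induction j, hij using Nat.le_induction with
  | base => exact h₁ i
  | succ j hij ih =>
    -- The value at (i, j + 1) is the pushout of those at (i, j) and (j, j + 1) over the one at (j,
    -- j), and the map on it is induced.
    exact gluing _ _ _ _ (hF.isPushout hij le_rfl j.le_succ) (hG.isPushout hij le_rfl j.le_succ)
      (hF.cof_right le_rfl j.le_succ) (hG.cof_right le_rfl j.le_succ) (α.naturality _)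
      (α.naturality _) (α.naturality _) (α.naturality _) (h₁ j) (h₂ j) ih

end Zigzag

/-! ### Symmetric replacement of a cobordism -/

section Symmetrization

variable {C : Type u} [Category.{v} C] [UnpointedWaldhausenCategory C]

open UnpointedWaldhausenCategory

theorem isPushout_coprod [HasCofibrantInitial C] (X Y : C) :
    IsPushout (initial.to X) (initial.to Y) (coprod.inl : X ⟶ X ⨿ Y) coprod.inr :=
  ⟨⟨Subsingleton.elim _ _⟩, ⟨PushoutCocone.IsColimit.mk _ (fun s => coprod.desc s.inl s.inr)
    (fun _ => coprod.inl_desc _ _) (fun _ => coprod.inr_desc _ _) (fun s m h1 h2 => by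
      apply coprod.hom_ext
      · rw [h1, coprod.inl_desc]
      · rw [h2, coprod.inr_desc])⟩⟩

theorem cof_coprod_inl [HasCofibrantInitial C] (X Y : C) : cof (coprod.inl : X ⟶ X ⨿ Y) :=
  cof_of_isPushout (isPushout_coprod X Y) (HasCofibrantInitial.cof_initial_to Y)

theorem comp_square_comp {J : Type*} [Category J] {X X' Y Y' Z Z' : J} {e : X ⟶ Y} {i : Y ⟶ Z}
    {e' : X' ⟶ Y'} {i' : Y' ⟶ Z'} {a : X ⟶ X'} {m : Y ⟶ Y'} {z : Z ⟶ Z'}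
    (h₁ : e ≫ m = a ≫ e') (h₂ : m ≫ i' = i ≫ z) : (e ≫ i) ≫ z = a ≫ e' ≫ i' := by
  rw [Category.assoc, ← h₂, ← Category.assoc, h₁, Category.assoc]

theorem cof_coprod_desc_of_iso [HasCofibrantInitial C] {A₁ A₂ B A₁' A₂' B' : C} {e₁ : A₁ ⟶ A₁'}
    {e₂ : A₂ ⟶ A₂'} {e : B ⟶ B'} {f₁ : A₁ ⟶ B} {f₂ : A₂ ⟶ B} {g₁ : A₁' ⟶ B'} {g₂ : A₂' ⟶ B'}
    (he₁ : IsIso e₁) (he₂ : IsIso e₂) (he : IsIso e) (h₁ : f₁ ≫ e = e₁ ≫ g₁)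
    (h₂ : f₂ ≫ e = e₂ ≫ g₂) (h : cof (coprod.desc f₁ f₂)) : cof (coprod.desc g₁ g₂) := by
  refine Zigzag.cof_of_comp_eq (e := coprod.map e₁ e₂) inferInstance he ?_ h
  rw [coprod.desc_comp, coprod.map_desc, h₁, h₂]

/-- The gluing lemma over the initial object. It is needed because `T` is applied to maps out of
coproducts. -/
theorem weq_coprod_map [HasCofibrantInitial C] {A₁ A₂ B₁ B₂ : C} {f₁ : A₁ ⟶ B₁} {f₂ : A₂ ⟶ B₂}
    (h₁ : weq f₁) (h₂ : weq f₂) : weq (coprod.map f₁ f₂) :=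
  gluing (𝟙 (⊥_ C)) f₂ f₁ _ (isPushout_coprod A₁ A₂) (isPushout_coprod B₁ B₂)
    (HasCofibrantInitial.cof_initial_to _) (HasCofibrantInitial.cof_initial_to _)
    (Subsingleton.elim _ _) (Subsingleton.elim _ _) (coprod.inl_map _ _) (coprod.inr_map _ _)
    (weq_of_isIso _ inferInstance) h₂ h₁

theorem cof_coprod_desc_fill [HasCofibrantInitial C] (D : Zigzag C) (hD : ∀ k, cof (D.l k))
    (h : ∀ k, cof (coprod.desc (D.l k) (D.r k))) (k : ℕ) :
    cof (coprod.desc ((D.fill hD).map (Tw.right le_rfl k.le_succ))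
      ((D.fill hD).map (Tw.left k.le_succ le_rfl))) := by
  exact cof_coprod_desc_of_iso (Zigzag.isIso_unit_c D hD k) (Zigzag.isIso_unit_c D hD (k + 1))
    (Zigzag.isIso_unit_d D hD k) ((D.unit hD).l_d k) ((D.unit hD).r_d k) (h k)

variable [HasCofibrantInitial C]
  (T : MorphismProperty.FunctorialFactorizationData (cof (C := C)) (weq (C := C)))

/-- The two boundary inclusions of an elementary cobordism. -/
noncomputable abbrev boundaryArrow (F : Tw ℕ ⥤ C) (k : ℕ) : Arrow C :=
  Arrow.mk (coprod.desc (F.map (Tw.right le_rfl k.le_succ) :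
      F.obj ⟨k, k, le_rfl⟩ ⟶ F.obj ⟨k, k + 1, k.le_succ⟩)
    (F.map (Tw.left k.le_succ le_rfl) : F.obj ⟨k + 1, k + 1, le_rfl⟩ ⟶ _))

/-- The map of boundary inclusions induced by a map of cobordisms. -/
noncomputable def boundaryMap {F G : Tw ℕ ⥤ C} (α : F ⟶ G) (k : ℕ) :
    boundaryArrow F k ⟶ boundaryArrow G k :=
  Arrow.homMk (coprod.map (α.app _) (α.app _)) (α.app _) (by
    apply coprod.hom_ext
    · simp
    · simp)

theorem boundaryMap_id (F : Tw ℕ ⥤ C) (k : ℕ) : boundaryMap (𝟙 F) k = 𝟙 _ := by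
  ext
  · exact coprod.map_id_id
  · rfl

theorem boundaryMap_comp {F G H : Tw ℕ ⥤ C} (α : F ⟶ G) (β : G ⟶ H) (k : ℕ) :
    boundaryMap (α ≫ β) k = boundaryMap α k ≫ boundaryMap β k := by
  ext
  · exact (coprod.map_map _ _ _ _).symm
  · rfl

/-- The zigzag obtained from a cobordism by replacing the boundary inclusions by cofibrations. -/
noncomputable def symZigzag : (Tw ℕ ⥤ C) ⥤ Zigzag C where
  obj F :=
    { c := fun k => F.obj ⟨k, k, le_rfl⟩
      d := fun k => T.Z.obj (boundaryArrow F k)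
      l := fun k => coprod.inl ≫ T.i.app (boundaryArrow F k)
      r := fun k => coprod.inr ≫ T.i.app (boundaryArrow F k) }
  map α :=
    { c := fun k => α.app _
      d := fun k => T.Z.map (boundaryMap α k)
      l_d := fun k => comp_square_comp (coprod.inl_map _ _) (T.i.naturality (boundaryMap α k))
      r_d := fun k => comp_square_comp (coprod.inr_map _ _) (T.i.naturality (boundaryMap α k)) }
  map_id F := by
    refine Zigzag.Hom.ext rfl (funext fun k => ?_)
    change T.Z.map (boundaryMap (𝟙 F) k) = 𝟙 _
    rw [boundaryMap_id, CategoryTheory.Functor.map_id]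
  map_comp α β := by
    refine Zigzag.Hom.ext rfl (funext fun k => ?_)
    change T.Z.map (boundaryMap (α ≫ β) k) = T.Z.map _ ≫ T.Z.map _
    rw [boundaryMap_comp, T.Z.map_comp]

/-- The projection of the zigzag with cofibrant boundary inclusions. -/
noncomputable def symZigzagProj (F : Tw ℕ ⥤ C) :
    (symZigzag T).obj F ⟶ Zigzag.ofFunctor.obj F where
  c k := 𝟙 _
  d k := T.p.app (boundaryArrow F k)
  l_d k := by
    refine (Category.assoc _ _ _).trans ((congrArg (fun w => coprod.inl ≫ w) T.fac_app).trans ?_)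
    exact (coprod.inl_desc _ _).trans (Category.id_comp _).symm
  r_d k := by
    refine (Category.assoc _ _ _).trans ((congrArg (fun w => coprod.inr ≫ w) T.fac_app).trans ?_)
    exact (coprod.inr_desc _ _).trans (Category.id_comp _).symm

theorem symZigzagProj_naturality {F G : Tw ℕ ⥤ C} (α : F ⟶ G) :
    (symZigzag T).map α ≫ symZigzagProj T G = symZigzagProj T F ≫ Zigzag.ofFunctor.map α := by
  refine Zigzag.Hom.ext (funext fun k => ?_) (funext fun k => ?_)
  · exact (Category.comp_id _).trans (Category.id_comp _).symm
  · exact T.p.naturality (boundaryMap α k)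

theorem cof_desc_symZigzag (F : Tw ℕ ⥤ C) (k : ℕ) :
    cof (coprod.desc (((symZigzag T).obj F).l k) (((symZigzag T).obj F).r k)) := by
  have : coprod.desc (((symZigzag T).obj F).l k) (((symZigzag T).obj F).r k) =
      T.i.app (boundaryArrow F k) := by
    apply coprod.hom_ext
    · exact coprod.inl_desc _ _
    · exact coprod.inr_desc _ _
  rw [this]
  exact T.hi _

theorem cof_symZigzag_l (F : Tw ℕ ⥤ C) (k : ℕ) : cof (((symZigzag T).obj F).l k) :=
  cof_comp _ _ (cof_coprod_inl _ _) (T.hi (boundaryArrow F k))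

/-- The symmetric replacement of a cobordism. -/
noncomputable def symmetrize : (Tw ℕ ⥤ C) ⥤ (Tw ℕ ⥤ C) where
  obj F := ((symZigzag T).obj F).fill (cof_symZigzag_l T F)
  map {F G} α := Zigzag.lift _ ((symZigzag T).map α ≫ Zigzag.unit _ (cof_symZigzag_l T G))
  map_id F := Zigzag.fill_natTrans_ext _ (by
    rw [Zigzag.unit_lift, CategoryTheory.Functor.map_id, CategoryTheory.Functor.map_id,
      Category.comp_id, Category.id_comp])
  map_comp {F G H} α β := Zigzag.fill_natTrans_ext _ (by
    rw [Zigzag.unit_lift, Zigzag.ofFunctor.map_comp, ← Category.assoc, Zigzag.unit_lift,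
      Category.assoc, Zigzag.unit_lift, (symZigzag T).map_comp, Category.assoc])

theorem unit_symmetrize_map {F G : Tw ℕ ⥤ C} (α : F ⟶ G) :
    Zigzag.unit _ (cof_symZigzag_l T F) ≫ Zigzag.ofFunctor.map ((symmetrize T).map α) =
      (symZigzag T).map α ≫ Zigzag.unit _ (cof_symZigzag_l T G) :=
  Zigzag.unit_lift _ _

/-- The comparison of a cobordism with its symmetric replacement. -/
noncomputable def symmetrizeProj : symmetrize T ⟶ 𝟭 (Tw ℕ ⥤ C) where
  app F := Zigzag.lift (cof_symZigzag_l T F) (symZigzagProj T F)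
  naturality F G α := Zigzag.fill_natTrans_ext _ (by
    have h₁ := Zigzag.unit_lift (cof_symZigzag_l T F) (symZigzagProj T F)
    have h₂ := Zigzag.unit_lift (cof_symZigzag_l T G) (symZigzagProj T G)
    have h₃ : Zigzag.unit _ (cof_symZigzag_l T F) ≫
        Zigzag.ofFunctor.map ((symmetrize T).map α) ≫
          Zigzag.ofFunctor.map (Zigzag.lift (cof_symZigzag_l T G) (symZigzagProj T G)) =
        (symZigzag T).map α ≫ symZigzagProj T G :=
      (Category.assoc _ _ _).symm.trans ((congrArg (fun w => w ≫ _) (unit_symmetrize_map T α)).trans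
        ((Category.assoc _ _ _).trans (congrArg (fun w => _ ≫ w) h₂)))
    have h₄ : Zigzag.unit _ (cof_symZigzag_l T F) ≫
        Zigzag.ofFunctor.map (Zigzag.lift (cof_symZigzag_l T F) (symZigzagProj T F)) ≫
          Zigzag.ofFunctor.map α = symZigzagProj T F ≫ Zigzag.ofFunctor.map α :=
      (Category.assoc _ _ _).symm.trans (congrArg (fun w => w ≫ _) h₁)
    exact h₃.trans ((symZigzagProj_naturality T α).trans h₄.symm))

theorem isCob_symmetrize (F : Tw ℕ ⥤ C) : IsCob C ((symmetrize T).obj F) :=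
  Zigzag.isCob_fill _ _

/-- On the generators the projection is, up to isomorphism, the identity of F_kk and the weak
equivalence in the factorization; gluing propagates this to all intervals. -/
theorem weq_symmetrizeProj {F : Tw ℕ ⥤ C} (hF : IsCob C F) (x : Tw ℕ) :
    weq (((symmetrizeProj T).app F).app x) := by
  have h := Zigzag.unit_lift (cof_symZigzag_l T F) (symZigzagProj T F)
  refine Zigzag.weq_of_generators (isCob_symmetrize T F) hF _ (fun k => ?_) (fun k => ?_) x
  · exact Zigzag.weq_of_comp_eq (Zigzag.isIso_unit_c _ (cof_symZigzag_l T F) k)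
      (IsIso.id (F.obj ⟨k, k, le_rfl⟩))
      ((Category.comp_id _).trans (congrArg (fun w => Zigzag.Hom.c w k) h).symm)
      (weq_of_isIso (𝟙 (F.obj ⟨k, k, le_rfl⟩)) inferInstance)
  · exact Zigzag.weq_of_comp_eq (Zigzag.isIso_unit_d _ (cof_symZigzag_l T F) k)
      (IsIso.id (F.obj ⟨k, k + 1, k.le_succ⟩))
      ((Category.comp_id _).trans (congrArg (fun w => Zigzag.Hom.d w k) h).symm)
      (T.hp (boundaryArrow F k))

/-- Here it is used that `T` preserves objectwise weak equivalences; without it, `symmetrize` would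
not act on the morphisms of `w Cob(C)_n`. -/
theorem weq_symmetrize_map
    (hT : ∀ {f g : Arrow C} (φ : f ⟶ g), weq φ.left → weq φ.right → weq (T.Z.map φ))
    {F G : Tw ℕ ⥤ C} (α : F ⟶ G) (hα : ∀ x, weq (α.app x)) (x : Tw ℕ) :
    weq (((symmetrize T).map α).app x) := by
  have h := unit_symmetrize_map T α
  refine Zigzag.weq_of_generators (isCob_symmetrize T F) (isCob_symmetrize T G) _
    (fun k => ?_) (fun k => ?_) x
  · exact Zigzag.weq_of_comp_eq (Zigzag.isIso_unit_c _ (cof_symZigzag_l T F) k)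
      (Zigzag.isIso_unit_c _ (cof_symZigzag_l T G) k)
      (congrArg (fun w => Zigzag.Hom.c w k) h).symm (hα _)
  · exact Zigzag.weq_of_comp_eq (Zigzag.isIso_unit_d _ (cof_symZigzag_l T F) k)
      (Zigzag.isIso_unit_d _ (cof_symZigzag_l T G) k)
      (congrArg (fun w => Zigzag.Hom.d w k) h).symm
      (hT _ (weq_coprod_map (hα _) (hα _)) (hα _))

theorem cof_desc_symmetrize (F : Tw ℕ ⥤ C) (k : ℕ) :
    cof (coprod.desc (((symmetrize T).obj F).map (Tw.right le_rfl k.le_succ))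
      (((symmetrize T).obj F).map (Tw.left k.le_succ le_rfl))) :=
  cof_coprod_desc_fill _ _ (cof_desc_symZigzag T F) k

/-! ### The levels of the cobordism category -/

variable (n : ℕ)

/-- The retraction of `ℕ` onto `{0, …, n}`. -/
def clamp : ℕ →o Fin (n + 1) :=
  ⟨fun k => ⟨min k n, by omega⟩, fun _ _ h => min_le_min_right n h⟩

/-- The inclusion of `{0, …, n}` in `ℕ`. -/
def finVal : Fin (n + 1) →o ℕ := ⟨fun i => i, fun _ _ h => h⟩

theorem clamp_finVal (i : Fin (n + 1)) : clamp n (finVal n i) = i :=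
  Fin.ext (min_eq_left (Nat.le_of_lt_succ i.2))

/-- Restricting to `{0, …, n}` the extension of a functor changes nothing. -/
def clampFinVal : Tw.map (finVal n) ⋙ Tw.map (clamp n) ⟶ 𝟭 (Tw (Fin (n + 1))) where
  app x := homOfLE ⟨(clamp_finVal n x.src).ge, (clamp_finVal n x.tgt).le⟩

instance (x : Tw (Fin (n + 1))) : IsIso ((clampFinVal n).app x) :=
  ⟨homOfLE ⟨(clamp_finVal n x.src).le, (clamp_finVal n x.tgt).ge⟩, rfl, rfl⟩

/-- Symmetric replacement on the level `n` of the cobordism category. -/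
noncomputable def wSymmetrize
    (hT : ∀ {f g : Arrow C} (φ : f ⟶ g), weq φ.left → weq φ.right → weq (T.Z.map φ)) :
    WFun (IsCob C (P := Fin (n + 1))) ⥤ WFun (IsSymCob C (n := n)) where
  obj F :=
    -- The functor on tw [n] is extended to ℕ by repeating the last vertex, replaced there, and
    -- restricted back, so that zigzags need no length parameter.
    { functor := Tw.map (finVal n) ⋙ (symmetrize T).obj (Tw.map (clamp n) ⋙ F.functor)
      prop :=
        { toIsCob := (isCob_symmetrize T _).restrict (finVal n)
          cof_desc := fun i => cof_desc_symmetrize T (Tw.map (clamp n) ⋙ F.functor) i } }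
  map α :=
    { trans := Functor.whiskerLeft (Tw.map (finVal n))
        ((symmetrize T).map (Functor.whiskerLeft (Tw.map (clamp n)) α.trans))
      weq_app := fun _ => weq_symmetrize_map T hT _ (fun _ => α.weq_app _) _ }
  map_id F := WFun.Hom.ext (congrArg (Functor.whiskerLeft (Tw.map (finVal n)))
    ((symmetrize T).map_id (Tw.map (clamp n) ⋙ F.functor)))
  map_comp α β := WFun.Hom.ext (congrArg (Functor.whiskerLeft (Tw.map (finVal n)))
    ((symmetrize T).map_comp (Functor.whiskerLeft (Tw.map (clamp n)) α.trans)
      (Functor.whiskerLeft (Tw.map (clamp n)) β.trans)))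

/-- The natural weak equivalence from the symmetric replacement, on underlying functors. -/
noncomputable def wSymmetrizeProjTrans (F : Tw (Fin (n + 1)) ⥤ C) :
    Tw.map (finVal n) ⋙ (symmetrize T).obj (Tw.map (clamp n) ⋙ F) ⟶ F where
  app x := ((symmetrizeProj T).app (Tw.map (clamp n) ⋙ F)).app ((Tw.map (finVal n)).obj x) ≫
    F.map ((clampFinVal n).app x)
  naturality x y f := by
    have h := ((symmetrizeProj T).app (Tw.map (clamp n) ⋙ F)).naturality
      ((Tw.map (finVal n)).map f)
    refine (Category.assoc _ _ _).symm.trans ((congrArg (fun w => w ≫ _) h).trans ?_)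
    refine (Category.assoc _ _ _).trans (Eq.trans ?_ (Category.assoc _ _ _).symm)
    refine congrArg (fun w => _ ≫ w) ?_
    exact (F.map_comp _ _).symm.trans (F.map_comp ((clampFinVal n).app x) f)

theorem wSymmetrizeProjTrans_weq {F : Tw (Fin (n + 1)) ⥤ C} (hF : IsCob C F)
    (x : Tw (Fin (n + 1))) : weq ((wSymmetrizeProjTrans T n F).app x) :=
  weq_comp _ _ (weq_symmetrizeProj T (hF.restrict (clamp n)) _) (weq_of_isIso _ inferInstance)

theorem wSymmetrizeProjTrans_naturality {F G : Tw (Fin (n + 1)) ⥤ C} (α : F ⟶ G) :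
    Functor.whiskerLeft (Tw.map (finVal n))
        ((symmetrize T).map (Functor.whiskerLeft (Tw.map (clamp n)) α)) ≫
      wSymmetrizeProjTrans T n G = wSymmetrizeProjTrans T n F ≫ α := by
  ext x
  have h := NatTrans.congr_app ((symmetrizeProj T).naturality
    (Functor.whiskerLeft (Tw.map (clamp n)) α)) ((Tw.map (finVal n)).obj x)
  refine (Category.assoc _ _ _).symm.trans ((congrArg (fun w => w ≫ _) h).trans ?_)
  refine (Category.assoc _ _ _).trans (Eq.trans ?_ (Category.assoc _ _ _).symm)
  exact congrArg (fun w => _ ≫ w) (α.naturality ((clampFinVal n).app x)).symm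

/-- Symmetric replacement is an inverse on a fixed level n. No compatibility between different n is
claimed or needed. -/
theorem nonempty_compatibleInverse_incl
    (hT : ∀ {f g : Arrow C} (φ : f ⟶ g), weq φ.left → weq φ.right → weq (T.Z.map φ)) :
    Nonempty (CompatibleInverse (SSet.toTop.map (nerveMap (WFun.incl (P := Fin (n + 1))
      (S := IsSymCob C) (S' := IsCob C) (fun _ h => h.toIsCob)))).hom) := by
  refine nonempty_compatibleInverse_nerve (L := wSymmetrize T n hT)
    { app := fun F => ⟨wSymmetrizeProjTrans T n F.functor,
        wSymmetrizeProjTrans_weq T n F.prop.toIsCob⟩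
      naturality := fun F G α => WFun.Hom.ext (wSymmetrizeProjTrans_naturality T n α.trans) }
    { app := fun F => ⟨wSymmetrizeProjTrans T n F.functor, wSymmetrizeProjTrans_weq T n F.prop⟩
      naturality := fun F G α => WFun.Hom.ext (wSymmetrizeProjTrans_naturality T n α.trans) }
    -- The same natural weak equivalence is used in both categories, which is possible because the
    -- symmetric objects form a full subcategory.
    fun F => rfl

end Symmetrization

/-! ### Assembly of the proof -/

section

variable (C : Type u) [Category.{v} C] [UnpointedWaldhausenCategory C]

open UnpointedWaldhausenCategory

theorem isCob_const {P : Type} [Preorder P] (X : C) : IsCob C ((Functor.const (Tw P)).obj X) where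
  cof_right _ _ := cof_of_isIso (𝟙 X) inferInstance
  isPushout _ _ _ := IsPushout.of_id_fst (f := 𝟙 X)

variable [HasCofibrantInitial C]

/-- In degree 0 the symmetry condition is vacuous, so the constant functor at the initial object
gives a point. The criterion for weak equivalences needs a point of the source. -/
theorem nonempty_bSymCob : Nonempty (BSymCob C) := by
  let F : WFun (IsSymCob C (n := 0)) :=
    ⟨(Functor.const _).obj (⊥_ C), { toIsCob := isCob_const C _, cof_desc := fun i => i.elim0 }⟩
  let x : (symCob C).obj (op ⦋0⦌ₛ) :=
    cell (q := ⦋0⦌) (nerve (WFun (IsSymCob C (n := 0)))) (ComposableArrows.mk₀ F)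
      (stdSimplex.vertex 0)
  exact ⟨Realization.point (ι := toSimplexCategory) (X := symCob C) ⦋0⦌ₛ x (stdSimplex.vertex 0)⟩

theorem hasDualLifting_symCobIncl (hC : HasFunctorialFactorizations C) {D : Type}
    [TopologicalSpace D] [LocallyCompactSpace D] (R : Radial D) :
    HasDualLifting (Realization.map toSimplexCategory (symCobIncl C)) R := by
  obtain ⟨T, hT⟩ := hC
  exact Realization.hasDualLifting_map (symCobIncl C)
    (fun n => (nonempty_compatibleInverse_incl T n hT).some) R

end

end CobordismCategory

open CobordismCategory in
theorem proposition2p10 (C : Type u) [Category.{v} C] [UnpointedWaldhausenCategory C]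
    [HasCofibrantInitial C] (hC : HasFunctorialFactorizations C) :
    IsWeakHomotopyEquivalence (CobordismCategory.inclusion C) := by
  have := nonempty_bSymCob C
  have : Nonempty (Realization SemiSimplexCategory.toSimplexCategory
      (SemiSimplexCategory.toSimplexCategory.op ⋙ cob C)) :=
    ‹Nonempty (BSymCob C)›.map
      (Realization.map SemiSimplexCategory.toSimplexCategory (symCobIncl C))
  -- For each factor, dual lifting is invoked twice: with a point and with the interval as parameter
  -- space.
  exact IsWeakHomotopyEquivalence.comp
    (isWeakHomotopyEquivalence_of_dualLifting
      (hasDualLifting_ofRestrict (wCob C ⋙ nerveFunctor) _)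
      (hasDualLifting_ofRestrict (wCob C ⋙ nerveFunctor) _))
    (isWeakHomotopyEquivalence_of_dualLifting (hasDualLifting_symCobIncl C hC _)
      (hasDualLifting_symCobIncl C hC _))
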